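/- **Notation.** Let $n\ge 1$, let $\mathbb K\in\{\mathbb R,\mathbb C\}$, and let $\mathcal S$ be the linear span over $\mathbb K$ of the indicators $1_I$ of all half-open axis-parallel cubes $I=\prod_i[a_i,a_i+\ell)\subset\mathbb R^n$. For a Banach space $X$ over $\mathbb K$ and $1<p<\infty$, $\beta_{p,X}$ denotes the unconditionality constant of martingale differences in $L^p(\mathbb R^n;X)$: the least $\beta\in[0,\infty]$ such that $$\Big\|\sum_{k<N}\varepsilon_k d_k\Big\|_{L^p(\mathbb R^n;X)}\le\beta\,\Big\|\sum_{k<N}d_k\Big\|_{L^p(\mathbb R^n;X)}$$ for all $N$, all signs $\varepsilon_k\in\{-1,1\}$, all $\sigma$-finite filtrations $(\mathcal F_k)$ of the Borel $\sigma$-algebra of $\mathbb R^n$ with Lebesgue measure, and all $d_k\in L^p(\mathbb R^n;X)$ such that $d_k$ is $\mathcal F_{k+1}$-measurable and $\mathbb E(d_k\mid\mathcal F_k)=0$. The space $X$ is UMD if, for every $p\in(1,\infty)$, the same inequality holds with one finite constant on all $\sigma$-finite measure spaces. Let $T$ be a linear operator from $\mathcal S$ to $L^1_{\mathrm{loc}}(\mathbb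 R^n;\mathbb K)$, and write $\langle g,Tf\rangle=\int g\,Tf\,dx$. Let $\alpha>0$ and let $C_K,C_W$ be constants. Suppose that there is a kernel $K$ with values in $\mathbb K$ such that, for every $f\in\mathcal S$, $$Tf(x)=\int_{\mathbb R^n}K(x,y)f(y)\,dy\qquad\text{for a.e. }x\notin\operatorname{supp}f,$$ and that the following hold. * Standard estimates: $|K(x,y)|\le C_K|x-y|^{-n}$ for $x\ne y$, and $$|K(x+h,y)-K(x,y)|+|K(x,y+h)-K(x,y)|\le\frac{C_K|h|^\alpha}{|x-y|^{n+\alpha}}\qquad\text{for }|x-y|>2|h|.$$ * Weak boundedness property: $|\langle 1_I,T1_I\rangle|\le C_W|I|$ for all cubes $I$. * $T(1)=T^*(1)=0$, that is, for all $h\in\mathcal S$ with $\int h=0$, $$\lim_{R\to\infty}\langle h,T1_{[-R,R)^n}\rangle=0\qquad\text{and}\qquad\lim_{R\to\infty}\langle 1_{[-R,R)^n},Th\rangle=0.$$ **Theorem 1.1.** Let $X$ be a UMD space and $1<p<\infty$, and let $T$ be as above. Then $T$ extends to a bounded linear operator on $L^p(\mathbb R^n;X)$; that is, there is a bounded $\mathbb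 K$-linear operator on $L^p(\mathbb R^n;X)$ which maps $f(\cdot)x$ to $(Tf)(\cdot)x$ for all $f\in\mathcal S$ and $x\in X$. Its norm satisfies $$\|T\|_{\mathcal L(L^p(\mathbb R^n;X))}\le C\,\beta_{p,X}^2,$$ where $C$ depends only on $n$, $\alpha$, $C_K$ and $C_W$. -/

import Mathlib

open MeasureTheory Filter Topology
open scoped ENNReal NNReal

noncomputable section

/-! ### Unconditional martingale differences -/

/-- `B` is an admissible constant in the unconditionality inequality
`‖∑ ε_k d_k‖_p ≤ B ‖∑ d_k‖_p`, for all signs `ε_k ∈ {-1, 1}` and all finite martingale difference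
sequences `d_0, …, d_{N-1}` in `L^p(S, μ; X)`, relative to σ-finite filtrations `ℱ`.
The last condition on `d k` says that its conditional expectation with respect to `ℱ k` vanishes;
it is written through integrals because the functions of `L^p(S, μ; X)` need not be integrable
when `μ` is infinite. -/
def IsUMDBound {S : Type*} [m : MeasurableSpace S] (μ : Measure S) (p : ℝ≥0∞)
    (X : Type*) [NormedAddCommGroup X] [NormedSpace ℝ X] (B : ℝ≥0∞) : Prop :=
  ∀ (ℱ : Filtration ℕ m) (d : ℕ → S → X) (ε : ℕ → ℝ) (N : ℕ),
    (∀ k, SigmaFinite (μ.trim (ℱ.le k))) →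
    (∀ k, StronglyMeasurable[ℱ (k + 1)] (d k)) →
    (∀ k, MemLp (d k) p μ) →
    (∀ k, ∀ A : Set S, MeasurableSet[ℱ k] A → μ A < ∞ → ∫ s in A, d k s ∂μ = 0) →
    (∀ k, ε k = 1 ∨ ε k = -1) →
    eLpNorm (fun s => ∑ k ∈ Finset.range N, ε k • d k s) p μ
      ≤ B * eLpNorm (fun s => ∑ k ∈ Finset.range N, d k s) p μ

/-- The unconditionality constant of martingale differences in `L^p(S, μ; X)`. -/
def umdConst {S : Type*} [MeasurableSpace S] (μ : Measure S) (p : ℝ≥0∞)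
    (X : Type*) [NormedAddCommGroup X] [NormedSpace ℝ X] : ℝ≥0∞ :=
  sInf {B | IsUMDBound μ p X B}

/-- The property of unconditional martingale differences: for every `p ∈ (1, ∞)` the
unconditionality inequality holds with one finite constant on all σ-finite measure spaces. -/
def IsUMD (X : Type*) [NormedAddCommGroup X] [NormedSpace ℝ X] : Prop :=
  ∀ p : ℝ≥0∞, 1 < p → p < ∞ → ∃ B : ℝ≥0∞, B < ∞ ∧
    ∀ (S : Type) [MeasurableSpace S] (μ : Measure S) [SigmaFinite μ], IsUMDBound μ p X B

/-! ### Cubes and step functions -/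

/-- The half-open axis-parallel cube with lower corner `a` and side length `l`. -/
def cube {n : ℕ} (a : EuclideanSpace ℝ (Fin n)) (l : ℝ) : Set (EuclideanSpace ℝ (Fin n)) :=
  {x | ∀ i, a i ≤ x i ∧ x i < a i + l}

/-- The indicator function of a cube. -/
def cubeInd (𝕜 : Type*) [RCLike 𝕜] {n : ℕ} (a : EuclideanSpace ℝ (Fin n)) (l : ℝ) :
    EuclideanSpace ℝ (Fin n) → 𝕜 :=
  (cube a l).indicator 1

/-- The step functions: finite linear combinations of indicators of cubes. -/
def stepFun (n : ℕ) (𝕜 : Type*) [RCLike 𝕜] : Submodule 𝕜 (EuclideanSpace ℝ (Fin n) → 𝕜) :=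
  Submodule.span 𝕜 {f | ∃ (a : EuclideanSpace ℝ (Fin n)) (l : ℝ), 0 < l ∧ f = cubeInd 𝕜 a l}

/-- The indicator of a cube as a step function. -/
def cubeStep (𝕜 : Type*) [RCLike 𝕜] {n : ℕ} (a : EuclideanSpace ℝ (Fin n)) {l : ℝ} (hl : 0 < l) :
    stepFun n 𝕜 :=
  ⟨cubeInd 𝕜 a l, Submodule.subset_span ⟨a, l, hl, rfl⟩⟩

/-- The indicator of the cube `[-R, R)ⁿ` as a step function. -/
def centeredStep (𝕜 : Type*) [RCLike 𝕜] (n : ℕ) {R : ℝ} (hR : 0 < R) : stepFun n 𝕜 :=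
  cubeStep 𝕜 (WithLp.toLp 2 fun _ => -R : EuclideanSpace ℝ (Fin n)) (l := 2 * R) (by positivity)

lemma measurableSet_cube {n : ℕ} (a : EuclideanSpace ℝ (Fin n)) (l : ℝ) :
    MeasurableSet (cube a l) := by
  have : cube a l = ⋂ i, {x | a i ≤ x i ∧ x i < a i + l} := by
    ext x; simp [cube]
  rw [this]
  refine MeasurableSet.iInter fun i => ?_
  have hm : Measurable fun x : EuclideanSpace ℝ (Fin n) => x i := by fun_prop
  exact (measurableSet_le measurable_const hm).inter (measurableSet_lt hm measurable_const)

lemma volume_cube_lt_top {n : ℕ} (a : EuclideanSpace ℝ (Fin n)) (l : ℝ) :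
    volume (cube a l) < ∞ := by
  have hK : IsCompact ((EuclideanSpace.equiv (Fin n) ℝ) ⁻¹'
      (Set.Icc (fun i => a i) (fun i => a i + l))) :=
    (EuclideanSpace.equiv (Fin n) ℝ).toHomeomorph.isCompact_preimage.2 isCompact_Icc
  refine lt_of_le_of_lt (measure_mono ?_) hK.measure_lt_top
  intro x hx
  exact ⟨fun i => (hx i).1, fun i => (hx i).2.le⟩

lemma stepFun_memLp {n : ℕ} {𝕜 : Type*} [RCLike 𝕜] (f : stepFun n 𝕜) (p : ℝ≥0∞) :
    MemLp (f : EuclideanSpace ℝ (Fin n) → 𝕜) p volume := by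
  obtain ⟨f, hf⟩ := f
  induction hf using Submodule.span_induction with
  | mem f hf =>
    obtain ⟨a, l, -, rfl⟩ := hf
    exact memLp_indicator_const p (measurableSet_cube a l) (1 : 𝕜)
      (Or.inr (volume_cube_lt_top a l).ne)
  | zero => exact MemLp.zero'
  | add f g _ _ hf hg => exact hf.add hg
  | smul c f _ hf => exact hf.const_smul c

lemma stepFun_smul_memLp {n : ℕ} {𝕜 : Type*} [RCLike 𝕜] {X : Type*} [NormedAddCommGroup X]
    [NormedSpace 𝕜 X] (f : stepFun n 𝕜) (x : X) (p : ℝ≥0∞) :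
    MemLp (fun t => (f : EuclideanSpace ℝ (Fin n) → 𝕜) t • x) p volume :=
  ((ContinuousLinearMap.id 𝕜 𝕜).smulRight x).comp_memLp' (stepFun_memLp f p)

/-- The elementary tensor `f ⊗ x : t ↦ f(t) x`, an element of `L^p(ℝⁿ; X)`. -/
def stepTensor {n : ℕ} {𝕜 : Type*} [RCLike 𝕜] {X : Type*} [NormedAddCommGroup X]
    [NormedSpace 𝕜 X] (p : ℝ≥0∞) (f : stepFun n 𝕜) (x : X) :
    Lp X p (volume : Measure (EuclideanSpace ℝ (Fin n))) :=
  (stepFun_smul_memLp f x p).toLp _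

/-! ### Calderón–Zygmund operators -/

/-- The standard estimates, with constant `c` and Hölder exponent `α`. -/
structure IsStandardKernel {n : ℕ} {𝕜 : Type*} [RCLike 𝕜] (α c : ℝ)
    (K : EuclideanSpace ℝ (Fin n) → EuclideanSpace ℝ (Fin n) → 𝕜) : Prop where
  size : ∀ x y, x ≠ y → ‖K x y‖ ≤ c / ‖x - y‖ ^ n
  smooth : ∀ x y h, 2 * ‖h‖ < ‖x - y‖ →
    ‖K (x + h) y - K x y‖ + ‖K x (y + h) - K x y‖ ≤ c * ‖h‖ ^ α / ‖x - y‖ ^ ((n : ℝ) + α)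

/-- A linear operator `T` from step functions to (classes of) locally integrable functions is a
singular integral with kernel `K`: `T f (x) = ∫ K(x, y) f(y) dy` for `x` off the support of `f`. -/
structure IsSingularIntegral {n : ℕ} {𝕜 : Type*} [RCLike 𝕜]
    (K : EuclideanSpace ℝ (Fin n) → EuclideanSpace ℝ (Fin n) → 𝕜)
    (T : stepFun n 𝕜 →ₗ[𝕜] (EuclideanSpace ℝ (Fin n) →ₘ[volume] 𝕜)) : Prop where
  locallyIntegrable : ∀ f : stepFun n 𝕜, LocallyIntegrable (T f : EuclideanSpace ℝ (Fin n) → 𝕜)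
  repr : ∀ f : stepFun n 𝕜, ∀ᵐ x : EuclideanSpace ℝ (Fin n),
    x ∉ tsupport (f : EuclideanSpace ℝ (Fin n) → 𝕜) →
      T f x = ∫ y, K x y * (f : EuclideanSpace ℝ (Fin n) → 𝕜) y

/-- The bilinear pairing `⟨g, T f⟩ = ∫ g(x) T f(x) dx` for step functions `f, g`. -/
def pairing {n : ℕ} {𝕜 : Type*} [RCLike 𝕜]
    (T : stepFun n 𝕜 →ₗ[𝕜] (EuclideanSpace ℝ (Fin n) →ₘ[volume] 𝕜)) (g f : stepFun n 𝕜) : 𝕜 :=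
  ∫ x, (g : EuclideanSpace ℝ (Fin n) → 𝕜) x * T f x

/-- The weak boundedness property `|⟨1_I, T 1_I⟩| ≤ c |I|` for all cubes `I`. -/
def WeakBoundedness {n : ℕ} {𝕜 : Type*} [RCLike 𝕜] (c : ℝ)
    (T : stepFun n 𝕜 →ₗ[𝕜] (EuclideanSpace ℝ (Fin n) →ₘ[volume] 𝕜)) : Prop :=
  ∀ (a : EuclideanSpace ℝ (Fin n)) (l : ℝ) (hl : 0 < l),
    ‖pairing T (cubeStep 𝕜 a hl) (cubeStep 𝕜 a hl)‖ ≤ c * volume.real (cube a l)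

/-- `T(1) = 0`, modulo constants: `⟨h, T 1⟩ = lim_{R → ∞} ⟨h, T 1_{[-R, R)ⁿ}⟩` vanishes for all
step functions `h` of mean zero. -/
def VanishesOnOne {n : ℕ} {𝕜 : Type*} [RCLike 𝕜]
    (T : stepFun n 𝕜 →ₗ[𝕜] (EuclideanSpace ℝ (Fin n) →ₘ[volume] 𝕜)) : Prop :=
  ∀ h : stepFun n 𝕜, ∫ x, (h : EuclideanSpace ℝ (Fin n) → 𝕜) x = 0 →
    Tendsto (fun R : Set.Ioi (0 : ℝ) => pairing T h (centeredStep 𝕜 n R.2)) atTop (𝓝 0)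

/-- `T*(1) = 0`, modulo constants: `⟨1, T h⟩ = lim_{R → ∞} ⟨1_{[-R, R)ⁿ}, T h⟩` vanishes for all
step functions `h` of mean zero. -/
def AdjointVanishesOnOne {n : ℕ} {𝕜 : Type*} [RCLike 𝕜]
    (T : stepFun n 𝕜 →ₗ[𝕜] (EuclideanSpace ℝ (Fin n) →ₘ[volume] 𝕜)) : Prop :=
  ∀ h : stepFun n 𝕜, ∫ x, (h : EuclideanSpace ℝ (Fin n) → 𝕜) x = 0 →
    Tendsto (fun R : Set.Ioi (0 : ℝ) => pairing T (centeredStep 𝕜 n R.2) h) atTop (𝓝 0)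

end

/-!
The operator is discretised, and the discrete operators are bounded uniformly by averaging over
dyadic grids.

*Discretisation.* For a mesh size `δ`, the matrix `czMatrix` of `T` with respect to the cells
`δ (i + [0, 1)ⁿ)` satisfies discrete Calderón–Zygmund conditions which do not depend on `δ`
(`exists_isCellCZ_czMatrix`): smoothness comes from the kernel, boundedness of the averages over
blocks from the size of the kernel (`lintegral_box_le`) and weak boundedness, and vanishing on
constants from `T 1 = T* 1 = 0`. The unconditionality constant of `ℝⁿ` serves for functions on the
lattice, because Lebesgue measure is mapped to counting measure (`IsUMD.isDiscreteUMDBound`).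

*Dyadic representation.* Let `E_s` be the averaging operators of a grid of dyadic rectangles; one
side at a time is doubled, so that every rectangle has two halves and one Haar function. The
differences `E_s a E_s - E_{s+1} a E_{s+1}` telescope to the matrix `a`, and they are sums, over
the relative positions `m` of two rectangles, of three kinds of operators: from Haar functions to
Haar functions, from Haar functions to differences of indicators, and from differences of
indicators to Haar functions (`tendsto_sum_haarTerm`). Since `a` and its transpose vanish on
constants, differences of indicators suffice, and there are no paraproducts. The coefficients are
bounded by the summable weights `(1 + |m|)^(-n-α)` (`IsCellCZ.isDyadicCZ`).

*Boundedness.* Whether a rectangle is good, that is, in the middle of its ancestor about `log |m|`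
generations up, does not depend on the rectangle itself. So the average over all grids sees only
the good rectangles, up to a factor `2 ^ n` (`sum_origin_good`); these have a close common ancestor
with their translate by `m`. On the levels in one of about `n log |m|` residue classes, the pairs
of such rectangles are nested, and two applications of the unconditionality inequality give the
factor `β²`: one to extract the coefficients from the function (`haar_proj`, `diff_proj`), and one
to exchange one martingale difference on a pair for another (`pair_transfer`). The logarithmic loss
is absorbed by the weights (`IsDyadicCZ.ellNorm_le`, `tsum_czWeight_lt_top`).

*Return to `ℝⁿ`.* The discrete bounds on finer and finer meshes bound the image of a step function
on a fixed mesh (`IsSingularIntegral.eLpNorm_stepImage_le`), and hence `T` extends by density from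
the dyadic step functions (`exists_extension`). The extension agrees with `T` on arbitrary cubes:
their dyadic approximations converge in `L^p`, and their images under `T` converge almost
everywhere, by the kernel representation (`IsSingularIntegral.mem_agreeStep`).
-/


noncomputable section

/-! ### The unconditionality inequality on a countable set -/

/-- A partition of `ι` into finite classes, given by the class of each point. -/
structure FinPart (ι : Type*) where
  /-- The class of a point. -/
  cls : ι → Finset ι
  mem_cls : ∀ i, i ∈ cls i
  cls_eq : ∀ {i j}, j ∈ cls i → cls j = cls i

namespace FinPart

variable {ι Y X : Type*}

/-- The function `f` is constant on the classes of `P`. -/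
def Inv (P : FinPart ι) (f : ι → Y) : Prop := ∀ i, ∀ j ∈ P.cls i, f j = f i

/-- `P.Finer Q`: the partition `P` refines `Q`. -/
def Finer (P Q : FinPart ι) : Prop := ∀ i, P.cls i ⊆ Q.cls i

lemma Finer.trans {P Q R : FinPart ι} (h : P.Finer Q) (h' : Q.Finer R) : P.Finer R :=
  fun i => (h i).trans (h' i)

lemma Inv.mono {P Q : FinPart ι} {f : ι → Y} (h : P.Finer Q) (hf : Q.Inv f) : P.Inv f :=
  fun i j hj => hf i j (h i hj)

lemma mem_symm (P : FinPart ι) {i j : ι} (h : j ∈ P.cls i) : i ∈ P.cls j := by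
  rw [P.cls_eq h]; exact P.mem_cls i

/-- If the sums of `f` over the classes of `P` vanish, so does the sum over any finite union of
classes. -/
lemma sum_eq_zero_of_saturated [AddCommMonoid X] (P : FinPart ι) (f : ι → X) (A : Finset ι)
    (hA : ∀ i ∈ A, P.cls i ⊆ A) (hf : ∀ i ∈ A, ∑ j ∈ P.cls i, f j = 0) : ∑ i ∈ A, f i = 0 := by
  classical
  induction A using Finset.strongInduction with
  | H A ih =>
    rcases A.eq_empty_or_nonempty with rfl | ⟨i, hi⟩
    · simp
    rw [← Finset.sum_sdiff (hA i hi), hf i hi, add_zero]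
    refine ih _ ?_ ?_ ?_
    · refine Finset.ssubset_iff_subset_ne.2 ⟨Finset.sdiff_subset, fun h => ?_⟩
      have := h ▸ hi
      exact (Finset.mem_sdiff.1 this).2 (P.mem_cls i)
    · intro j hj l hl
      rw [Finset.mem_sdiff] at hj ⊢
      refine ⟨hA j hj.1 hl, fun h => hj.2 ?_⟩
      rw [← P.cls_eq h, P.cls_eq hl]
      exact P.mem_cls j
    · exact fun j hj => hf j (Finset.mem_sdiff.1 hj).1

/-- The σ-algebra of all unions of classes. -/
@[reducible] def measurableSpace (P : FinPart ι) : MeasurableSpace ι where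
  MeasurableSet' A := ∀ i ∈ A, ∀ j ∈ P.cls i, j ∈ A
  measurableSet_empty := by simp
  measurableSet_compl A hA i hi j hj := fun h => hi (hA j h i (P.mem_symm hj))
  measurableSet_iUnion s hs i hi j hj := by
    obtain ⟨k, hk⟩ := Set.mem_iUnion.1 hi
    exact Set.mem_iUnion.2 ⟨k, hs k i hk j hj⟩

lemma measurableSpace_mono {P Q : FinPart ι} (h : P.Finer Q) :
    Q.measurableSpace ≤ P.measurableSpace :=
  fun _ hA i hi j hj => hA i hi j (h i hj)

lemma Inv.stronglyMeasurable [TopologicalSpace X] [Zero X] {P : FinPart ι} {f : ι → X}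
    (hf : P.Inv f) (hs : (Function.support f).Finite) :
    StronglyMeasurable[P.measurableSpace] f := by
  refine @SimpleFunc.stronglyMeasurable _ _ P.measurableSpace _
    (@SimpleFunc.mk _ P.measurableSpace _ f ?_ ?_)
  · intro x i hi j hj
    simpa [hf i j hj] using hi
  · refine ((hs.image f).union (Set.finite_singleton 0)).subset ?_
    rintro _ ⟨i, rfl⟩
    by_cases h : f i = 0
    · exact Or.inr h
    · exact Or.inl ⟨i, h, rfl⟩

/-- The conditional expectation: averages over the classes. -/
def avg [AddCommGroup X] [Module ℝ X] (P : FinPart ι) (f : ι → X) (i : ι) : X :=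
  ((P.cls i).card : ℝ)⁻¹ • ∑ j ∈ P.cls i, f j

lemma card_ne_zero (P : FinPart ι) (i : ι) : ((P.cls i).card : ℝ) ≠ 0 := by
  have := Finset.card_pos.2 ⟨i, P.mem_cls i⟩
  positivity

lemma inv_avg [AddCommGroup X] [Module ℝ X] (P : FinPart ι) (f : ι → X) : P.Inv (P.avg f) := by
  intro i j hj
  simp only [avg, P.cls_eq hj]

lemma sum_avg [AddCommGroup X] [Module ℝ X] (P : FinPart ι) (f : ι → X) (i : ι) :
    ∑ j ∈ P.cls i, P.avg f j = ∑ j ∈ P.cls i, f j := by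
  rw [Finset.sum_congr rfl fun j hj => P.inv_avg f i j hj, Finset.sum_const, avg,
    ← Nat.cast_smul_eq_nsmul ℝ, smul_smul, mul_inv_cancel₀ (P.card_ne_zero i), one_smul]

lemma sum_avg_sub_avg [AddCommGroup X] [Module ℝ X] {P Q : FinPart ι} (h : P.Finer Q) (f : ι → X)
    (i : ι) : ∑ j ∈ Q.cls i, (P.avg f j - Q.avg f j) = 0 := by
  rw [Finset.sum_sub_distrib, Q.sum_avg, ← Finset.sum_sub_distrib]
  refine P.sum_eq_zero_of_saturated _ _ ?_ ?_
  · intro j hj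
    rw [← Q.cls_eq hj]
    exact h j
  · intro j _
    rw [Finset.sum_sub_distrib, P.sum_avg, sub_self]

lemma finite_support_avg [AddCommGroup X] [Module ℝ X] (P : FinPart ι) {f : ι → X}
    (hf : (Function.support f).Finite) : (Function.support (P.avg f)).Finite := by
  refine (hf.biUnion fun i _ => (P.cls i).finite_toSet).subset ?_
  intro i hi
  by_contra h
  refine hi ?_
  rw [avg, Finset.sum_eq_zero, smul_zero]
  intro j hj
  by_contra hj'
  exact h (Set.mem_biUnion (show j ∈ Function.support f from hj') (P.mem_symm hj))

/-- The partition obtained from `P` by splitting its classes along the level sets of `a`. -/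
def split (P : FinPart ι) (a : ι → Y) : FinPart ι where
  cls i := by classical exact (P.cls i).filter fun j => a j = a i
  mem_cls i := by simp [P.mem_cls]
  cls_eq {i j} h := by
    classical
    simp only [Finset.mem_filter] at h
    simp only [P.cls_eq h.1, h.2]

lemma mem_split {P : FinPart ι} {a : ι → Y} {i j : ι} :
    j ∈ (P.split a).cls i ↔ j ∈ P.cls i ∧ a j = a i := by
  classical
  simp [split]

lemma split_finer (P : FinPart ι) (a : ι → Y) : (P.split a).Finer P :=
  fun _ _ h => (mem_split.1 h).1

lemma Finer.split {P Q : FinPart ι} {a : ι → Y} (h : Q.Finer P) (ha : Q.Inv a) :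
    Q.Finer (P.split a) :=
  fun i j hj => mem_split.2 ⟨h i hj, ha i j hj⟩

lemma sum_split_cls [AddCommMonoid X] [DecidableEq Y] (P : FinPart ι) (a : ι → Y) (f : ι → X)
    (i : ι) : ∑ j ∈ (P.split a).cls i, f j = ∑ j ∈ P.cls i, if a j = a i then f j else 0 := by
  rw [← Finset.sum_filter]
  refine Finset.sum_congr ?_ fun _ _ => rfl
  ext j; simp [mem_split]

end FinPart

section Norm

variable {ι X : Type*} [NormedAddCommGroup X]

/-- The norm of `ℓ^p(ι; X)`. -/
def ellNorm (p : ℝ≥0∞) (f : ι → X) : ℝ≥0∞ :=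
  letI : MeasurableSpace ι := ⊤
  eLpNorm f p Measure.count

variable {p : ℝ≥0∞}

lemma ellNorm_zero : ellNorm p (fun _ : ι => (0 : X)) = 0 := by
  unfold ellNorm; exact eLpNorm_zero

lemma ellNorm_const_smul {𝕜 : Type*} [NormedField 𝕜] [NormedSpace 𝕜 X] (c : 𝕜) (f : ι → X) :
    ellNorm p (fun i => c • f i) = ‖c‖ₑ * ellNorm p f := by
  unfold ellNorm
  exact eLpNorm_const_smul c f p _

variable [Countable ι]

lemma ellNorm_eq [m : MeasurableSpace ι] [MeasurableSingletonClass ι] (f : ι → X) :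
    ellNorm p f = eLpNorm f p Measure.count := by
  have : m = ⊤ := by
    refine le_antisymm le_top fun s _ => s.to_countable.measurableSet
  subst this
  rfl

lemma ellNorm_add_le (hp : 1 ≤ p) (f g : ι → X) :
    ellNorm p (fun i => f i + g i) ≤ ellNorm p f + ellNorm p g := by
  let _ : MeasurableSpace ι := ⊤
  exact eLpNorm_add_le StronglyMeasurable.of_discrete.aestronglyMeasurable
    StronglyMeasurable.of_discrete.aestronglyMeasurable hp

lemma ellNorm_sub_le (hp : 1 ≤ p) (f g : ι → X) :
    ellNorm p (fun i => f i - g i) ≤ ellNorm p f + ellNorm p g := by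
  let _ : MeasurableSpace ι := ⊤
  exact eLpNorm_sub_le StronglyMeasurable.of_discrete.aestronglyMeasurable
    StronglyMeasurable.of_discrete.aestronglyMeasurable hp

lemma ellNorm_sum_le (hp : 1 ≤ p) {κ : Type*} (s : Finset κ) (f : κ → ι → X) :
    ellNorm p (fun i => ∑ k ∈ s, f k i) ≤ ∑ k ∈ s, ellNorm p (f k) := by
  classical
  induction s using Finset.induction_on with
  | empty => simp [ellNorm_zero]
  | insert a s ha ih =>
    simp only [Finset.sum_insert ha]
    exact (ellNorm_add_le hp _ _).trans (by gcongr)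

lemma ellNorm_le_of_tendsto {f : ℕ → ι → X} {g : ι → X} {C : ℝ≥0∞}
    (hfg : ∀ i, Tendsto (fun k => f k i) atTop (𝓝 (g i))) (hf : ∀ k, ellNorm p (f k) ≤ C) :
    ellNorm p g ≤ C := by
  let _ : MeasurableSpace ι := ⊤
  have h := Lp.eLpNorm_lim_le_liminf_eLpNorm (μ := Measure.count) (p := p)
    (fun k => (StronglyMeasurable.of_discrete (f := f k)).aestronglyMeasurable) g
    (Eventually.of_forall hfg)
  refine h.trans ?_
  exact (liminf_le_liminf (Eventually.of_forall hf)).trans (by simp)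

lemma ellNorm_ne_top {f : ι → X} (hf : (Function.support f).Finite) : ellNorm p f ≠ ∞ := by
  classical
  let _ : MeasurableSpace ι := ⊤
  have h : f = fun i => ∑ k ∈ hf.toFinset, ({k} : Set ι).indicator (fun _ => f k) i := by
    ext i
    simp only [Set.indicator_apply, Set.mem_singleton_iff]
    rw [Finset.sum_ite_eq]
    by_cases h : f i = 0 <;> simp [h]
  have hm : MemLp f p (Measure.count : Measure ι) := by
    rw [h]
    refine memLp_finsetSum _ fun k _ => ?_
    exact memLp_indicator_const p (Set.toFinite _).measurableSet _ (Or.inr (by simp))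
  exact hm.2.ne

/-- Averaging over the classes of a partition is a contraction, by Jensen's inequality. -/
lemma ellNorm_avg_le [NormedSpace ℝ X] (hp : 1 ≤ p) (hp' : p ≠ ∞) (P : FinPart ι) (f : ι → X) :
    ellNorm p (P.avg f) ≤ ellNorm p f := by
  classical
  let _ : MeasurableSpace ι := ⊤
  have hp0 : p ≠ 0 := (zero_lt_one.trans_le hp).ne'
  have hr : 1 ≤ p.toReal := by
    rw [← ENNReal.toReal_one]; exact ENNReal.toReal_mono hp' hp
  unfold ellNorm
  rw [eLpNorm_eq_lintegral_rpow_enorm_toReal hp0 hp', eLpNorm_eq_lintegral_rpow_enorm_toReal hp0 hp']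
  refine ENNReal.rpow_le_rpow ?_ (by positivity)
  rw [lintegral_count, lintegral_count]
  have key : ∀ i, ‖P.avg f i‖ₑ ^ p.toReal
      ≤ ((P.cls i).card : ℝ≥0∞)⁻¹ * ∑ j ∈ P.cls i, ‖f j‖ₑ ^ p.toReal := by
    intro i
    have hc : ((P.cls i).card : ℝ≥0∞) ≠ 0 := by
      have := Finset.card_pos.2 ⟨i, P.mem_cls i⟩
      exact_mod_cast this.ne'
    have h1 : ‖P.avg f i‖ₑ ≤ ∑ j ∈ P.cls i, ((P.cls i).card : ℝ≥0∞)⁻¹ * ‖f j‖ₑ := by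
      rw [FinPart.avg, enorm_smul, ← Finset.mul_sum]
      gcongr
      · rw [enorm_inv (P.card_ne_zero i)]
        simp
      · exact enorm_sum_le _ _
    refine (ENNReal.rpow_le_rpow h1 (by positivity)).trans ?_
    rw [Finset.mul_sum]
    refine ENNReal.rpow_arith_mean_le_arith_mean_rpow _ _ _ ?_ hr
    rw [Finset.sum_const, nsmul_eq_mul, ENNReal.mul_inv_cancel hc (ENNReal.natCast_ne_top _)]
  refine (ENNReal.tsum_le_tsum key).trans ?_
  have : ∀ i, ((P.cls i).card : ℝ≥0∞)⁻¹ * ∑ j ∈ P.cls i, ‖f j‖ₑ ^ p.toReal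
      = ∑' j, if j ∈ P.cls i then ((P.cls i).card : ℝ≥0∞)⁻¹ * ‖f j‖ₑ ^ p.toReal else 0 := by
    intro i
    rw [tsum_eq_sum (s := P.cls i) (by intro j hj; simp [hj]), Finset.mul_sum]
    exact Finset.sum_congr rfl fun j hj => by simp [hj]
  simp_rw [this]
  rw [ENNReal.tsum_comm]
  refine ENNReal.tsum_le_tsum fun j => ?_
  rw [tsum_eq_sum (s := P.cls j) (by
    intro i hi
    have : j ∉ P.cls i := fun h => hi (P.mem_symm h)
    simp [this])]
  have hc : ((P.cls j).card : ℝ≥0∞) ≠ 0 := by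
    have := Finset.card_pos.2 ⟨j, P.mem_cls j⟩
    exact_mod_cast this.ne'
  rw [Finset.sum_congr rfl (g := fun _ => ((P.cls j).card : ℝ≥0∞)⁻¹ * ‖f j‖ₑ ^ p.toReal)]
  · rw [Finset.sum_const, nsmul_eq_mul, ← mul_assoc,
      ENNReal.mul_inv_cancel hc (ENNReal.natCast_ne_top _), one_mul]
  · intro i hi
    rw [if_pos (P.mem_symm hi), P.cls_eq hi]

end Norm

/-! ### From Lebesgue measure to counting measure -/

section Transference

variable {X : Type*} [NormedAddCommGroup X] [NormedSpace ℝ X] {p B : ℝ≥0∞}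

/-- The unconditionality inequality passes to the image measure, because a filtration of the image
can be pulled back. -/
lemma IsUMDBound.map {S S' : Type*} [MeasurableSpace S] [m' : MeasurableSpace S'] {μ : Measure S}
    {π : S → S'} (hπ : Measurable π) (h : IsUMDBound μ p X B) :
    IsUMDBound (μ.map π) p X B := by
  intro ℱ d ε N hσ hd hLp hzero hε
  have hle : ∀ k, (ℱ k).comap π ≤ ‹MeasurableSpace S› := fun k =>
    (MeasurableSpace.comap_mono (ℱ.le k)).trans hπ.comap_le
  let 𝒢 : Filtration ℕ ‹MeasurableSpace S› :=
    ⟨fun k => (ℱ k).comap π, fun i j hij => MeasurableSpace.comap_mono (ℱ.mono hij), hle⟩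
  have hdm : ∀ k, StronglyMeasurable (d k) := fun k => (hd k).mono (ℱ.le _)
  have key := h 𝒢 (fun k => d k ∘ π) ε N ?_ ?_ ?_ ?_ hε
  · have e1 : eLpNorm (fun s => ∑ k ∈ Finset.range N, ε k • d k s) p (μ.map π)
        = eLpNorm (fun s => ∑ k ∈ Finset.range N, ε k • (d k ∘ π) s) p μ := by
      rw [eLpNorm_map_measure _ hπ.aemeasurable]
      · rfl
      · exact (Finset.stronglyMeasurable_fun_sum _ fun k _ =>
          (hdm k).const_smul (ε k)).aestronglyMeasurable
    have e2 : eLpNorm (fun s => ∑ k ∈ Finset.range N, d k s) p (μ.map π)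
        = eLpNorm (fun s => ∑ k ∈ Finset.range N, (d k ∘ π) s) p μ := by
      rw [eLpNorm_map_measure _ hπ.aemeasurable]
      · rfl
      · exact (Finset.stronglyMeasurable_fun_sum _ fun k _ => hdm k).aestronglyMeasurable
    rw [e1, e2]; exact key
  · intro k
    have hm : @Measurable _ _ ((ℱ k).comap π) (ℱ k) π := @comap_measurable _ _ (ℱ k) π
    have := hσ k
    have e : @Measure.map _ _ ((ℱ k).comap π) (ℱ k) π (μ.trim (hle k))
        = (μ.map π).trim (ℱ.le k) := by
      refine @Measure.ext _ (ℱ k) _ _ fun s hs => ?_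
      rw [@Measure.map_apply _ _ ((ℱ k).comap π) (ℱ k) _ _ hm _ hs, trim_measurableSet_eq _ hs,
        trim_measurableSet_eq _ (hm hs), Measure.map_apply hπ (ℱ.le k _ hs)]
    refine @SigmaFinite.of_map _ _ ((ℱ k).comap π) (ℱ k) _ π
      (@Measurable.aemeasurable _ _ ((ℱ k).comap π) (ℱ k) _ _ hm) ?_
    rw [e]; exact this
  · intro k
    exact (hd k).comp_measurable (@comap_measurable _ _ (ℱ (k + 1)) π)
  · intro k
    exact (memLp_map_measure_iff (hdm k).aestronglyMeasurable hπ.aemeasurable).1 (hLp k)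
  · rintro k _ ⟨A, hA, rfl⟩ hfin
    have := hzero k A hA (by rwa [Measure.map_apply hπ (ℱ.le k _ hA)])
    rwa [setIntegral_map (ℱ.le k _ hA) (hdm k).aestronglyMeasurable hπ.aemeasurable] at this

/-- The unconditionality inequality in `ℓ^p(ι; X)`, for finite martingale difference sequences
of finitely supported functions relative to partitions into finite classes. -/
def IsDiscreteUMDBound (ι : Type*) (p : ℝ≥0∞) (X : Type*) [NormedAddCommGroup X] [NormedSpace ℝ X]
    (B : ℝ≥0∞) : Prop :=
  ∀ (P : ℕ → FinPart ι) (d : ℕ → ι → X) (ε : ℕ → ℝ) (N : ℕ),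
    (∀ k < N, (P (k + 1)).Finer (P k)) →
    (∀ k < N, (P (k + 1)).Inv (d k)) →
    (∀ k < N, (Function.support (d k)).Finite) →
    (∀ k < N, ∀ i, ∑ j ∈ (P k).cls i, d k j = 0) →
    (∀ k, ε k = 1 ∨ ε k = -1) →
    ellNorm p (fun i => ∑ k ∈ Finset.range N, ε k • d k i)
      ≤ B * ellNorm p (fun i => ∑ k ∈ Finset.range N, d k i)

/-- For a multiple of counting measure, partitions into finite classes generate σ-finite
filtrations, and conditional expectations vanish if the sums over the classes do. The factor of the
measure cancels from the inequality. -/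
lemma IsUMDBound.discrete [CompleteSpace X] {ι : Type*} [Countable ι] [m : MeasurableSpace ι]
    [MeasurableSingletonClass ι] {c : ℝ≥0∞} (hc0 : c ≠ 0) (hc : c ≠ ∞) (hp' : p ≠ ∞)
    (h : IsUMDBound (c • (Measure.count : Measure ι)) p X B) : IsDiscreteUMDBound ι p X B := by
  classical
  intro P d ε N hP hinv hfin hzero hε
  have hle : ∀ k, (P k).measurableSpace ≤ m := fun k s _ => s.to_countable.measurableSet
  -- after `N` the filtration is constant
  let Q : ℕ → FinPart ι := fun k => P (min k N)
  have hmono : Monotone fun k => (Q k).measurableSpace := by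
    refine monotone_nat_of_le_succ fun k => FinPart.measurableSpace_mono ?_
    rcases lt_or_ge k N with hk | hk
    · simpa [Q, min_eq_left hk.le, min_eq_left (Nat.succ_le_of_lt hk)] using hP k hk
    · simp only [Q, min_eq_right hk, min_eq_right (hk.trans (Nat.le_succ k))]
      exact fun i => subset_rfl
  let ℱ : Filtration ℕ m := ⟨fun k => (Q k).measurableSpace, hmono, fun k => hle _⟩
  let d' : ℕ → ι → X := fun k => if k < N then d k else 0
  have hd' : ∀ k, (Function.support (d' k)).Finite := by
    intro k
    by_cases hk : k < N
    · simpa [d', hk] using hfin k hk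
    · simp [d', hk]
  have hfinite : ∀ s : Set ι, (c • (Measure.count : Measure ι)) s < ∞ ↔ s.Finite := by
    intro s
    rw [Measure.smul_apply, smul_eq_mul, ← Measure.count_apply_lt_top]
    rw [ENNReal.mul_lt_top_iff]
    constructor
    · rintro (h | h | h)
      · exact h.2
      · exact absurd h hc0
      · simp [h]
    · exact fun h => Or.inl ⟨hc.lt_top, h⟩
  have key := h ℱ d' ε N ?_ ?_ ?_ ?_ hε
  · have e : ∀ δ : ℕ → ℝ, (fun s => ∑ k ∈ Finset.range N, δ k • d' k s)
        = fun s => ∑ k ∈ Finset.range N, δ k • d k s := by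
      intro δ; ext s
      refine Finset.sum_congr rfl fun k hk => ?_
      simp [d', Finset.mem_range.1 hk]
    have e' : (fun s => ∑ k ∈ Finset.range N, d' k s)
        = fun s => ∑ k ∈ Finset.range N, d k s := by
      simpa using e 1
    rw [e ε, e', eLpNorm_smul_measure_of_ne_top hp', eLpNorm_smul_measure_of_ne_top hp',
      ← ellNorm_eq, ← ellNorm_eq, smul_eq_mul, smul_eq_mul, mul_left_comm] at key
    refine (ENNReal.mul_le_mul_iff_right ?_ ?_).1 key
    · exact (ENNReal.rpow_pos (pos_iff_ne_zero.2 hc0) hc).ne'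
    · exact ENNReal.rpow_ne_top_of_nonneg (by positivity) hc
  · intro k
    refine Measure.sigmaFinite_of_countable (S := Set.range fun i => ((Q k).cls i : Set ι))
      (Set.countable_range _) ?_ ?_
    · rintro _ ⟨i, rfl⟩
      rw [trim_measurableSet_eq]
      · exact (hfinite _).2 (Finset.finite_toSet _)
      · intro a ha b hb
        rw [Finset.mem_coe] at ha ⊢
        rwa [(Q k).cls_eq ha] at hb
    · exact Set.eq_univ_of_forall fun i => ⟨_, ⟨i, rfl⟩, (Q k).mem_cls i⟩
  · intro k
    refine FinPart.Inv.stronglyMeasurable ?_ (hd' k)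
    intro i j hj
    by_cases hk : k < N
    · have := hinv k hk i j (by simpa [Q, min_eq_left (Nat.succ_le_of_lt hk)] using hj)
      simpa [d', hk] using this
    · simp [d', hk]
  · intro k
    have hsm : StronglyMeasurable (d' k) := StronglyMeasurable.of_discrete
    refine ⟨hsm.aestronglyMeasurable, ?_⟩
    rw [eLpNorm_smul_measure_of_ne_top hp', ← ellNorm_eq]
    exact ENNReal.mul_lt_top (ENNReal.rpow_lt_top_of_nonneg (by positivity) hc)
      (ellNorm_ne_top (hd' k)).lt_top
  · intro k A hA hAfin
    by_cases hk : k < N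
    swap
    · simp [d', hk]
    have hAf : A.Finite := (hfinite A).1 hAfin
    have : ∫ s in A, d' k s ∂(c • (Measure.count : Measure ι)) = c.toReal • ∑ i ∈ hAf.toFinset, d' k i := by
      rw [Measure.restrict_smul, integral_smul_measure]
      congr 1
      obtain ⟨F, rfl⟩ := hAf.exists_finset_coe
      have hi : Integrable (d' k) (Measure.count : Measure ι) := by
        rw [← memLp_one_iff_integrable]
        exact ⟨StronglyMeasurable.of_discrete.aestronglyMeasurable,
          by rw [← ellNorm_eq]; exact (ellNorm_ne_top (hd' k)).lt_top⟩
      rw [setIntegral_finset F hi.integrableOn]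
      simp [Measure.real]
    rw [this, FinPart.sum_eq_zero_of_saturated (P k), smul_zero]
    · intro i hi j hj
      rw [Set.Finite.mem_toFinset] at hi ⊢
      exact hA i hi j (by simpa [Q, min_eq_left hk.le] using hj)
    · intro i _
      simpa [d', hk] using hzero k hk i

end Transference


/-! ### Martingale transforms -/

section Transforms

variable {ι : Type*} {X : Type*} [NormedAddCommGroup X] [NormedSpace ℝ X] {p B : ℝ≥0∞}

/-- A finite martingale difference sequence of finitely supported functions. -/
structure IsMartDiff (P : ℕ → FinPart ι) (d : ℕ → ι → X) (N : ℕ) : Prop where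
  finer : ∀ k < N, (P (k + 1)).Finer (P k)
  inv : ∀ k < N, (P (k + 1)).Inv (d k)
  fin : ∀ k < N, (Function.support (d k)).Finite
  zero : ∀ k < N, ∀ i, ∑ j ∈ (P k).cls i, d k j = 0

lemma sum_range_two_mul {M : Type*} [AddCommMonoid M] (g : ℕ → M) (N : ℕ) :
    ∑ k ∈ Finset.range (2 * N), g k = ∑ k ∈ Finset.range N, (g (2 * k) + g (2 * k + 1)) := by
  induction N with
  | zero => simp
  | succ N ih =>
    rw [Finset.sum_range_succ, ← ih, mul_add, mul_one, Finset.sum_range_succ,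
      Finset.sum_range_succ, add_assoc]

/-- Predictable signs are admissible: the filtration is refined first on the set where the sign is
positive, and then on its complement. -/
lemma IsDiscreteUMDBound.predictable_sign (h : IsDiscreteUMDBound ι p X B) {P : ℕ → FinPart ι}
    {d : ℕ → ι → X} {N : ℕ} (hd : IsMartDiff P d N) (v : ℕ → ι → ℝ)
    (hv : ∀ k < N, (P k).Inv (v k)) (hv1 : ∀ k i, v k i = 1 ∨ v k i = -1) :
    ellNorm p (fun i => ∑ k ∈ Finset.range N, v k i • d k i)
      ≤ B * ellNorm p (fun i => ∑ k ∈ Finset.range N, d k i) := by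
  classical
  let w : ∀ k, ι → ι ⊕ Unit := fun k i => if v k i = 1 then Sum.inl i else Sum.inr ()
  -- the intermediate partition: split the class of `i` only if the sign at `i` is positive
  let mid : ℕ → FinPart ι := fun k => if hk : k < N then
    { cls := fun i => if v k i = 1 then (P (k + 1)).cls i else (P k).cls i
      mem_cls := fun i => by split_ifs; exacts [FinPart.mem_cls _ i, FinPart.mem_cls _ i]
      cls_eq := fun {i j} hj => by
        split_ifs at hj with h1
        · have := hv k hk i j (hd.finer k hk i hj)
          simp [this, h1, (P (k + 1)).cls_eq hj]
        · have := hv k hk i j hj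
          simp [this, h1, (P k).cls_eq hj] }
    else P k
  have hmid : ∀ k < N, ∀ i, (mid k).cls i
      = if v k i = 1 then (P (k + 1)).cls i else (P k).cls i := fun k hk i => by
    simp [mid, hk]
  let Q : ℕ → FinPart ι := fun k => if k % 2 = 0 then P (k / 2) else mid (k / 2)
  let e : ℕ → ι → X := fun k i => if k % 2 = 0 then (if v (k / 2) i = 1 then d (k / 2) i else 0)
    else (if v (k / 2) i = 1 then 0 else d (k / 2) i)
  have hQ0 : ∀ k, Q (2 * k) = P k := fun k => by simp [Q]
  have hQ1 : ∀ k, Q (2 * k + 1) = mid k := fun k => by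
    simp [Q, Nat.add_mod, show (2 * k + 1) / 2 = k by omega]
  have he0 : ∀ k i, e (2 * k) i = if v k i = 1 then d k i else 0 := fun k i => by simp [e]
  have he1 : ∀ k i, e (2 * k + 1) i = if v k i = 1 then 0 else d k i := fun k i => by
    simp [e, Nat.add_mod, show (2 * k + 1) / 2 = k by omega]
  have key := h Q e (fun k => if k % 2 = 0 then 1 else -1) (2 * N) ?_ ?_ ?_ ?_
    (fun k => by split_ifs <;> simp)
  · simp only [sum_range_two_mul, he0, he1] at key
    have e1 : (fun i => ∑ k ∈ Finset.range N, v k i • d k i)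
        = fun i => ∑ k ∈ Finset.range N, ((if 2 * k % 2 = 0 then (1 : ℝ) else -1) •
          (if v k i = 1 then d k i else 0) + (if (2 * k + 1) % 2 = 0 then (1 : ℝ) else -1) •
          (if v k i = 1 then 0 else d k i)) := by
      ext i
      refine Finset.sum_congr rfl fun k _ => ?_
      rcases hv1 k i with h1 | h1
      · simp [h1]
      · norm_num [h1, Nat.add_mod]
    have e2 : (fun i => ∑ k ∈ Finset.range N, d k i) = fun i => ∑ k ∈ Finset.range N,
        ((if v k i = 1 then d k i else 0) + if v k i = 1 then 0 else d k i) := by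
      ext i
      refine Finset.sum_congr rfl fun k _ => ?_
      split_ifs <;> simp
    rw [e1, e2]
    exact key
  · intro k hk
    obtain ⟨l, rfl | rfl⟩ := Nat.even_or_odd' k
    · have hl : l < N := by omega
      rw [hQ0, hQ1]
      intro i
      rw [hmid l hl]
      split_ifs
      · exact hd.finer l hl i
      · exact subset_rfl
    · have hl : l < N := by omega
      rw [show 2 * l + 1 + 1 = 2 * (l + 1) by ring, hQ0, hQ1]
      intro i
      rw [hmid l hl]
      split_ifs
      · exact subset_rfl
      · exact hd.finer l hl i
  · intro k hk
    obtain ⟨l, rfl | rfl⟩ := Nat.even_or_odd' k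
    · have hl : l < N := by omega
      rw [hQ1]
      intro i j hj
      rw [hmid l hl] at hj
      rw [he0, he0]
      split_ifs at hj with h1
      · rw [hv l hl i j (hd.finer l hl i hj), hd.inv l hl i j hj]
      · rw [hv l hl i j hj]; simp [h1]
    · have hl : l < N := by omega
      rw [show 2 * l + 1 + 1 = 2 * (l + 1) by ring, hQ0]
      intro i j hj
      rw [he1, he1, hv l hl i j (hd.finer l hl i hj), hd.inv l hl i j hj]
  · intro k hk
    obtain ⟨l, rfl | rfl⟩ := Nat.even_or_odd' k
    · refine (hd.fin l (by omega)).subset fun i hi => ?_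
      rw [Function.mem_support, he0] at hi
      intro h0; simp [h0] at hi
    · refine (hd.fin l (by omega)).subset fun i hi => ?_
      rw [Function.mem_support, he1] at hi
      intro h0; simp [h0] at hi
  · intro k hk i
    obtain ⟨l, rfl | rfl⟩ := Nat.even_or_odd' k
    · have hl : l < N := by omega
      rw [hQ0, Finset.sum_congr rfl fun j hj => by rw [he0, hv l hl i j hj]]
      split_ifs
      · exact hd.zero l hl i
      · simp
    · have hl : l < N := by omega
      rw [hQ1, hmid l hl]
      split_ifs with h1
      · refine Finset.sum_eq_zero fun j hj => ?_
        rw [he1, hv l hl i j (hd.finer l hl i hj)]; simp [h1]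
      · rw [Finset.sum_congr rfl fun j hj => by rw [he1, hv l hl i j hj]]
        simpa [h1] using hd.zero l hl i

variable [Countable ι]

/-- Predictable real multipliers with values in `[-1, 1]` are admissible. Writing such a multiplier
as `v = (s + v') / 2` with a sign `s` and another multiplier `v'` halves the error. -/
lemma IsDiscreteUMDBound.predictable (hp : 1 ≤ p) (h : IsDiscreteUMDBound ι p X B)
    {P : ℕ → FinPart ι} {d : ℕ → ι → X} {N : ℕ} (hd : IsMartDiff P d N) (v : ℕ → ι → ℝ)
    (hv : ∀ k < N, (P k).Inv (v k)) (hv1 : ∀ k i, |v k i| ≤ 1) :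
    ellNorm p (fun i => ∑ k ∈ Finset.range N, v k i • d k i)
      ≤ B * ellNorm p (fun i => ∑ k ∈ Finset.range N, d k i) := by
  set D := B * ellNorm p (fun i => ∑ k ∈ Finset.range N, d k i)
  set M := ∑ k ∈ Finset.range N, ellNorm p (d k)
  have hM : M ≠ ∞ := by
    refine (ENNReal.sum_lt_top.2 fun k hk => ?_).ne
    exact (ellNorm_ne_top (hd.fin k (Finset.mem_range.1 hk))).lt_top
  -- the bound with an error is the triangle inequality for `J = 0`
  have step : ∀ J : ℕ, ∀ v : ℕ → ι → ℝ, (∀ k < N, (P k).Inv (v k)) → (∀ k i, |v k i| ≤ 1) →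
      ellNorm p (fun i => ∑ k ∈ Finset.range N, v k i • d k i) ≤ D + (2 ^ J)⁻¹ * M := by
    intro J
    induction J with
    | zero =>
      intro v _ hv1
      refine le_add_left ?_
      rw [pow_zero, inv_one, one_mul]
      refine (ellNorm_sum_le hp _ _).trans (Finset.sum_le_sum fun k _ => ?_)
      refine eLpNorm_mono fun i => ?_
      rw [norm_smul]
      exact mul_le_of_le_one_left (norm_nonneg _) (hv1 k i)
    | succ J ih =>
      intro v hv hv1
      let s : ℕ → ι → ℝ := fun k i => if 0 ≤ v k i then 1 else -1
      let v' : ℕ → ι → ℝ := fun k i => 2 * v k i - s k i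
      have e : (fun i => ∑ k ∈ Finset.range N, v k i • d k i)
          = fun i => (1 / 2 : ℝ) • ((∑ k ∈ Finset.range N, s k i • d k i)
            + ∑ k ∈ Finset.range N, v' k i • d k i) := by
        ext i
        rw [← Finset.sum_add_distrib, Finset.smul_sum]
        refine Finset.sum_congr rfl fun k _ => ?_
        rw [← add_smul, smul_smul]
        congr 1
        simp only [v']; ring
      rw [e, ellNorm_const_smul]
      have h1 : ellNorm p (fun i => ∑ k ∈ Finset.range N, s k i • d k i) ≤ D := by
        refine h.predictable_sign hd s (fun k hk i j hj => ?_) (fun k i => ?_)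
        · simp only [s, hv k hk i j hj]
        · by_cases h0 : 0 ≤ v k i <;> simp [s, h0]
      have h2 := ih v' (fun k hk i j hj => by simp only [v', s, hv k hk i j hj]) (fun k i => by
        have := abs_le.1 (hv1 k i)
        simp only [v', s]
        rw [abs_le]
        split_ifs <;> constructor <;> linarith)
      have h3 : ‖(1 / 2 : ℝ)‖ₑ = 2⁻¹ := by
        rw [one_div, enorm_inv two_ne_zero]
        simp [Real.enorm_eq_ofReal]
      calc _ ≤ 2⁻¹ * (D + (D + (2 ^ J)⁻¹ * M)) := by
            rw [h3]; gcongr; exact (ellNorm_add_le hp _ _).trans (add_le_add h1 h2)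
        _ = D + (2 ^ (J + 1))⁻¹ * M := by
            rw [← add_assoc, ← two_mul, mul_add, ← mul_assoc, ENNReal.inv_mul_cancel (by simp)
              (by simp), one_mul, ← mul_assoc, pow_succ', ENNReal.mul_inv (by simp) (by simp)]
  have lim : Tendsto (fun J : ℕ => D + (2 ^ J : ℝ≥0∞)⁻¹ * M) atTop (𝓝 (D + 0 * M)) := by
    refine Tendsto.const_add _ (ENNReal.Tendsto.mul_const ?_ (Or.inr hM))
    have := ENNReal.tendsto_pow_atTop_nhds_zero_of_lt_one (r := 2⁻¹) (by norm_num)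
    simpa only [ENNReal.inv_pow] using this
  rw [zero_mul, add_zero] at lim
  exact ge_of_tendsto' lim fun J => step J v hv hv1

/-- Predictable scalar multipliers bounded by `c`, real or complex. -/
lemma IsDiscreteUMDBound.predictable_rclike {𝕜 : Type*} [RCLike 𝕜] [NormedSpace 𝕜 X]
    [IsScalarTower ℝ 𝕜 X] (hp : 1 ≤ p) (h : IsDiscreteUMDBound ι p X B) {P : ℕ → FinPart ι}
    {d : ℕ → ι → X} {N : ℕ} (hd : IsMartDiff P d N) (v : ℕ → ι → 𝕜) {c : ℝ≥0}
    (hv : ∀ k < N, (P k).Inv (v k)) (hv1 : ∀ k i, ‖v k i‖ ≤ c) :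
    ellNorm p (fun i => ∑ k ∈ Finset.range N, v k i • d k i)
      ≤ 2 * c * (B * ellNorm p (fun i => ∑ k ∈ Finset.range N, d k i)) := by
  have real : ∀ u : ℕ → ι → ℝ, (∀ k < N, (P k).Inv (u k)) → (∀ k i, |u k i| ≤ c) →
      ellNorm p (fun i => ∑ k ∈ Finset.range N, u k i • d k i)
        ≤ c * (B * ellNorm p (fun i => ∑ k ∈ Finset.range N, d k i)) := by
    intro u hu hu1
    rcases eq_or_ne c 0 with rfl | hc
    · have : ∀ k i, u k i = 0 := fun k i => abs_nonpos_iff.1 (by simpa using hu1 k i)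
      simp [this, ellNorm_zero]
    have hc' : (c : ℝ) ≠ 0 := by exact_mod_cast hc
    have h1 := h.predictable hp hd (fun k i => (c : ℝ)⁻¹ * u k i)
      (fun k hk i j hj => by simp only [hu k hk i j hj]) (fun k i => by
        rw [abs_mul, abs_inv, NNReal.abs_eq, inv_mul_le_iff₀ (by positivity), mul_one]
        exact hu1 k i)
    have e : (fun i => ∑ k ∈ Finset.range N, u k i • d k i)
        = fun i => (c : ℝ) • ∑ k ∈ Finset.range N, ((c : ℝ)⁻¹ * u k i) • d k i := by
      ext i
      rw [Finset.smul_sum]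
      refine Finset.sum_congr rfl fun k _ => ?_
      rw [smul_smul, mul_inv_cancel_left₀ hc']
    rw [e, ellNorm_const_smul]
    rw [Real.enorm_eq_ofReal c.coe_nonneg, ENNReal.ofReal_coe_nnreal]
    gcongr
  have e : (fun i => ∑ k ∈ Finset.range N, v k i • d k i)
      = fun i => (∑ k ∈ Finset.range N, RCLike.re (v k i) • d k i)
        + (RCLike.I : 𝕜) • ∑ k ∈ Finset.range N, RCLike.im (v k i) • d k i := by
    ext i
    rw [Finset.smul_sum, ← Finset.sum_add_distrib]
    refine Finset.sum_congr rfl fun k _ => ?_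
    conv_lhs => rw [← RCLike.re_add_im (v k i)]
    rw [add_smul, mul_comm, mul_smul, RCLike.real_smul_eq_coe_smul (K := 𝕜),
      RCLike.real_smul_eq_coe_smul (K := 𝕜)]
  rw [e]
  refine (ellNorm_add_le hp _ _).trans ?_
  rw [ellNorm_const_smul, mul_assoc, two_mul]
  refine add_le_add (real _ (fun k hk i j hj => by simp only [hv k hk i j hj])
    fun k i => (RCLike.abs_re_le_norm _).trans (hv1 k i)) ?_
  refine (mul_le_of_le_one_left (by positivity) ?_).trans
    (real _ (fun k hk i j hj => by simp only [hv k hk i j hj])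
      fun k i => (RCLike.abs_im_le_norm _).trans (hv1 k i))
  rw [← ofReal_norm]
  rw [ENNReal.ofReal_le_one]
  rcases eq_or_ne (RCLike.I : 𝕜) 0 with h0 | h0
  · simp [h0]
  · exact (RCLike.norm_I_of_ne_zero h0).le

/-- Martingale multipliers of `f` supported on every second difference. -/
lemma IsDiscreteUMDBound.avg_multiplier {𝕜 : Type*} [RCLike 𝕜] [NormedSpace 𝕜 X]
    [IsScalarTower ℝ 𝕜 X] (hp : 1 ≤ p) (hp' : p ≠ ∞) (h : IsDiscreteUMDBound ι p X B)
    (G H : ℕ → FinPart ι) (J : ℕ) (hHG : ∀ k < J, (H k).Finer (G k))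
    (hGH : ∀ k < J, (G (k + 1)).Finer (H k)) (v : ℕ → ι → 𝕜) {c : ℝ≥0}
    (hv : ∀ k < J, (G k).Inv (v k)) (hv1 : ∀ k i, ‖v k i‖ ≤ c)
    (f : ι → X) (hf : (Function.support f).Finite) :
    ellNorm p (fun i => ∑ k ∈ Finset.range J, v k i • ((H k).avg f i - (G k).avg f i))
      ≤ 4 * c * B * ellNorm p f := by
  let P : ℕ → FinPart ι := fun k => if k % 2 = 0 then G (k / 2) else H (k / 2)
  let d : ℕ → ι → X := fun k i => (P (k + 1)).avg f i - (P k).avg f i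
  have hP0 : ∀ k, P (2 * k) = G k := fun k => by simp [P]
  have hP1 : ∀ k, P (2 * k + 1) = H k := fun k => by
    simp [P, Nat.add_mod, show (2 * k + 1) / 2 = k by omega]
  have hP2 : ∀ k, P (2 * k + 1 + 1) = G (k + 1) := fun k => by
    rw [← hP0, show 2 * k + 1 + 1 = 2 * (k + 1) by ring]
  have hfin : ∀ k < 2 * J, (P (k + 1)).Finer (P k) := by
    intro k hk
    obtain ⟨l, rfl | rfl⟩ := Nat.even_or_odd' k
    · rw [hP0, hP1]; exact hHG l (by omega)
    · rw [hP1, hP2]; exact hGH l (by omega)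
  have hd : IsMartDiff P d (2 * J) := by
    refine ⟨hfin, fun k hk i j hj => ?_, fun k _ => ?_, fun k hk i => ?_⟩
    · simp only [d, (P (k + 1)).inv_avg f i j hj, (P k).inv_avg f i j (hfin k hk i hj)]
    · refine (((P (k + 1)).finite_support_avg hf).union ((P k).finite_support_avg hf)).subset ?_
      exact Function.support_sub _ _
    · exact FinPart.sum_avg_sub_avg (hfin k hk) f i
  have key := h.predictable_rclike hp hd (fun k i => if k % 2 = 0 then v (k / 2) i else 0) (c := c)
    (fun k hk => by
      obtain ⟨l, rfl | rfl⟩ := Nat.even_or_odd' k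
      · rw [hP0]
        intro i j hj
        simpa using hv l (by omega) i j hj
      · intro i j _
        simp [Nat.add_mod])
    (fun k i => by
      split_ifs
      · exact hv1 _ _
      · simp)
  have e1 : (fun i => ∑ k ∈ Finset.range (2 * J), (if k % 2 = 0 then v (k / 2) i else 0) • d k i)
      = fun i => ∑ k ∈ Finset.range J, v k i • ((H k).avg f i - (G k).avg f i) := by
    ext i
    rw [sum_range_two_mul]
    refine Finset.sum_congr rfl fun k _ => ?_
    simp [d, hP0, hP1, Nat.add_mod]
  have e2 : (fun i => ∑ k ∈ Finset.range (2 * J), d k i)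
      = fun i => (P (2 * J)).avg f i - (P 0).avg f i := by
    ext i
    exact Finset.sum_range_sub (fun k => (P k).avg f i) (2 * J)
  rw [e1, e2] at key
  refine key.trans ?_
  calc 2 * (c : ℝ≥0∞) * (B * _) ≤ 2 * c * (B * (ellNorm p f + ellNorm p f)) := by
        gcongr
        exact (ellNorm_sub_le hp _ _).trans
          (add_le_add (ellNorm_avg_le hp hp' _ _) (ellNorm_avg_le hp hp' _ _))
    _ = 4 * c * B * ellNorm p f := by ring

/-- Suppose that on every class of `S k` the functions `a k` and `b k` form a martingale difference
sequence of length two. Then, for vector coefficients `y k` which are constant on the classes of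
`S k`, the functions `y (a + b)` control the functions `y (θ₁ a + θ₂ b)`. -/
lemma IsDiscreteUMDBound.transfer (hp : 1 ≤ p) (h : IsDiscreteUMDBound ι p X B)
    (S : ℕ → FinPart ι) (J : ℕ) (hS : ∀ k < J, (S (k + 1)).Finer (S k)) (y : ℕ → ι → X)
    (hy : ∀ k < J, (S k).Inv (y k)) (hyf : ∀ k < J, (Function.support (y k)).Finite)
    (a b : ℕ → ι → ℝ) (ha : ∀ k < J, (S (k + 1)).Inv (a k)) (hb : ∀ k < J, (S (k + 1)).Inv (b k))
    (ha0 : ∀ k < J, ∀ i, ∑ j ∈ (S k).cls i, a k j = 0)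
    (hb0 : ∀ k < J, ∀ i, ∑ j ∈ (S k).cls i, (if a k j = a k i then b k j else 0) = 0)
    (θ₁ θ₂ : ℝ) {c : ℝ≥0} (h1 : |θ₁| ≤ c) (h2 : |θ₂| ≤ c) :
    ellNorm p (fun i => ∑ k ∈ Finset.range J, (θ₁ * a k i + θ₂ * b k i) • y k i)
      ≤ 2 * c * (B * ellNorm p (fun i => ∑ k ∈ Finset.range J, (a k i + b k i) • y k i)) := by
  classical
  -- each class of `S k` is first divided into the level sets of `a k`
  let P : ℕ → FinPart ι := fun k => if k % 2 = 0 then S (k / 2) else (S (k / 2)).split (a (k / 2))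
  let d : ℕ → ι → X := fun k i => (if k % 2 = 0 then a (k / 2) i else b (k / 2) i) • y (k / 2) i
  have hP0 : ∀ k, P (2 * k) = S k := fun k => by simp [P]
  have hP1 : ∀ k, P (2 * k + 1) = (S k).split (a k) := fun k => by
    simp [P, Nat.add_mod, show (2 * k + 1) / 2 = k by omega]
  have hP2 : ∀ k, P (2 * k + 1 + 1) = S (k + 1) := fun k => by
    rw [← hP0, show 2 * k + 1 + 1 = 2 * (k + 1) by ring]
  have hd0 : ∀ k i, d (2 * k) i = a k i • y k i := fun k i => by simp [d]
  have hd1 : ∀ k i, d (2 * k + 1) i = b k i • y k i := fun k i => by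
    simp [d, Nat.add_mod, show (2 * k + 1) / 2 = k by omega]
  have hd : IsMartDiff P d (2 * J) := by
    refine ⟨fun k hk => ?_, fun k hk i j hj => ?_, fun k hk => ?_, fun k hk i => ?_⟩
    · obtain ⟨l, rfl | rfl⟩ := Nat.even_or_odd' k
      · rw [hP0, hP1]; exact FinPart.split_finer _ _
      · rw [hP1, hP2]; exact (hS l (by omega)).split (ha l (by omega))
    · obtain ⟨l, rfl | rfl⟩ := Nat.even_or_odd' k
      · rw [hP1, FinPart.mem_split] at hj
        rw [hd0, hd0, hj.2, hy l (by omega) i j hj.1]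
      · rw [hP2] at hj
        rw [hd1, hd1, hb l (by omega) i j hj, hy l (by omega) i j (hS l (by omega) i hj)]
    · obtain ⟨l, rfl | rfl⟩ := Nat.even_or_odd' k
      · refine (hyf l (by omega)).subset fun i hi => ?_
        rw [Function.mem_support, hd0] at hi
        intro h0; simp [h0] at hi
      · refine (hyf l (by omega)).subset fun i hi => ?_
        rw [Function.mem_support, hd1] at hi
        intro h0; simp [h0] at hi
    · obtain ⟨l, rfl | rfl⟩ := Nat.even_or_odd' k
      · rw [hP0, Finset.sum_congr rfl fun j hj => by rw [hd0, hy l (by omega) i j hj],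
          ← Finset.sum_smul, ha0 l (by omega), zero_smul]
      · rw [hP1, Finset.sum_congr rfl fun j hj => by
            rw [hd1, hy l (by omega) i j (FinPart.mem_split.1 hj).1],
          ← Finset.sum_smul, FinPart.sum_split_cls, hb0 l (by omega), zero_smul]
  have key := h.predictable_rclike hp hd (fun k _ => if k % 2 = 0 then θ₁ else θ₂) (c := c)
    (fun k hk i j _ => rfl) (fun k i => by split_ifs; exacts [h1, h2])
  simp only [sum_range_two_mul, hd0, hd1] at key
  have e1 : (fun i => ∑ k ∈ Finset.range J, (θ₁ * a k i + θ₂ * b k i) • y k i)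
      = fun i => ∑ k ∈ Finset.range J, ((if 2 * k % 2 = 0 then θ₁ else θ₂) • a k i • y k i
        + (if (2 * k + 1) % 2 = 0 then θ₁ else θ₂) • b k i • y k i) := by
    ext i
    refine Finset.sum_congr rfl fun k _ => ?_
    simp [Nat.add_mod, add_smul, mul_smul]
  rw [e1]
  simpa only [add_smul] using key

end Transforms

/-! ### Dyadic rectangles -/

/-- The lattice `ℤⁿ`, which indexes the cells of a grid of cubes. -/
abbrev Cell (n : ℕ) := Fin n → ℤ

section Rectangles

variable {n : ℕ}

/-- The binary logarithms of the side lengths of the rectangles of level `s`. From one level to the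
next exactly one side is doubled, and `n` levels make up one dyadic scale. -/
def sideExp (s : ℕ) (c : Fin n) : ℕ := (s + c) / n

/-- The side lengths of the rectangles of level `s`. -/
def side (s : ℕ) (c : Fin n) : ℤ := 2 ^ sideExp s c

/-- The rectangle of level `s` with lower corner `u`. -/
def rect (s : ℕ) (u : Cell n) : Finset (Cell n) :=
  Fintype.piFinset fun c => Finset.Ico (u c) (u c + side s c)

/-- The number of points in a rectangle of level `s`. -/
def rectCard (n s : ℕ) : ℕ := ∏ c : Fin n, 2 ^ sideExp s c

/-- The lower corner of the rectangle with index `q` in the grid of level `s` with origin `t`. -/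
def gridPos (t : Cell n) (s : ℕ) (q : Cell n) : Cell n := fun c => t c + q c * side s c

/-- The index of the rectangle containing `i` in the grid of level `s` with origin `t`. -/
def blk (t : Cell n) (s : ℕ) (i : Cell n) : Cell n := fun c => (i c - t c) / side s c

lemma side_pos (s : ℕ) (c : Fin n) : 0 < side s c := by unfold side; positivity

lemma rectCard_pos (n s : ℕ) : 0 < rectCard n s := Finset.prod_pos fun _ _ => by positivity

lemma rectCard_ne_zero (n s : ℕ) : (rectCard n s : ℝ) ≠ 0 := by exact_mod_cast (rectCard_pos n s).ne'

lemma mem_rect {s : ℕ} {u i : Cell n} : i ∈ rect s u ↔ ∀ c, u c ≤ i c ∧ i c < u c + side s c := by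
  simp [rect]

lemma card_rect (s : ℕ) (u : Cell n) : (rect s u).card = rectCard n s := by
  simp only [rect, rectCard, side, Fintype.card_piFinset, Int.card_Ico, add_sub_cancel_left]
  exact Finset.prod_congr rfl fun c _ => by
    rw [show (2 : ℤ) ^ sideExp s c = ((2 ^ sideExp s c : ℕ) : ℤ) by push_cast; rfl,
      Int.toNat_natCast]

lemma self_mem_rect (s : ℕ) (u : Cell n) : u ∈ rect s u :=
  mem_rect.2 fun c => ⟨le_rfl, by linarith [side_pos s c]⟩

lemma mem_rect_gridPos {t : Cell n} {s : ℕ} {q i : Cell n} :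
    i ∈ rect s (gridPos t s q) ↔ blk t s i = q := by
  rw [mem_rect, funext_iff]
  refine forall_congr' fun c => ?_
  have h := side_pos s c
  rw [blk, gridPos, Int.ediv_eq_iff_of_pos h]
  constructor <;> rintro ⟨h1, h2⟩ <;> constructor <;> linarith

/-- The partition of the lattice into rectangles of level `s`, with origin `t`. -/
def grid (t : Cell n) (s : ℕ) : FinPart (Cell n) where
  cls i := rect s (gridPos t s (blk t s i))
  mem_cls _ := mem_rect_gridPos.2 rfl
  cls_eq h := by rw [mem_rect_gridPos.1 h]

lemma mem_grid {t : Cell n} {s : ℕ} {i j : Cell n} :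
    j ∈ (grid t s).cls i ↔ blk t s j = blk t s i := mem_rect_gridPos

lemma blk_eq_ediv {t : Cell n} {s s' : ℕ} {c : Fin n} {k : ℕ}
    (h : sideExp s' c = sideExp s c + k) (i : Cell n) : blk t s' i c = blk t s i c / 2 ^ k := by
  rw [blk, blk, side, side, h, pow_add, Int.ediv_ediv,
    if_neg fun hk => absurd hk.1 (not_lt.2 (by positivity)), sub_zero]

lemma sideExp_mono {s s' : ℕ} (h : s ≤ s') (c : Fin n) : sideExp s c ≤ sideExp s' c :=
  Nat.div_le_div_right (by omega)

lemma grid_finer (t : Cell n) {s s' : ℕ} (h : s ≤ s') : (grid t s).Finer (grid t s') := by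
  intro i j hj
  rw [mem_grid] at hj ⊢
  ext c
  obtain ⟨k, hk⟩ := Nat.exists_eq_add_of_le (sideExp_mono h c)
  rw [blk_eq_ediv hk, blk_eq_ediv hk, hj]

lemma sideExp_add_mul [NeZero n] (s L : ℕ) (c : Fin n) :
    sideExp (s + n * L) c = sideExp s c + L := by
  rw [sideExp, sideExp, show s + n * L + c = s + c + n * L by ring,
    Nat.add_mul_div_left _ _ (Nat.pos_of_neZero n)]

/-- The coordinate whose side is doubled from level `s` to level `s + 1`. -/
def axis [NeZero n] (s : ℕ) : Fin n :=
  ⟨n - 1 - s % n, by have := Nat.pos_of_neZero n; omega⟩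

lemma sideExp_succ [NeZero n] (s : ℕ) (c : Fin n) :
    sideExp (s + 1) c = sideExp s c + if c = axis s then 1 else 0 := by
  have hn := Nat.pos_of_neZero n
  rw [sideExp, sideExp, show s + 1 + c = s + c + 1 by ring, Nat.succ_div]
  congr 1
  have : n ∣ s + c + 1 ↔ c = axis s := by
    have h1 := Nat.mod_lt s hn
    have h2 := Nat.div_add_mod s n
    have h3 := c.2
    rw [Fin.ext_iff, axis]
    rw [show s + c + 1 = n * (s / n) + (s % n + c + 1) by omega,
      Nat.dvd_add_right (Dvd.intro _ rfl)]
    constructor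
    · intro h
      have := Nat.le_of_dvd (by omega) h
      have h4 : s % n + c + 1 = n := by
        refine Nat.eq_of_dvd_of_lt_two_mul (by omega) h (by omega)
      simp only; omega
    · intro h
      simp only at h
      rw [show s % n + c + 1 = n by omega]
  simp only [this]

lemma side_succ [NeZero n] (s : ℕ) (c : Fin n) :
    side (s + 1) c = if c = axis s then 2 * side s c else side s c := by
  rw [side, side, sideExp_succ]
  split_ifs <;> simp [pow_succ, mul_comm]

lemma rectCard_succ [NeZero n] (s : ℕ) : rectCard n (s + 1) = 2 * rectCard n s := by
  rw [rectCard, rectCard]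
  simp only [sideExp_succ, pow_add, Finset.prod_mul_distrib]
  rw [mul_comm]
  congr 1
  simp [Finset.prod_ite_eq', apply_ite (fun k => 2 ^ k)]

lemma rectCard_eq [NeZero n] (s : ℕ) : rectCard n s = 2 ^ s := by
  induction s with
  | zero => simp [rectCard, sideExp, Nat.div_eq_of_lt]
  | succ s ih => rw [rectCard_succ, ih, pow_succ']

/-- The translation from the lower to the upper half of a rectangle of level `s + 1`. -/
def halfShift [NeZero n] (s : ℕ) : Cell n :=
  Pi.single (axis s : Fin n) (side s (axis s : Fin n))

/-- The sign of the Haar functions of level `s + 1`: positive on lower halves. -/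
def haarSign [NeZero n] (t : Cell n) (s : ℕ) (i : Cell n) : ℝ :=
  if Even (blk t s i (axis s)) then 1 else -1

variable {X : Type*} [NormedAddCommGroup X] [NormedSpace ℝ X]

/-- The average of `f` over a rectangle. -/
def rectAvg (f : Cell n → X) (s : ℕ) (u : Cell n) : X :=
  (rectCard n s : ℝ)⁻¹ • ∑ j ∈ rect s u, f j

lemma grid_avg (t : Cell n) (s : ℕ) (f : Cell n → X) (i : Cell n) :
    (grid t s).avg f i = rectAvg f s (gridPos t s (blk t s i)) := by
  rw [FinPart.avg, rectAvg]
  simp only [grid, card_rect]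

variable [NeZero n]

lemma haarSign_eq (t : Cell n) (s : ℕ) (i : Cell n) : haarSign t s i = 1 ∨ haarSign t s i = -1 := by
  unfold haarSign; split_ifs <;> simp

lemma blk_succ (t : Cell n) (s : ℕ) (i : Cell n) (c : Fin n) :
    blk t (s + 1) i c = if c = axis s then blk t s i c / 2 else blk t s i c := by
  split_ifs with h
  · rw [blk_eq_ediv (s := s) (k := 1) (by rw [sideExp_succ, if_pos h]), pow_one]
  · rw [blk_eq_ediv (s := s) (k := 0) (by rw [sideExp_succ, if_neg h]), pow_zero, Int.ediv_one]

/-- The rectangle of level `s` containing `i` is the lower or upper half of the one of level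
`s + 1`, according to the sign at `i`. -/
lemma gridPos_blk_eq (t : Cell n) (s : ℕ) (i : Cell n) :
    gridPos t s (blk t s i) = if haarSign t s i = 1 then gridPos t (s + 1) (blk t (s + 1) i)
      else gridPos t (s + 1) (blk t (s + 1) i) + halfShift s := by
  ext c
  have h2 : haarSign t s i = 1 ↔ Even (blk t s i (axis s)) := by
    unfold haarSign; split_ifs with h <;> simp [h]; norm_num
  by_cases he : haarSign t s i = 1
  · rw [if_pos he, gridPos, gridPos, blk_succ, side_succ]
    split_ifs with hc
    · obtain ⟨r, hr⟩ := h2.1 he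
      subst hc
      rw [hr, show r + r = r * 2 by ring, Int.mul_ediv_cancel _ two_ne_zero]; ring
    · rfl
  · rw [if_neg he, Pi.add_apply, gridPos, gridPos, blk_succ, side_succ, halfShift]
    split_ifs with hc
    · subst hc
      obtain ⟨r, hr⟩ := Int.not_even_iff_odd.1 (mt h2.2 he)
      rw [hr, Pi.single_eq_same, show (2 * r + 1) / 2 = r by omega]; ring
    · simp [Pi.single_eq_of_ne hc]

lemma mem_rect_succ {s : ℕ} {u i : Cell n} :
    i ∈ rect (s + 1) u ↔ i ∈ rect s u ∨ i ∈ rect s (u + halfShift s) := by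
  simp only [mem_rect, side_succ, Pi.add_apply, halfShift]
  constructor
  · intro h
    by_cases h1 : i (axis s : Fin n) < u (axis s) + side s (axis s : Fin n)
    · left
      intro c
      have := h c
      split_ifs at this with hc
      · subst hc; exact ⟨this.1, h1⟩
      · exact this
    · right
      intro c
      have := h c
      split_ifs at this with hc
      · subst hc; rw [Pi.single_eq_same]; constructor <;> linarith
      · rw [Pi.single_eq_of_ne hc]; simpa using this
  · rintro (h | h) c
    · have := h c
      have h1 := side_pos s c
      split_ifs
      · constructor <;> linarith
      · exact this
    · have := h c
      have h1 := side_pos s c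
      split_ifs with hc
      · subst hc; rw [Pi.single_eq_same] at this; constructor <;> linarith
      · rw [Pi.single_eq_of_ne hc] at this; simpa using this

lemma disjoint_rect_halfShift (s : ℕ) (u : Cell n) :
    Disjoint (rect s u) (rect s (u + halfShift s)) := by
  rw [Finset.disjoint_left]
  intro i h1 h2
  have := (mem_rect.1 h1 (axis s)).2
  have := (mem_rect.1 h2 (axis s)).1
  simp only [Pi.add_apply, halfShift, Pi.single_eq_same] at this
  linarith

lemma rect_succ (s : ℕ) (u : Cell n) :
    rect (s + 1) u = (rect s u).disjUnion _ (disjoint_rect_halfShift s u) := by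
  ext i
  rw [Finset.mem_disjUnion, mem_rect_succ]

lemma sum_rect_succ {M : Type*} [AddCommMonoid M] (s : ℕ) (u : Cell n) (f : Cell n → M) :
    ∑ i ∈ rect (s + 1) u, f i = ∑ i ∈ rect s u, f i + ∑ i ∈ rect s (u + halfShift s), f i := by
  rw [rect_succ, Finset.sum_disjUnion]

/-- The sign on the two halves of a rectangle. -/
lemma haarSign_of_mem {t : Cell n} {s : ℕ} {q i : Cell n} :
    (i ∈ rect s (gridPos t (s + 1) q) → haarSign t s i = 1) ∧
    (i ∈ rect s (gridPos t (s + 1) q + halfShift s) → haarSign t s i = -1) := by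
  have key : ∀ i, i ∈ rect (s + 1) (gridPos t (s + 1) q) →
      i ∈ rect s (if haarSign t s i = 1 then gridPos t (s + 1) q
        else gridPos t (s + 1) q + halfShift s) := by
    intro i hi
    rw [mem_rect_gridPos] at hi
    rw [← hi, ← gridPos_blk_eq]
    exact mem_rect_gridPos.2 rfl
  have hd := Finset.disjoint_left.1 (disjoint_rect_halfShift s (gridPos t (s + 1) q))
  constructor
  · intro h
    have := key i (mem_rect_succ.2 (Or.inl h))
    by_contra h1
    rw [if_neg h1] at this
    exact hd h this
  · intro h
    have := key i (mem_rect_succ.2 (Or.inr h))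
    refine (haarSign_eq t s i).resolve_left fun h1 => ?_
    rw [if_pos h1] at this
    exact hd this h

lemma sum_rect_haarSign (t : Cell n) (s : ℕ) (q : Cell n) (F : ℝ → ℝ) :
    ∑ i ∈ rect (s + 1) (gridPos t (s + 1) q), F (haarSign t s i)
      = rectCard n s * (F 1 + F (-1)) := by
  rw [sum_rect_succ, Finset.sum_congr rfl fun i hi => by rw [haarSign_of_mem.1 hi],
    Finset.sum_const, card_rect, Finset.sum_congr rfl fun i hi => by rw [haarSign_of_mem.2 hi],
    Finset.sum_const, card_rect]
  simp only [nsmul_eq_mul]; ring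

/-- The Haar coefficient of `f` at a rectangle of level `s + 1`. -/
def haarCoeff (f : Cell n → X) (s : ℕ) (u : Cell n) : X :=
  (1 / 2 : ℝ) • (rectAvg f s u - rectAvg f s (u + halfShift s))

lemma rectAvg_succ (f : Cell n → X) (s : ℕ) (u : Cell n) :
    rectAvg f (s + 1) u = (1 / 2 : ℝ) • (rectAvg f s u + rectAvg f s (u + halfShift s)) := by
  rw [rectAvg, rectAvg, rectAvg, sum_rect_succ, ← smul_add, smul_smul, rectCard_succ]
  push_cast
  rw [mul_inv, one_div]

/-- The martingale difference of `f` in terms of Haar functions. -/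
lemma grid_avg_sub (t : Cell n) (s : ℕ) (f : Cell n → X) (i : Cell n) :
    (grid t s).avg f i - (grid t (s + 1)).avg f i
      = haarSign t s i • haarCoeff f s (gridPos t (s + 1) (blk t (s + 1) i)) := by
  rw [grid_avg, grid_avg, rectAvg_succ, gridPos_blk_eq, haarCoeff]
  rcases haarSign_eq t s i with h | h
  · rw [if_pos h, h]; module
  · rw [if_neg (by rw [h]; norm_num), h]; module

end Rectangles

/-! ### Pairs of rectangles -/

section Pairs

variable {n : ℕ}

/-- The partition obtained from the grid by joining the rectangles with indices `q` and `π q`. -/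
def pairPart (t : Cell n) (s : ℕ) (π : Cell n → Cell n) (hπ : Function.Involutive π) :
    FinPart (Cell n) where
  cls i := rect s (gridPos t s (blk t s i)) ∪ rect s (gridPos t s (π (blk t s i)))
  mem_cls i := Finset.mem_union_left _ (mem_rect_gridPos.2 rfl)
  cls_eq {i j} h := by
    rcases Finset.mem_union.1 h with h | h
    · rw [mem_rect_gridPos.1 h]
    · rw [mem_rect_gridPos.1 h, hπ, Finset.union_comm]

lemma mem_pairPart {t : Cell n} {s : ℕ} {π : Cell n → Cell n} {hπ : Function.Involutive π}
    {i j : Cell n} : j ∈ (pairPart t s π hπ).cls i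
      ↔ blk t s j = blk t s i ∨ blk t s j = π (blk t s i) := by
  simp only [pairPart, Finset.mem_union, mem_rect_gridPos]

/-- A set of indices `q` for which the pairs `{q, q + m}` are mutually disjoint. -/
structure IsPairing (m : Cell n) (A : Set (Cell n)) : Prop where
  ne_zero : m ≠ 0
  disj : ∀ q ∈ A, q + m ∉ A

open Classical in
/-- The involution that exchanges `q` and `q + m` for `q ∈ A`. -/
def partner (m : Cell n) (A : Set (Cell n)) (q : Cell n) : Cell n :=
  if q ∈ A then q + m else if q - m ∈ A then q - m else q

open Classical in
/-- The function that is `1` at `q ∈ A`, `-1` at `q + m` for `q ∈ A`, and `0` elsewhere. -/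
def pairSign (m : Cell n) (A : Set (Cell n)) (q : Cell n) : ℝ :=
  if q ∈ A then 1 else if q - m ∈ A then -1 else 0

open Classical in
/-- The index in `A` of the pair which contains `q`. -/
def pairBase (m : Cell n) (A : Set (Cell n)) (q : Cell n) : Cell n := if q ∈ A then q else q - m

variable {m : Cell n} {A : Set (Cell n)}

lemma IsPairing.sub_not_mem (h : IsPairing m A) {q : Cell n} (hq : q ∈ A) : q - m ∉ A := by
  intro h'
  have := h.disj _ h'
  rw [sub_add_cancel] at this
  exact this hq

lemma IsPairing.involutive (h : IsPairing m A) : Function.Involutive (partner m A) := by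
  intro q
  by_cases h1 : q ∈ A
  · simp [partner, h1, h.disj q h1]
  · by_cases h2 : q - m ∈ A
    · simp [partner, h1, h2]
    · simp [partner, h1, h2]

lemma pairSign_cases (q : Cell n) : (q ∈ A ∧ pairSign m A q = 1)
    ∨ (q ∉ A ∧ q - m ∈ A ∧ pairSign m A q = -1) ∨ (q ∉ A ∧ q - m ∉ A ∧ pairSign m A q = 0) := by
  unfold pairSign
  by_cases h1 : q ∈ A
  · simp [h1]
  · by_cases h2 : q - m ∈ A <;> simp [h1, h2]

lemma finer_pairPart (h : IsPairing m A) (t : Cell n) {s s' : ℕ} (hs : s' ≤ s) :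
    (grid t s').Finer (pairPart t s (partner m A) h.involutive) :=
  (grid_finer t hs).trans fun _ _ hj => mem_pairPart.2 (Or.inl (mem_grid.1 hj))

variable [NeZero n]

/-- Sums over the classes of a pair partition, of functions that depend on the four quarters of
each pair only. -/
lemma sum_pairPart_eq_zero (h : IsPairing m A) (t : Cell n) (s : ℕ) (F : ℝ → ℝ → ℝ)
    (h0 : ∀ r, F 0 r = 0) (h4 : F 1 1 + F 1 (-1) + F (-1) 1 + F (-1) (-1) = 0) (i : Cell n) :
    ∑ j ∈ (pairPart t (s + 1) (partner m A) h.involutive).cls i,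
      F (pairSign m A (blk t (s + 1) j)) (haarSign t s j) = 0 := by
  have hsum : ∀ q, ∑ j ∈ rect (s + 1) (gridPos t (s + 1) q),
      F (pairSign m A (blk t (s + 1) j)) (haarSign t s j)
      = rectCard n s * (F (pairSign m A q) 1 + F (pairSign m A q) (-1)) := by
    intro q
    rw [← sum_rect_haarSign t s q (F (pairSign m A q))]
    exact Finset.sum_congr rfl fun j hj => by rw [mem_rect_gridPos.1 hj]
  have hdisj : ∀ q q' : Cell n, q ≠ q' →
      Disjoint (rect (s + 1) (gridPos t (s + 1) q)) (rect (s + 1) (gridPos t (s + 1) q')) := by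
    intro q q' hqq
    rw [Finset.disjoint_left]
    intro j h1 h2
    exact hqq ((mem_rect_gridPos.1 h1).symm.trans (mem_rect_gridPos.1 h2))
  have hm : ∀ q : Cell n, q ≠ q + m := fun q hq => h.ne_zero (by simpa using hq)
  simp only [pairPart]
  rcases pairSign_cases (m := m) (A := A) (blk t (s + 1) i) with h1 | h1 | h1
  · have e : partner m A (blk t (s + 1) i) = blk t (s + 1) i + m := by simp [partner, h1.1]
    have e2 : pairSign m A (blk t (s + 1) i + m) = -1 := by
      simp [pairSign, h.disj _ h1.1, h1.1]
    rw [e, Finset.sum_union (hdisj _ _ (hm _)), hsum, hsum, e2, h1.2]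
    linear_combination (rectCard n s : ℝ) * h4
  · have e : partner m A (blk t (s + 1) i) = blk t (s + 1) i - m := by
      simp [partner, h1.1, h1.2.1]
    have e2 : pairSign m A (blk t (s + 1) i - m) = 1 := by simp [pairSign, h1.2.1]
    rw [e, Finset.sum_union (hdisj _ _ fun hq => h.ne_zero (sub_eq_self.1 hq.symm)), hsum, hsum, e2,
      h1.2.2]
    linear_combination (rectCard n s : ℝ) * h4
  · have e : partner m A (blk t (s + 1) i) = blk t (s + 1) i := by
      simp [partner, h1.1, h1.2.1]
    rw [e, Finset.union_self, hsum, h1.2.2, h0, h0]; simp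

/-- `A` consists of indices `q` such that the rectangles with indices `q` and `q + m` have a common
ancestor `n * L` levels further up. -/
def IsGood (m : Cell n) (L : ℕ) (A : Set (Cell n)) : Prop :=
  ∀ q ∈ A, ∀ c, q c / 2 ^ L = (q c + m c) / 2 ^ L

lemma pairPart_finer (h : IsPairing m A) {L : ℕ} (hA : IsGood m L A) (t : Cell n) (s : ℕ) :
    (pairPart t s (partner m A) h.involutive).Finer (grid t (s + n * L)) := by
  intro i j hj
  rw [mem_pairPart] at hj
  rw [mem_grid]
  ext c
  rw [blk_eq_ediv (sideExp_add_mul s L c), blk_eq_ediv (sideExp_add_mul s L c)]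
  rcases hj with hj | hj
  · rw [hj]
  · rw [hj]
    set q := blk t s i
    by_cases h1 : q ∈ A
    · simp only [partner, h1, if_true, Pi.add_apply]
      exact (hA q h1 c).symm
    · by_cases h2 : q - m ∈ A
      · simp only [partner, h1, h2, if_true, if_false]
        have := hA _ h2 c
        simpa using this
      · simp [partner, h1, h2]

end Pairs

/-! ### Haar multipliers and exchange operators -/

section Chains

variable {n : ℕ}

/-- The levels in the residue class of `ρ` modulo `n * L + 1`, from coarse to fine. -/
def chainLevel (n L ρ J k : ℕ) : ℕ := ρ + (n * L + 1) * (J - 1 - k)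

lemma chainLevel_succ {n L ρ J k : ℕ} (h : k + 1 < J) :
    chainLevel n L ρ J k = chainLevel n L ρ J (k + 1) + 1 + n * L := by
  unfold chainLevel
  obtain ⟨r, hr⟩ : ∃ r, J - 1 - k = r + 1 := ⟨J - 1 - k - 1, by omega⟩
  rw [hr, show J - 1 - (k + 1) = r by omega]; ring

lemma chainLevel_last {n L ρ J k : ℕ} (h : J ≤ k + 1) : chainLevel n L ρ J k = ρ := by
  unfold chainLevel
  rw [show J - 1 - k = 0 by omega]; simp

/-- The pair partitions along a chain of levels, closed by a grid at the fine end. -/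
def pairChain (t m : Cell n) (A : ℕ → Set (Cell n)) (hA : ∀ k, IsPairing m (A k)) (L ρ J k : ℕ) :
    FinPart (Cell n) :=
  if k < J then pairPart t (chainLevel n L ρ J k + 1) (partner m (A k)) (hA k).involutive
  else grid t ρ

variable {t m : Cell n} {A : ℕ → Set (Cell n)} {hA : ∀ k, IsPairing m (A k)}
  {L ρ J k : ℕ}

lemma pairChain_of_lt (hk : k < J) : pairChain t m A hA L ρ J k
    = pairPart t (chainLevel n L ρ J k + 1) (partner m (A k)) (hA k).involutive := if_pos hk

variable {X : Type*} [NormedAddCommGroup X]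

open Classical in
/-- The vector coefficient `Y`, given on the indices in `A`, as a function on the union of the
pairs of rectangles. -/
def pairCoeff (m : Cell n) (A : Set (Cell n)) (Y : Cell n → X) (q : Cell n) : X :=
  if pairSign m A q = 0 then 0 else Y (pairBase m A q)

lemma pairCoeff_partner {A : Set (Cell n)} (h : IsPairing m A) (Y : Cell n → X) (q : Cell n) :
    pairCoeff m A Y (partner m A q) = pairCoeff m A Y q := by
  by_cases h1 : q ∈ A
  · simp [pairCoeff, pairSign, pairBase, partner, h1, h.disj q h1]
  · by_cases h2 : q - m ∈ A
    · simp [pairCoeff, pairSign, pairBase, partner, h1, h2]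
    · simp [pairCoeff, pairSign, partner, h1, h2]

lemma finite_support_blk (t : Cell n) (s : ℕ) {Y : Cell n → X} (hY : (Function.support Y).Finite) :
    (Function.support fun i => Y (blk t s i)).Finite := by
  refine (hY.biUnion fun q _ => (rect s (gridPos t s q)).finite_toSet).subset ?_
  intro i hi
  exact Set.mem_biUnion (show blk t s i ∈ Function.support Y from hi) (mem_rect_gridPos.2 rfl)

lemma finite_support_pairCoeff {A : Set (Cell n)} {Y : Cell n → X}
    (hY : (Function.support Y).Finite) : (Function.support (pairCoeff m A Y)).Finite := by
  refine (hY.union (hY.image fun q => q + m)).subset ?_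
  intro q hq
  rw [Function.mem_support, pairCoeff] at hq
  split_ifs at hq with h
  · exact absurd rfl hq
  · rw [pairBase] at hq
    split_ifs at hq with h1
    · exact Or.inl hq
    · exact Or.inr ⟨q - m, hq, by simp⟩

variable [NeZero n]

lemma pairChain_succ_finer_grid (hG : ∀ k, IsGood m L (A k)) (hk : k < J) :
    (pairChain t m A hA L ρ J (k + 1)).Finer (grid t (chainLevel n L ρ J k)) := by
  by_cases h : k + 1 < J
  · rw [pairChain_of_lt h, chainLevel_succ h]
    exact pairPart_finer (hA _) (hG _) _ _
  · rw [pairChain, if_neg h, chainLevel_last (by omega)]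
    exact fun i => subset_rfl

lemma pairChain_succ_finer (hG : ∀ k, IsGood m L (A k)) (hk : k < J) :
    (pairChain t m A hA L ρ J (k + 1)).Finer (pairChain t m A hA L ρ J k) := by
  refine (pairChain_succ_finer_grid hG hk).trans ?_
  rw [pairChain_of_lt hk]
  exact finer_pairPart (hA k) t (Nat.le_succ _)

lemma haarSign_inv (t : Cell n) (s : ℕ) : (grid t s).Inv (haarSign t s) := by
  intro i j hj
  rw [haarSign, haarSign, mem_grid.1 hj]

variable [NormedSpace ℝ X] {p B : ℝ≥0∞}

/-- Exchange of one martingale difference on pairs of rectangles for another; both are described by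
functions of the signs which single out the four quarters of the pair. -/
lemma IsDiscreteUMDBound.pair_transfer (hp : 1 ≤ p) (h : IsDiscreteUMDBound (Cell n) p X B)
    (hA : ∀ k, IsPairing m (A k)) (hG : ∀ k, IsGood m L (A k)) (t : Cell n) (ρ J : ℕ)
    (Y : ℕ → Cell n → X) (hY : ∀ k, (Function.support (Y k)).Finite)
    (F₁ F₂ : ℝ → ℝ → ℝ) (h10 : ∀ r, F₁ 0 r = 0) (h20 : ∀ r, F₂ 0 r = 0)
    (h14 : F₁ 1 1 + F₁ 1 (-1) + F₁ (-1) 1 + F₁ (-1) (-1) = 0)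
    (h24 : ∀ c, (if F₁ 1 1 = c then F₂ 1 1 else 0) + (if F₁ 1 (-1) = c then F₂ 1 (-1) else 0)
      + (if F₁ (-1) 1 = c then F₂ (-1) 1 else 0)
      + (if F₁ (-1) (-1) = c then F₂ (-1) (-1) else 0) = 0)
    (θ₁ θ₂ : ℝ) {c : ℝ≥0} (h1 : |θ₁| ≤ c) (h2 : |θ₂| ≤ c) (f g : Cell n → X)
    (hf : ∀ i, f i = ∑ k ∈ Finset.range J,
      (F₁ (pairSign m (A k) (blk t (chainLevel n L ρ J k + 1) i))
          (haarSign t (chainLevel n L ρ J k) i)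
        + F₂ (pairSign m (A k) (blk t (chainLevel n L ρ J k + 1) i))
          (haarSign t (chainLevel n L ρ J k) i))
      • pairCoeff m (A k) (Y k) (blk t (chainLevel n L ρ J k + 1) i))
    (hg : ∀ i, g i = ∑ k ∈ Finset.range J,
      (θ₁ * F₁ (pairSign m (A k) (blk t (chainLevel n L ρ J k + 1) i))
          (haarSign t (chainLevel n L ρ J k) i)
        + θ₂ * F₂ (pairSign m (A k) (blk t (chainLevel n L ρ J k + 1) i))
          (haarSign t (chainLevel n L ρ J k) i))
      • pairCoeff m (A k) (Y k) (blk t (chainLevel n L ρ J k + 1) i)) :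
    ellNorm p g ≤ 2 * c * (B * ellNorm p f) := by
  rw [funext hf, funext hg]
  have hinv : ∀ (F : ℝ → ℝ → ℝ), ∀ k < J, (pairChain t m A hA L ρ J (k + 1)).Inv fun i =>
      F (pairSign m (A k) (blk t (chainLevel n L ρ J k + 1) i))
        (haarSign t (chainLevel n L ρ J k) i) := by
    intro F k hk
    refine FinPart.Inv.mono (pairChain_succ_finer_grid hG hk) ?_
    intro i j hj
    have h1 := haarSign_inv t _ i j hj
    have h2 := mem_grid.1 (grid_finer t (Nat.le_succ _) i hj)
    simp only [h1, Nat.succ_eq_add_one] at h2 ⊢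
    rw [h2]
  refine h.transfer hp (pairChain t m A hA L ρ J) J (fun k hk => pairChain_succ_finer hG hk)
    (fun k i => pairCoeff m (A k) (Y k) (blk t (chainLevel n L ρ J k + 1) i)) ?_ ?_
    (fun k i => F₁ (pairSign m (A k) (blk t (chainLevel n L ρ J k + 1) i))
        (haarSign t (chainLevel n L ρ J k) i))
    (fun k i => F₂ (pairSign m (A k) (blk t (chainLevel n L ρ J k + 1) i))
        (haarSign t (chainLevel n L ρ J k) i))
    (hinv F₁) (hinv F₂) ?_ ?_ θ₁ θ₂ h1 h2
  · intro k hk i j hj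
    rw [pairChain_of_lt hk, mem_pairPart] at hj
    rcases hj with hj | hj
    · simp only [hj]
    · simp only [hj, pairCoeff_partner (hA k)]
  · exact fun k _ => finite_support_blk t _ (finite_support_pairCoeff (hY k))
  · intro k hk i
    rw [pairChain_of_lt hk]
    exact sum_pairPart_eq_zero (hA k) t _ F₁ h10 h14 i
  · intro k hk i
    rw [pairChain_of_lt hk]
    exact sum_pairPart_eq_zero (hA k) t _ (fun x y => if F₁ x y = F₁ _ _ then F₂ x y else 0)
      (fun r => by simp [h20]) (h24 _) i

open Classical in
/-- Moving Haar functions by `m`. If `a` is half the sum and `b` half the difference of the Haar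
functions of the two rectangles of a pair, then these functions are `a + b` and `a - b`, and `b` has
mean zero on the level sets of `a`. -/
lemma IsDiscreteUMDBound.haar_move (hp : 1 ≤ p) (h : IsDiscreteUMDBound (Cell n) p X B)
    (hA : ∀ k, IsPairing m (A k)) (hG : ∀ k, IsGood m L (A k)) (t : Cell n) (ρ J : ℕ)
    (Y : ℕ → Cell n → X) (hY : ∀ k, (Function.support (Y k)).Finite) :
    ellNorm p (fun i => ∑ k ∈ Finset.range J,
      if blk t (chainLevel n L ρ J k + 1) i - m ∈ A k then haarSign t (chainLevel n L ρ J k) i •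
        Y k (blk t (chainLevel n L ρ J k + 1) i - m) else 0)
    ≤ 2 * (B * ellNorm p (fun i => ∑ k ∈ Finset.range J,
      if blk t (chainLevel n L ρ J k + 1) i ∈ A k then haarSign t (chainLevel n L ρ J k) i •
        Y k (blk t (chainLevel n L ρ J k + 1) i) else 0)) := by
  have key := h.pair_transfer hp hA hG t ρ J Y hY (fun x y => x ^ 2 * y / 2) (fun x y => x * y / 2)
    (by simp) (by simp) (by norm_num) (fun c => by norm_num; split_ifs <;> norm_num) 1 (-1) (c := 1)
    (by simp) (by simp)
    (fun i => ∑ k ∈ Finset.range J,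
      if blk t (chainLevel n L ρ J k + 1) i ∈ A k then haarSign t (chainLevel n L ρ J k) i •
        Y k (blk t (chainLevel n L ρ J k + 1) i) else 0)
    (fun i => ∑ k ∈ Finset.range J,
      if blk t (chainLevel n L ρ J k + 1) i - m ∈ A k then haarSign t (chainLevel n L ρ J k) i •
        Y k (blk t (chainLevel n L ρ J k + 1) i - m) else 0) ?_ ?_
  · simpa using key
  · intro i
    refine Finset.sum_congr rfl fun k _ => ?_
    rcases pairSign_cases (m := m) (A := A k) (blk t (chainLevel n L ρ J k + 1) i)
      with h1 | h1 | h1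
    · simp [pairCoeff, pairBase, h1]
    · simp only [h1.2.2, h1.1, if_false]; norm_num
      rw [neg_div, add_neg_cancel, zero_smul]
    · simp [pairCoeff, h1]
  · intro i
    refine Finset.sum_congr rfl fun k _ => ?_
    rcases pairSign_cases (m := m) (A := A k) (blk t (chainLevel n L ρ J k + 1) i)
      with h1 | h1 | h1
    · have := (hA k).sub_not_mem h1.1
      simp only [h1.2, this, if_false]; norm_num
    · simp only [h1.2.2, h1.1, h1.2.1, if_true, if_false, pairCoeff, pairBase]
      norm_num
      congr 1; ring
    · simp [pairCoeff, h1]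

/-- On a pair of rectangles the Haar function `h` of the first and the difference `w` of the two
indicators are both combinations of this function and `quarterDiff`: the function that is `1`
on the lower half of the first rectangle, with mean zero and constant on the rest of the pair. -/
def quarterMain (x y : ℝ) : ℝ := if x = 0 then 0 else if x = 1 ∧ y = 1 then 1 else -1 / 3

/-- The difference `h - quarterMain`, so that `w = quarterMain - 2 * quarterDiff`. -/
def quarterDiff (x y : ℝ) : ℝ :=
  if x = 0 then 0 else if x = 1 then (if y = 1 then 0 else -2 / 3) else 1 / 3

open Classical in
/-- From Haar functions to differences of indicators. -/
lemma IsDiscreteUMDBound.haar_to_diff (hp : 1 ≤ p) (h : IsDiscreteUMDBound (Cell n) p X B)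
    (hA : ∀ k, IsPairing m (A k)) (hG : ∀ k, IsGood m L (A k)) (t : Cell n) (ρ J : ℕ)
    (Y : ℕ → Cell n → X) (hY : ∀ k, (Function.support (Y k)).Finite) :
    ellNorm p (fun i => ∑ k ∈ Finset.range J,
      pairSign m (A k) (blk t (chainLevel n L ρ J k + 1) i) •
        pairCoeff m (A k) (Y k) (blk t (chainLevel n L ρ J k + 1) i))
    ≤ 4 * (B * ellNorm p (fun i => ∑ k ∈ Finset.range J,
      if blk t (chainLevel n L ρ J k + 1) i ∈ A k then haarSign t (chainLevel n L ρ J k) i •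
        Y k (blk t (chainLevel n L ρ J k + 1) i) else 0)) := by
  have key := h.pair_transfer hp hA hG t ρ J Y hY quarterMain quarterDiff
    (by simp [quarterMain]) (by simp [quarterDiff]) (by norm_num [quarterMain])
    (fun c => by norm_num [quarterMain, quarterDiff]; split_ifs <;> norm_num) 1 (-2) (c := 2)
    (by simp) (by simp)
    (fun i => ∑ k ∈ Finset.range J,
      if blk t (chainLevel n L ρ J k + 1) i ∈ A k then haarSign t (chainLevel n L ρ J k) i •
        Y k (blk t (chainLevel n L ρ J k + 1) i) else 0)
    (fun i => ∑ k ∈ Finset.range J,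
      pairSign m (A k) (blk t (chainLevel n L ρ J k + 1) i) •
        pairCoeff m (A k) (Y k) (blk t (chainLevel n L ρ J k + 1) i)) ?_ ?_
  · refine key.trans (le_of_eq ?_)
    norm_num
  · intro i
    refine Finset.sum_congr rfl fun k _ => ?_
    rcases pairSign_cases (m := m) (A := A k) (blk t (chainLevel n L ρ J k + 1) i)
      with h1 | h1 | h1
    · rcases haarSign_eq t (chainLevel n L ρ J k) i with h2 | h2
      · simp [pairCoeff, pairBase, h1, h2, quarterMain, quarterDiff]
      · simp only [h1.2, h1.1, h2, if_true, pairCoeff, pairBase, quarterMain, quarterDiff]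
        norm_num
    · simp only [h1.2.2, h1.1, if_false, quarterMain, quarterDiff]; norm_num
    · simp [pairCoeff, h1]
  · intro i
    refine Finset.sum_congr rfl fun k _ => ?_
    rcases pairSign_cases (m := m) (A := A k) (blk t (chainLevel n L ρ J k + 1) i)
      with h1 | h1 | h1
    · rcases haarSign_eq t (chainLevel n L ρ J k) i with h2 | h2
      · simp [h1, h2, quarterMain, quarterDiff]
      · simp only [h1.2, h2, quarterMain, quarterDiff]
        norm_num
    · simp only [h1.2.2, quarterMain, quarterDiff]; norm_num
    · simp [h1, quarterMain, quarterDiff]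

open Classical in
/-- From differences of indicators to Haar functions. -/
lemma IsDiscreteUMDBound.diff_to_haar (hp : 1 ≤ p) (h : IsDiscreteUMDBound (Cell n) p X B)
    (hA : ∀ k, IsPairing m (A k)) (hG : ∀ k, IsGood m L (A k)) (t : Cell n) (ρ J : ℕ)
    (Y : ℕ → Cell n → X) (hY : ∀ k, (Function.support (Y k)).Finite) :
    ellNorm p (fun i => ∑ k ∈ Finset.range J,
      if blk t (chainLevel n L ρ J k + 1) i ∈ A k then haarSign t (chainLevel n L ρ J k) i •
        Y k (blk t (chainLevel n L ρ J k + 1) i) else 0)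
    ≤ 2 * (B * ellNorm p (fun i => ∑ k ∈ Finset.range J,
      pairSign m (A k) (blk t (chainLevel n L ρ J k + 1) i) •
        pairCoeff m (A k) (Y k) (blk t (chainLevel n L ρ J k + 1) i))) := by
  have key := h.pair_transfer hp hA hG t ρ J Y hY quarterMain (fun x y => -2 * quarterDiff x y)
    (by simp [quarterMain]) (by simp [quarterDiff]) (by norm_num [quarterMain])
    (fun c => by norm_num [quarterMain, quarterDiff]; split_ifs <;> norm_num) 1 (-1 / 2) (c := 1)
    (by simp) (by rw [abs_le]; constructor <;> norm_num)
    (fun i => ∑ k ∈ Finset.range J,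
      pairSign m (A k) (blk t (chainLevel n L ρ J k + 1) i) •
        pairCoeff m (A k) (Y k) (blk t (chainLevel n L ρ J k + 1) i))
    (fun i => ∑ k ∈ Finset.range J,
      if blk t (chainLevel n L ρ J k + 1) i ∈ A k then haarSign t (chainLevel n L ρ J k) i •
        Y k (blk t (chainLevel n L ρ J k + 1) i) else 0) ?_ ?_
  · simpa using key
  · intro i
    refine Finset.sum_congr rfl fun k _ => ?_
    rcases pairSign_cases (m := m) (A := A k) (blk t (chainLevel n L ρ J k + 1) i)
      with h1 | h1 | h1
    · rcases haarSign_eq t (chainLevel n L ρ J k) i with h2 | h2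
      · simp [h1, h2, quarterMain, quarterDiff]
      · simp only [h1.2, h2, quarterMain, quarterDiff]
        norm_num
    · simp only [h1.2.2, quarterMain, quarterDiff]; norm_num
    · simp [h1, quarterMain, quarterDiff]
  · intro i
    refine Finset.sum_congr rfl fun k _ => ?_
    rcases pairSign_cases (m := m) (A := A k) (blk t (chainLevel n L ρ J k + 1) i)
      with h1 | h1 | h1
    · rcases haarSign_eq t (chainLevel n L ρ J k) i with h2 | h2
      · simp [pairCoeff, pairBase, h1, h2, quarterMain, quarterDiff]
      · simp only [h1.2, h1.1, h2, if_true, pairCoeff, pairBase, quarterMain, quarterDiff]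
        norm_num
    · simp only [h1.2.2, h1.1, if_false, quarterMain, quarterDiff]; norm_num
    · simp [pairCoeff, h1]


section Projections

variable {𝕜 : Type*} [RCLike 𝕜] [NormedSpace 𝕜 X] [IsScalarTower ℝ 𝕜 X]

open Classical in
/-- Haar multipliers. -/
lemma IsDiscreteUMDBound.haar_proj (hp : 1 ≤ p) (hp' : p ≠ ∞)
    (h : IsDiscreteUMDBound (Cell n) p X B) (A : ℕ → Set (Cell n)) (t : Cell n) (L ρ J : ℕ)
    (lam : ℕ → Cell n → 𝕜) {c : ℝ≥0} (hlam : ∀ k q, ‖lam k q‖ ≤ c) (f : Cell n → X)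
    (hf : (Function.support f).Finite) :
    ellNorm p (fun i => ∑ k ∈ Finset.range J,
      if blk t (chainLevel n L ρ J k + 1) i ∈ A k then haarSign t (chainLevel n L ρ J k) i •
        lam k (blk t (chainLevel n L ρ J k + 1) i) • haarCoeff f (chainLevel n L ρ J k)
          (gridPos t (chainLevel n L ρ J k + 1) (blk t (chainLevel n L ρ J k + 1) i)) else 0)
    ≤ 4 * c * B * ellNorm p f := by
  have key := h.avg_multiplier hp hp'
    (fun k => if k < J then grid t (chainLevel n L ρ J k + 1) else grid t ρ)
    (fun k => grid t (chainLevel n L ρ J k)) J (fun k hk => ?_) (fun k hk => ?_)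
    (fun k i => if blk t (chainLevel n L ρ J k + 1) i ∈ A k
      then lam k (blk t (chainLevel n L ρ J k + 1) i) else 0) (c := c) ?_ ?_ f hf
  · refine le_trans (le_of_eq (congrArg _ (funext fun i => ?_))) key
    refine Finset.sum_congr rfl fun k hk => ?_
    rw [if_pos (Finset.mem_range.1 hk), grid_avg_sub]
    split_ifs
    · rw [smul_comm]
    · simp
  · simp only [hk, if_true]
    exact grid_finer t (Nat.le_succ _)
  · by_cases h1 : k + 1 < J
    · simp only [h1, if_true]
      exact grid_finer t (by rw [chainLevel_succ h1]; omega)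
    · simp only [h1, if_false, chainLevel_last (not_lt.1 h1)]
      exact fun i => subset_rfl
  · intro k hk i j hj
    simp only [hk, if_true] at hj
    simp only [mem_grid.1 hj]
  · intro k i
    split_ifs
    · exact hlam _ _
    · simp

omit [NeZero n] in
lemma avg_congr {P Q : FinPart (Cell n)} {i : Cell n} (h : P.cls i = Q.cls i) (f : Cell n → X) :
    P.avg f i = Q.avg f i := by
  simp only [FinPart.avg, h]

omit [NeZero n] in
lemma pairPart_avg (t : Cell n) (s : ℕ) {π : Cell n → Cell n} (hπ : Function.Involutive π)
    (f : Cell n → X) {i : Cell n} (hi : π (blk t s i) ≠ blk t s i) :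
    (pairPart t s π hπ).avg f i = (1 / 2 : ℝ) • (rectAvg f s (gridPos t s (blk t s i))
      + rectAvg f s (gridPos t s (π (blk t s i)))) := by
  have hd : Disjoint (rect s (gridPos t s (blk t s i))) (rect s (gridPos t s (π (blk t s i)))) := by
    rw [Finset.disjoint_left]
    intro j h1 h2
    exact hi ((mem_rect_gridPos.1 h2).symm.trans (mem_rect_gridPos.1 h1))
  simp only [FinPart.avg, pairPart, Finset.card_union_of_disjoint hd, Finset.sum_union hd,
    card_rect, rectAvg, ← smul_add, smul_smul]
  congr 1
  have := rectCard_ne_zero n s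
  push_cast
  field_simp
  norm_num

open Classical in
/-- Multipliers for differences of averages over pairs of rectangles. -/
lemma IsDiscreteUMDBound.diff_proj (hp : 1 ≤ p) (hp' : p ≠ ∞)
    (h : IsDiscreteUMDBound (Cell n) p X B) (hA : ∀ k, IsPairing m (A k))
    (hG : ∀ k, IsGood m L (A k)) (t : Cell n) (ρ J : ℕ)
    (lam : ℕ → Cell n → 𝕜) {c : ℝ≥0} (hlam : ∀ k q, ‖lam k q‖ ≤ c) (f : Cell n → X)
    (hf : (Function.support f).Finite) :
    ellNorm p (fun i => ∑ k ∈ Finset.range J,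
      pairSign m (A k) (blk t (chainLevel n L ρ J k + 1) i) •
        pairCoeff m (A k) (fun q => lam k q •
          (rectAvg f (chainLevel n L ρ J k + 1) (gridPos t (chainLevel n L ρ J k + 1) q)
          - rectAvg f (chainLevel n L ρ J k + 1) (gridPos t (chainLevel n L ρ J k + 1) (q + m))))
          (blk t (chainLevel n L ρ J k + 1) i))
    ≤ 8 * c * B * ellNorm p f := by
  -- the average over one rectangle differs from the average over the pair by half the difference,
  -- whence the factor `2` in the multiplier
  have key := h.avg_multiplier hp hp' (pairChain t m A hA L ρ J)
    (fun k => (pairPart t (chainLevel n L ρ J k + 1) (partner m (A k)) (hA k).involutive).split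
      fun i => pairSign m (A k) (blk t (chainLevel n L ρ J k + 1) i)) J
    (fun k hk => ?_) (fun k hk => ?_)
    (fun k i => 2 * lam k (pairBase m (A k) (blk t (chainLevel n L ρ J k + 1) i))
      * (if pairSign m (A k) (blk t (chainLevel n L ρ J k + 1) i) = 0 then 0 else 1))
    (c := 2 * c) ?_ ?_ f hf
  · refine le_trans (le_of_eq (congrArg _ (funext fun i => ?_))) (key.trans (le_of_eq ?_))
    · refine Finset.sum_congr rfl fun k hk => ?_
      rw [pairChain_of_lt (Finset.mem_range.1 hk)]
      set s := chainLevel n L ρ J k + 1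
      set q := blk t s i with hq
      have hHavg : ∀ q', partner m (A k) q = q' → pairSign m (A k) q' ≠ pairSign m (A k) q →
          ((pairPart t s (partner m (A k)) (hA k).involutive).split
            fun i => pairSign m (A k) (blk t s i)).avg f i = rectAvg f s (gridPos t s q) := by
        intro q' hqq hne
        rw [← grid_avg]
        refine avg_congr ?_ f
        ext j
        rw [FinPart.mem_split, mem_pairPart, mem_grid, ← hq, hqq]
        constructor
        · rintro ⟨hj | hj, h2⟩
          · exact hj
          · rw [hj] at h2; exact absurd h2 hne
        · intro hj
          exact ⟨Or.inl hj, by rw [hj]⟩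
      have hm := (hA k).ne_zero
      rcases pairSign_cases (m := m) (A := A k) q with h1 | h1 | h1
      · have e : partner m (A k) q = q + m := by simp [partner, h1.1]
        have e2 : pairSign m (A k) (q + m) = -1 := by
          simp [pairSign, (hA k).disj _ h1.1, h1.1]
        rw [hHavg (q + m) e (by rw [e2, h1.2]; norm_num),
          pairPart_avg _ _ _ _ (by rw [← hq, e]; simpa using hm), ← hq, e]
        simp only [pairCoeff, pairBase, h1.1, h1.2, if_true]
        rw [if_neg one_ne_zero, if_neg one_ne_zero, mul_one, one_smul, mul_comm, mul_smul]
        congr 1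
        rw [two_smul]
        module
      · have e : partner m (A k) q = q - m := by simp [partner, h1.1, h1.2.1]
        have e2 : pairSign m (A k) (q - m) = 1 := by simp [pairSign, h1.2.1]
        rw [hHavg (q - m) e (by rw [e2, h1.2.2]; norm_num),
          pairPart_avg _ _ _ _ (by rw [← hq, e]; simpa using hm), ← hq, e]
        simp only [pairCoeff, pairBase, h1.1, h1.2.2, if_false]
        rw [if_neg (by norm_num), if_neg (by norm_num), mul_one, mul_comm, mul_smul, smul_comm,
          sub_add_cancel]
        congr 1
        rw [two_smul]
        module
      · simp [h1, pairCoeff]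
    · push_cast; ring
  · rw [pairChain_of_lt hk]
    exact FinPart.split_finer _ _
  · refine FinPart.Finer.split ?_ ?_
    · rw [← pairChain_of_lt (ρ := ρ) (J := J) (L := L) (hA := hA) hk]
      exact pairChain_succ_finer hG hk
    · refine FinPart.Inv.mono (pairChain_succ_finer_grid hG hk) fun i j hj => ?_
      have h2 := mem_grid.1 (grid_finer t (Nat.le_succ _) i hj)
      simp only [Nat.succ_eq_add_one] at h2 ⊢
      rw [h2]
  · intro k hk i j hj
    rw [pairChain_of_lt hk, mem_pairPart] at hj
    rcases hj with hj | hj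
    · simp only [hj]
    · have hπ := hA k
      rcases pairSign_cases (m := m) (A := A k) (blk t (chainLevel n L ρ J k + 1) i)
        with h1 | h1 | h1
      · have e : partner m (A k) (blk t (chainLevel n L ρ J k + 1) i)
          = blk t (chainLevel n L ρ J k + 1) i + m := by simp [partner, h1.1]
        simp [hj, e, pairBase, pairSign, h1.1, hπ.disj _ h1.1]
      · have e : partner m (A k) (blk t (chainLevel n L ρ J k + 1) i)
          = blk t (chainLevel n L ρ J k + 1) i - m := by simp [partner, h1.1, h1.2.1]
        simp [hj, e, pairBase, pairSign, h1.1, h1.2.1]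
      · have e : partner m (A k) (blk t (chainLevel n L ρ J k + 1) i)
          = blk t (chainLevel n L ρ J k + 1) i := by simp [partner, h1.1, h1.2.1]
        simp [hj, e]
  · intro k i
    rw [norm_mul, norm_mul, RCLike.norm_ofNat]
    push_cast
    have := hlam k (pairBase m (A k) (blk t (chainLevel n L ρ J k + 1) i))
    split_ifs
    · simp
    · rw [norm_one, mul_one]; gcongr

end Projections

end Chains

section OperatorBounds

variable {n : ℕ} {m : Cell n}

/-! ### Sums over all levels -/

lemma sum_range_residue {M : Type*} [AddCommMonoid M] (g : ℕ → M) (R P : ℕ) (hP : 0 < P)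
    (hg : ∀ s, R ≤ s → g s = 0) :
    ∑ s ∈ Finset.range R, g s
      = ∑ ρ ∈ Finset.range P, ∑ k ∈ Finset.range R, g (ρ + P * (R - 1 - k)) := by
  have h1 : ∀ J, ∑ s ∈ Finset.range (P * J), g s
      = ∑ k ∈ Finset.range J, ∑ ρ ∈ Finset.range P, g (ρ + P * k) := by
    intro J
    induction J with
    | zero => simp
    | succ J ih =>
      rw [mul_add, mul_one, Finset.sum_range_add, ih, Finset.sum_range_succ]
      simp only [add_comm]
  have h2 : ∑ s ∈ Finset.range R, g s = ∑ s ∈ Finset.range (P * R), g s := by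
    refine Finset.sum_subset ?_ fun s _ hs => hg s (by simpa using hs)
    exact Finset.range_mono (Nat.le_mul_of_pos_left R hP)
  rw [h2, h1, Finset.sum_comm]
  refine Finset.sum_congr rfl fun ρ _ => ?_
  exact (Finset.sum_range_reflect (fun k => g (ρ + P * k)) R).symm

variable {X : Type*} [NormedAddCommGroup X] {p B : ℝ≥0∞}

/-- A sum over all levels is divided into the residue classes modulo `n * L + 1`. Within a class,
consecutive levels are so far apart that the pairs of good rectangles are nested. -/
lemma ellNorm_sum_range_le (hp : 1 ≤ p) (g : ℕ → Cell n → X) (L R : ℕ)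
    (hg : ∀ s, R ≤ s → g s = 0) {K : ℝ≥0∞}
    (hK : ∀ ρ, ellNorm p (fun i => ∑ k ∈ Finset.range R, g (chainLevel n L ρ R k) i) ≤ K) :
    ellNorm p (fun i => ∑ s ∈ Finset.range R, g s i) ≤ (n * L + 1 : ℕ) * K := by
  have e : (fun i => ∑ s ∈ Finset.range R, g s i) = fun i => ∑ ρ ∈ Finset.range (n * L + 1),
      ∑ k ∈ Finset.range R, g (chainLevel n L ρ R k) i := by
    ext i
    exact sum_range_residue (fun s => g s i) R (n * L + 1) (Nat.succ_pos _)
      fun s hs => by rw [hg s hs]; rfl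
  rw [e]
  refine (ellNorm_sum_le hp _ _).trans ((Finset.sum_le_sum fun ρ _ => hK ρ).trans ?_)
  simp

/-- Two colours suffice to make pairs disjoint. -/
lemma exists_pairing_split (hm : m ≠ 0) (G : Set (Cell n)) :
    ∃ A₁ A₂ : Set (Cell n), IsPairing m A₁ ∧ IsPairing m A₂ ∧ Disjoint A₁ A₂ ∧ A₁ ∪ A₂ = G := by
  obtain ⟨c, hc⟩ := Function.ne_iff.1 hm
  have hc' : m c ≠ 0 := hc
  have h : ∀ q : Cell n, (q + m) c / m c = q c / m c + 1 := fun q => by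
    rw [Pi.add_apply, Int.add_ediv_of_dvd_right (dvd_refl _), Int.ediv_self hc']
  refine ⟨G ∩ {q | Even (q c / m c)}, G ∩ {q | ¬ Even (q c / m c)}, ⟨hm, ?_⟩, ⟨hm, ?_⟩, ?_, ?_⟩
  · rintro q ⟨-, hq⟩ ⟨-, hq'⟩
    rw [Set.mem_ofPred_eq, h] at hq'
    exact (Int.even_add_one.1 hq') hq
  · rintro q ⟨-, hq⟩ ⟨-, hq'⟩
    rw [Set.mem_ofPred_eq, h] at hq'
    exact hq' (Int.even_add_one.2 hq)
  · rw [Set.disjoint_left]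
    rintro q ⟨-, hq⟩ ⟨-, hq'⟩
    exact hq' hq
  · ext q
    simp only [Set.mem_union, Set.mem_inter_iff, Set.mem_ofPred_eq]
    tauto

variable [NeZero n] [NormedSpace ℝ X]

lemma haarCoeff_ne_zero {f : Cell n → X} {t : Cell n} {s : ℕ} {q : Cell n}
    (h : haarCoeff f s (gridPos t (s + 1) q) ≠ 0) :
    q ∈ blk t (s + 1) '' Function.support f := by
  by_contra hq
  have h0 : ∀ j ∈ rect (s + 1) (gridPos t (s + 1) q), f j = 0 := by
    intro j hj
    by_contra hj'
    exact hq ⟨j, hj', mem_rect_gridPos.1 hj⟩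
  refine h ?_
  rw [haarCoeff, rectAvg, rectAvg,
    Finset.sum_eq_zero fun j hj => h0 j (mem_rect_succ.2 (Or.inl hj)),
    Finset.sum_eq_zero fun j hj => h0 j (mem_rect_succ.2 (Or.inr hj))]
  simp

omit [NeZero n] in
lemma rectAvg_ne_zero {f : Cell n → X} {t : Cell n} {s : ℕ} {q : Cell n}
    (h : rectAvg f s (gridPos t s q) ≠ 0) : q ∈ blk t s '' Function.support f := by
  by_contra hq
  refine h ?_
  rw [rectAvg, Finset.sum_eq_zero, smul_zero]
  intro j hj
  by_contra hj'
  exact hq ⟨j, hj', mem_rect_gridPos.1 hj⟩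

variable {𝕜 : Type*} [RCLike 𝕜] [NormedSpace 𝕜 X] [IsScalarTower ℝ 𝕜 X]

section

variable (hp : 1 ≤ p) (hp' : p ≠ ∞) (h : IsDiscreteUMDBound (Cell n) p X B) (hm : m ≠ 0) {L : ℕ}
  {G : Set (Cell n)} (hG : IsGood m L G) (t : Cell n) (R : ℕ) (lam : ℕ → Cell n → 𝕜) {c : ℝ≥0}
  (hlam : ∀ s q, ‖lam s q‖ ≤ c) (f : Cell n → X) (hf : (Function.support f).Finite)

include hp hp' h hm hG hlam hf

open Classical in
/-- The operators that map the Haar function of each rectangle to a bounded multiple of the one of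
its translate by `m`. -/
lemma ellNorm_haar_shift_le :
    ellNorm p (fun i => ∑ s ∈ Finset.range R, if blk t (s + 1) i - m ∈ G then
      haarSign t s i • lam s (blk t (s + 1) i - m) •
        haarCoeff f s (gridPos t (s + 1) (blk t (s + 1) i - m)) else 0)
    ≤ 32 * (n * L + 1 : ℕ) * c * B ^ 2 * ellNorm p f := by
  have single : ∀ A ⊆ G, IsPairing m A →
      ellNorm p (fun i => ∑ s ∈ Finset.range R, if blk t (s + 1) i - m ∈ A then
        haarSign t s i • lam s (blk t (s + 1) i - m) •
          haarCoeff f s (gridPos t (s + 1) (blk t (s + 1) i - m)) else 0)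
      ≤ (n * L + 1 : ℕ) * (8 * c * B ^ 2 * ellNorm p f) := by
    intro A hAG hA
    -- levels from `R` on are cut off, since the residue classes run past `R`
    let lam' : ℕ → Cell n → 𝕜 := fun s q => if s < R then lam s q else 0
    have hlam' : ∀ s q, ‖lam' s q‖ ≤ c := fun s q => by
      simp only [lam']; split_ifs
      · exact hlam s q
      · simp
    have key := ellNorm_sum_range_le hp (fun s i => if blk t (s + 1) i - m ∈ A then
        haarSign t s i • lam' s (blk t (s + 1) i - m) •
          haarCoeff f s (gridPos t (s + 1) (blk t (s + 1) i - m)) else 0) L R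
      (fun s hs => by ext i; simp [lam', not_lt.2 hs]) (K := 8 * c * B ^ 2 * ellNorm p f)
      fun ρ => ?_
    · refine le_trans (le_of_eq (congrArg _ (funext fun i => ?_))) key
      exact Finset.sum_congr rfl fun s hs => by simp [lam', Finset.mem_range.1 hs]
    · have h1 := h.haar_move hp (fun _ => hA) (fun _ q hq => hG q (hAG hq)) t ρ R
        (fun k q => lam' (chainLevel n L ρ R k) q • haarCoeff f (chainLevel n L ρ R k)
          (gridPos t (chainLevel n L ρ R k + 1) q))
        fun k => (hf.image (blk t (chainLevel n L ρ R k + 1))).subset fun q hq =>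
          haarCoeff_ne_zero (right_ne_zero_of_smul hq)
      have h2 := h.haar_proj hp hp' (fun _ => A) t L ρ R
        (fun k q => lam' (chainLevel n L ρ R k) q) (fun k q => hlam' _ q) f hf
      refine (h1.trans (mul_le_mul_right (mul_le_mul_right h2 B) 2)).trans (le_of_eq ?_)
      ring
  obtain ⟨A₁, A₂, hA₁, hA₂, hd, hu⟩ := exists_pairing_split hm G
  have e := ellNorm_add_le hp (fun i => ∑ s ∈ Finset.range R, if blk t (s + 1) i - m ∈ A₁ then
        haarSign t s i • lam s (blk t (s + 1) i - m) •
          haarCoeff f s (gridPos t (s + 1) (blk t (s + 1) i - m)) else 0)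
    (fun i => ∑ s ∈ Finset.range R, if blk t (s + 1) i - m ∈ A₂ then
        haarSign t s i • lam s (blk t (s + 1) i - m) •
          haarCoeff f s (gridPos t (s + 1) (blk t (s + 1) i - m)) else 0)
  refine le_trans (le_of_eq (congrArg _ (funext fun i => ?_))) (e.trans ((add_le_add
    (single A₁ (hu ▸ Set.subset_union_left) hA₁)
    (single A₂ (hu ▸ Set.subset_union_right) hA₂)).trans ?_))
  · rw [← Finset.sum_add_distrib]
    refine Finset.sum_congr rfl fun s _ => ?_
    rw [← hu]
    by_cases h1 : blk t (s + 1) i - m ∈ A₁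
    · simp [h1, Set.disjoint_left.1 hd h1]
    · simp [h1]
  · rw [← two_mul]
    calc _ = 16 * (n * L + 1 : ℕ) * c * B ^ 2 * ellNorm p f := by ring
      _ ≤ _ := by gcongr; norm_num

open Classical in
/-- The operators that map the Haar function of each rectangle to a bounded multiple of the
difference of the indicators of the rectangle and its translate by `m`. -/
lemma ellNorm_haar_diff_le :
    ellNorm p (fun i => ∑ s ∈ Finset.range R,
      ((if blk t (s + 1) i ∈ G then lam s (blk t (s + 1) i) •
        haarCoeff f s (gridPos t (s + 1) (blk t (s + 1) i)) else 0)
      - if blk t (s + 1) i - m ∈ G then lam s (blk t (s + 1) i - m) •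
        haarCoeff f s (gridPos t (s + 1) (blk t (s + 1) i - m)) else 0))
    ≤ 32 * (n * L + 1 : ℕ) * c * B ^ 2 * ellNorm p f := by
  have single : ∀ A ⊆ G, IsPairing m A →
      ellNorm p (fun i => ∑ s ∈ Finset.range R,
        ((if blk t (s + 1) i ∈ A then lam s (blk t (s + 1) i) •
          haarCoeff f s (gridPos t (s + 1) (blk t (s + 1) i)) else 0)
        - if blk t (s + 1) i - m ∈ A then lam s (blk t (s + 1) i - m) •
          haarCoeff f s (gridPos t (s + 1) (blk t (s + 1) i - m)) else 0))
      ≤ (n * L + 1 : ℕ) * (16 * c * B ^ 2 * ellNorm p f) := by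
    intro A hAG hA
    let lam' : ℕ → Cell n → 𝕜 := fun s q => if s < R then lam s q else 0
    have hlam' : ∀ s q, ‖lam' s q‖ ≤ c := fun s q => by
      simp only [lam']; split_ifs
      · exact hlam s q
      · simp
    have key := ellNorm_sum_range_le hp (fun s i =>
        ((if blk t (s + 1) i ∈ A then lam' s (blk t (s + 1) i) •
          haarCoeff f s (gridPos t (s + 1) (blk t (s + 1) i)) else 0)
        - if blk t (s + 1) i - m ∈ A then lam' s (blk t (s + 1) i - m) •
          haarCoeff f s (gridPos t (s + 1) (blk t (s + 1) i - m)) else 0)) L R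
      (fun s hs => by ext i; simp [lam', not_lt.2 hs]) (K := 16 * c * B ^ 2 * ellNorm p f)
      fun ρ => ?_
    · refine le_trans (le_of_eq (congrArg _ (funext fun i => ?_))) key
      exact Finset.sum_congr rfl fun s hs => by simp [lam', Finset.mem_range.1 hs]
    · have h1 := h.haar_to_diff hp (fun _ => hA) (fun _ q hq => hG q (hAG hq)) t ρ R
        (fun k q => lam' (chainLevel n L ρ R k) q • haarCoeff f (chainLevel n L ρ R k)
          (gridPos t (chainLevel n L ρ R k + 1) q))
        fun k => (hf.image (blk t (chainLevel n L ρ R k + 1))).subset fun q hq =>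
          haarCoeff_ne_zero (right_ne_zero_of_smul hq)
      have h2 := h.haar_proj hp hp' (fun _ => A) t L ρ R
        (fun k q => lam' (chainLevel n L ρ R k) q) (fun k q => hlam' _ q) f hf
      refine le_trans (le_of_eq (congrArg _ (funext fun i => ?_)))
        ((h1.trans (mul_le_mul_right (mul_le_mul_right h2 B) 4)).trans (le_of_eq (by ring)))
      refine Finset.sum_congr rfl fun k _ => ?_
      rcases pairSign_cases (m := m) (A := A) (blk t (chainLevel n L ρ R k + 1) i) with h1 | h1 | h1
      · simp [h1, pairCoeff, pairBase, hA.sub_not_mem h1.1]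
      · simp [h1, pairCoeff, pairBase]
      · simp [h1]
  obtain ⟨A₁, A₂, hA₁, hA₂, hd, hu⟩ := exists_pairing_split hm G
  have e := ellNorm_add_le hp (fun i => ∑ s ∈ Finset.range R,
        ((if blk t (s + 1) i ∈ A₁ then lam s (blk t (s + 1) i) •
          haarCoeff f s (gridPos t (s + 1) (blk t (s + 1) i)) else 0)
        - if blk t (s + 1) i - m ∈ A₁ then lam s (blk t (s + 1) i - m) •
          haarCoeff f s (gridPos t (s + 1) (blk t (s + 1) i - m)) else 0))
    (fun i => ∑ s ∈ Finset.range R,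
        ((if blk t (s + 1) i ∈ A₂ then lam s (blk t (s + 1) i) •
          haarCoeff f s (gridPos t (s + 1) (blk t (s + 1) i)) else 0)
        - if blk t (s + 1) i - m ∈ A₂ then lam s (blk t (s + 1) i - m) •
          haarCoeff f s (gridPos t (s + 1) (blk t (s + 1) i - m)) else 0))
  refine le_trans (le_of_eq (congrArg _ (funext fun i => ?_))) (e.trans ((add_le_add
    (single A₁ (hu ▸ Set.subset_union_left) hA₁)
    (single A₂ (hu ▸ Set.subset_union_right) hA₂)).trans ?_))
  · rw [← Finset.sum_add_distrib]
    refine Finset.sum_congr rfl fun s _ => ?_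
    rw [← hu, sub_add_sub_comm]
    congr 1
    · by_cases h1 : blk t (s + 1) i ∈ A₁
      · simp [h1, Set.disjoint_left.1 hd h1]
      · simp [h1]
    · by_cases h1 : blk t (s + 1) i - m ∈ A₁
      · simp [h1, Set.disjoint_left.1 hd h1]
      · simp [h1]
  · rw [← two_mul]
    exact le_of_eq (by ring)

open Classical in
/-- The operators that map the difference of the indicators of each rectangle and its translate by
`m` to a bounded multiple of the Haar function. -/
lemma ellNorm_diff_haar_le :
    ellNorm p (fun i => ∑ s ∈ Finset.range R, if blk t (s + 1) i ∈ G then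
      haarSign t s i • lam s (blk t (s + 1) i) •
        (rectAvg f (s + 1) (gridPos t (s + 1) (blk t (s + 1) i))
        - rectAvg f (s + 1) (gridPos t (s + 1) (blk t (s + 1) i + m))) else 0)
    ≤ 32 * (n * L + 1 : ℕ) * c * B ^ 2 * ellNorm p f := by
  have single : ∀ A ⊆ G, IsPairing m A →
      ellNorm p (fun i => ∑ s ∈ Finset.range R, if blk t (s + 1) i ∈ A then
        haarSign t s i • lam s (blk t (s + 1) i) •
          (rectAvg f (s + 1) (gridPos t (s + 1) (blk t (s + 1) i))
          - rectAvg f (s + 1) (gridPos t (s + 1) (blk t (s + 1) i + m))) else 0)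
      ≤ (n * L + 1 : ℕ) * (16 * c * B ^ 2 * ellNorm p f) := by
    intro A hAG hA
    let lam' : ℕ → Cell n → 𝕜 := fun s q => if s < R then lam s q else 0
    have hlam' : ∀ s q, ‖lam' s q‖ ≤ c := fun s q => by
      simp only [lam']; split_ifs
      · exact hlam s q
      · simp
    have key := ellNorm_sum_range_le hp (fun s i => if blk t (s + 1) i ∈ A then
        haarSign t s i • lam' s (blk t (s + 1) i) •
          (rectAvg f (s + 1) (gridPos t (s + 1) (blk t (s + 1) i))
          - rectAvg f (s + 1) (gridPos t (s + 1) (blk t (s + 1) i + m))) else 0) L R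
      (fun s hs => by ext i; simp [lam', not_lt.2 hs]) (K := 16 * c * B ^ 2 * ellNorm p f)
      fun ρ => ?_
    · refine le_trans (le_of_eq (congrArg _ (funext fun i => ?_))) key
      exact Finset.sum_congr rfl fun s hs => by simp [lam', Finset.mem_range.1 hs]
    · have h1 := h.diff_to_haar hp (fun _ => hA) (fun _ q hq => hG q (hAG hq)) t ρ R
        (fun k q => lam' (chainLevel n L ρ R k) q •
          (rectAvg f (chainLevel n L ρ R k + 1) (gridPos t (chainLevel n L ρ R k + 1) q)
          - rectAvg f (chainLevel n L ρ R k + 1) (gridPos t (chainLevel n L ρ R k + 1) (q + m))))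
        fun k => ?_
      · have h2 := h.diff_proj hp hp' (fun _ => hA) (fun _ q hq => hG q (hAG hq)) t ρ R
          (fun k q => lam' (chainLevel n L ρ R k) q) (fun k q => hlam' _ q) f hf
        exact (h1.trans (mul_le_mul_right (mul_le_mul_right h2 B) 2)).trans (le_of_eq (by ring))
      · refine ((hf.image (blk t (chainLevel n L ρ R k + 1))).union
          ((hf.image (blk t (chainLevel n L ρ R k + 1))).image fun q => q - m)).subset fun q hq => ?_
        by_contra hq'
        rw [Set.mem_union, not_or] at hq'
        refine right_ne_zero_of_smul hq ?_
        have e1 : rectAvg f (chainLevel n L ρ R k + 1)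
            (gridPos t (chainLevel n L ρ R k + 1) q) = 0 := by
          by_contra h0; exact hq'.1 (rectAvg_ne_zero h0)
        have e2 : rectAvg f (chainLevel n L ρ R k + 1)
            (gridPos t (chainLevel n L ρ R k + 1) (q + m)) = 0 := by
          by_contra h0; exact hq'.2 ⟨q + m, rectAvg_ne_zero h0, by simp⟩
        rw [e1, e2, sub_zero]
  obtain ⟨A₁, A₂, hA₁, hA₂, hd, hu⟩ := exists_pairing_split hm G
  have e := ellNorm_add_le hp (fun i => ∑ s ∈ Finset.range R, if blk t (s + 1) i ∈ A₁ then
        haarSign t s i • lam s (blk t (s + 1) i) •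
          (rectAvg f (s + 1) (gridPos t (s + 1) (blk t (s + 1) i))
          - rectAvg f (s + 1) (gridPos t (s + 1) (blk t (s + 1) i + m))) else 0)
    (fun i => ∑ s ∈ Finset.range R, if blk t (s + 1) i ∈ A₂ then
        haarSign t s i • lam s (blk t (s + 1) i) •
          (rectAvg f (s + 1) (gridPos t (s + 1) (blk t (s + 1) i))
          - rectAvg f (s + 1) (gridPos t (s + 1) (blk t (s + 1) i + m))) else 0)
  refine le_trans (le_of_eq (congrArg _ (funext fun i => ?_))) (e.trans ((add_le_add
    (single A₁ (hu ▸ Set.subset_union_left) hA₁)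
    (single A₂ (hu ▸ Set.subset_union_right) hA₂)).trans ?_))
  · rw [← Finset.sum_add_distrib]
    refine Finset.sum_congr rfl fun s _ => ?_
    rw [← hu]
    by_cases h1 : blk t (s + 1) i ∈ A₁
    · simp [h1, Set.disjoint_left.1 hd h1]
    · simp [h1]
  · rw [← two_mul]
    exact le_of_eq (by ring)

end

/-- The unconditionality constant is at least `1`, unless `X = 0`. -/
lemma IsDiscreteUMDBound.mul_ellNorm_le (h : IsDiscreteUMDBound (Cell n) p X B) (hp : 1 ≤ p)
    (f : Cell n → X) : B * ellNorm p f ≤ B ^ 2 * ellNorm p f := by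
  rcases subsingleton_or_nontrivial X with hX | hX
  · have : f = fun _ => 0 := funext fun i => Subsingleton.elim _ _
    rw [this, ellNorm_zero]; simp
  suffices hB : 1 ≤ B by
    gcongr
    exact le_self_pow₀ hB two_ne_zero
  obtain ⟨x, hx⟩ := exists_ne (0 : X)
  -- the inequality for one nonzero martingale difference, with the sign `1`
  let g : Cell n → X := Pi.single 0 x
  have hg : (Function.support g).Finite := (Set.finite_singleton 0).subset fun i hi => by
    by_contra h0
    exact hi (by simp only [g]; rw [Pi.single_apply]; exact if_neg h0)
  let d : Cell n → X := fun i => (grid (0 : Cell n) 0).avg g i - (grid 0 1).avg g i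
  have hdf : (Function.support d).Finite :=
    (((grid 0 0).finite_support_avg hg).union ((grid 0 1).finite_support_avg hg)).subset
      (Function.support_sub _ _)
  have key := h (fun k => grid 0 (1 - k)) (fun _ => d) (fun _ => 1) 1
    (fun k _ => grid_finer _ (by omega))
    (fun k hk i j hj => by
      have hj' : j ∈ (grid (0 : Cell n) 0).cls i := by simpa using hj
      simp only [d]
      rw [(grid 0 0).inv_avg g i j hj', (grid 0 1).inv_avg g i j (grid_finer _ zero_le_one _ hj')])
    (fun _ _ => hdf)
    (fun k hk i => by
      obtain rfl : k = 0 := by omega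
      exact FinPart.sum_avg_sub_avg (grid_finer 0 zero_le_one) g i) (fun _ => Or.inl rfl)
  simp only [Finset.sum_range_one, one_smul] at key
  have h0 : ellNorm p (fun i => d i) ≠ 0 := by
    intro h0
    let _ : MeasurableSpace (Cell n) := ⊤
    have hd0 : ∀ i, d i = 0 := by
      have := (eLpNorm_eq_zero_iff StronglyMeasurable.of_discrete.aestronglyMeasurable
        (zero_lt_one.trans_le hp).ne').1 h0
      intro i
      have := (Measure.ae_count_iff.1 this) i
      simpa using this
    have hne : (rect 0 (0 : Cell n)).card = 1 := by rw [card_rect, rectCard_eq]; rfl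
    have hd1 := hd0 0
    simp only [d] at hd1
    rw [grid_avg_sub] at hd1
    have hb : gridPos 0 (0 + 1) (blk 0 (0 + 1) (0 : Cell n)) = 0 := by
      ext c; simp [gridPos, blk]
    have hs : haarSign 0 0 (0 : Cell n) = 1 := by simp [haarSign, blk]
    obtain ⟨y, hy⟩ := Finset.card_eq_one.1 hne
    have hy0 : y = 0 := by
      have := self_mem_rect 0 (0 : Cell n)
      rw [hy] at this
      exact (Finset.mem_singleton.1 this).symm
    have hsum2 : ∑ j ∈ rect 0 ((0 : Cell n) + halfShift 0), g j = 0 := by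
      refine Finset.sum_eq_zero fun j hj => ?_
      simp only [g]
      rw [Pi.single_apply, if_neg]
      rintro rfl
      exact Finset.disjoint_left.1 (disjoint_rect_halfShift 0 (0 : Cell n)) (self_mem_rect _ _) hj
    rw [hs, one_smul, hb, haarCoeff, rectAvg, rectAvg, hsum2, hy, hy0] at hd1
    simp [rectCard_eq, g] at hd1
    exact hx hd1
  have h1 : 1 * ellNorm p (fun i => d i) ≤ B * ellNorm p (fun i => d i) := by simpa using key
  exact (ENNReal.mul_le_mul_iff_left h0 (ellNorm_ne_top hdf)).1 h1

end OperatorBounds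

/-! ### Averaging over grids -/

section Averaging

variable {n : ℕ}

/-- Indices in the middle of the blocks of side `2 ^ (l + 2)`. -/
def goodSet (n l : ℕ) : Set (Cell n) :=
  {q | ∀ c, 2 ^ l ≤ q c % 2 ^ (l + 2) ∧ q c % 2 ^ (l + 2) < 3 * 2 ^ l}

lemma isGood_goodSet {m : Cell n} {l : ℕ} (hm : ∀ c, |m c| ≤ 2 ^ l) :
    IsGood m (l + 2) (goodSet n l) := by
  intro q hq c
  have h1 := hq c
  have h2 := abs_le.1 (hm c)
  have h3 : (2 : ℤ) ^ (l + 2) = 4 * 2 ^ l := by ring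
  have h4 := Int.emod_add_mul_ediv (q c) (2 ^ (l + 2))
  have hpos : (0 : ℤ) < 2 ^ (l + 2) := by positivity
  symm
  rw [Int.ediv_eq_iff_of_pos hpos]
  constructor <;> nlinarith

/-- Exactly one of the translates of `q` by `2 ^ (l + 1) {0, 1}ⁿ` is good. -/
lemma sum_goodSet (l : ℕ) (q : Cell n) [DecidablePred (· ∈ goodSet n l)] :
    ∑ v : Fin n → Fin 2, (if (fun c => q c + (v c : ℤ) * 2 ^ (l + 1)) ∈ goodSet n l
      then (1 : ℝ) else 0) = 1 := by
  classical
  have h1 : ∀ x : ℤ, (if 2 ^ l ≤ x % 2 ^ (l + 2) ∧ x % 2 ^ (l + 2) < 3 * 2 ^ l then (1 : ℝ) else 0)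
      + (if 2 ^ l ≤ (x + 2 ^ (l + 1)) % 2 ^ (l + 2) ∧ (x + 2 ^ (l + 1)) % 2 ^ (l + 2) < 3 * 2 ^ l
        then 1 else 0) = 1 := by
    intro x
    have hK : (0 : ℤ) < 2 ^ l := by positivity
    have e1 : (2 : ℤ) ^ (l + 2) = 4 * 2 ^ l := by ring
    have e2 : (2 : ℤ) ^ (l + 1) = 2 * 2 ^ l := by ring
    rw [e1, e2]
    generalize (2 : ℤ) ^ l = K at hK
    have hr := Int.emod_nonneg x (by omega : 4 * K ≠ 0)
    have hr' := Int.emod_lt_of_pos x (by omega : 0 < 4 * K)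
    rw [← Int.emod_add_emod]
    generalize x % (4 * K) = r at hr hr'
    have h3 : (r + 2 * K) % (4 * K) = if r < 2 * K then r + 2 * K else r - 2 * K := by
      split_ifs with h
      · exact Int.emod_eq_of_lt (by omega) (by omega)
      · rw [show r + 2 * K = r - 2 * K + 4 * K by ring, Int.add_emod_right]
        exact Int.emod_eq_of_lt (by omega) (by omega)
    rw [h3]
    split_ifs <;> first | (exfalso; omega) | norm_num
  have h2 := Finset.prod_univ_sum (fun _ : Fin n => (Finset.univ : Finset (Fin 2)))
    (fun c b => if 2 ^ l ≤ (q c + (b : ℤ) * 2 ^ (l + 1)) % 2 ^ (l + 2) ∧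
      (q c + (b : ℤ) * 2 ^ (l + 1)) % 2 ^ (l + 2) < 3 * 2 ^ l then (1 : ℝ) else 0)
  rw [Fintype.piFinset_univ] at h2
  have h3 : ∏ c : Fin n, ∑ b : Fin 2, (if 2 ^ l ≤ (q c + (b : ℤ) * 2 ^ (l + 1)) % 2 ^ (l + 2) ∧
      (q c + (b : ℤ) * 2 ^ (l + 1)) % 2 ^ (l + 2) < 3 * 2 ^ l then (1 : ℝ) else 0) = 1 := by
    refine Finset.prod_eq_one fun c _ => ?_
    rw [Fin.sum_univ_two]
    simpa using h1 (q c)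
  refine Eq.trans (Finset.sum_congr rfl fun v _ => ?_) (h2.symm.trans h3)
  rw [Finset.prod_ite_zero, Finset.prod_const_one]
  by_cases hv : ∀ c, 2 ^ l ≤ (q c + (v c : ℤ) * 2 ^ (l + 1)) % 2 ^ (l + 2) ∧
      (q c + (v c : ℤ) * 2 ^ (l + 1)) % 2 ^ (l + 2) < 3 * 2 ^ l
  · rw [if_pos (show _ ∈ goodSet n l from hv), if_pos fun c _ => hv c]
  · rw [if_neg (show _ ∉ goodSet n l from hv), if_neg fun h => hv fun c => h c (Finset.mem_univ c)]

/-- The origins of grids, as representatives of residue classes. -/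
def origin {N : ℕ} (z : Fin n → ZMod N) : Cell n := fun c => ((z c).val : ℤ)

/-- Sums of periodic functions over a period are translation invariant. -/
lemma sum_origin_add {M : Type*} [AddCommMonoid M] {N : ℕ} [NeZero N] (g : Cell n → M)
    (hg : ∀ t t' : Cell n, (∀ c, (N : ℤ) ∣ t c - t' c) → g t = g t') (w : Cell n) :
    ∑ z : Fin n → ZMod N, g (origin z + w) = ∑ z : Fin n → ZMod N, g (origin z) := by
  rw [← Equiv.sum_comp (Equiv.addRight fun c => ((w c : ℤ) : ZMod N)) fun z => g (origin z)]
  refine Finset.sum_congr rfl fun z _ => hg _ _ fun c => ?_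
  rw [← ZMod.intCast_zmod_eq_zero_iff_dvd]
  simp [origin]

variable {X : Type*} [NormedAddCommGroup X] [NormedSpace ℝ X]

lemma blk_add (t w : Cell n) (s : ℕ) (i : Cell n) :
    blk (fun c => t c + w c * side s c) s i = blk t s i - w := by
  ext c
  rw [blk, Pi.sub_apply, blk, show i c - (t c + w c * side s c)
    = i c - t c + -(w c) * side s c by ring, Int.add_mul_ediv_right _ _ (side_pos s c).ne']
  ring

lemma gridPos_blk_add (t w : Cell n) (s : ℕ) (i : Cell n) :
    gridPos (fun c => t c + w c * side s c) s (blk (fun c => t c + w c * side s c) s i)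
      = gridPos t s (blk t s i) := by
  rw [blk_add]
  ext c
  simp only [gridPos, Pi.sub_apply]; ring

open Classical in
/-- Whether a rectangle has a given position in its ancestors is independent of the rectangle
itself: on average over the grids the good rectangles carry the fraction `2 ^ (-n)` of
every sum. Indeed, a translation of the grid by multiples of `2 ^ (l + 1)` sides preserves the
rectangle but changes its position, and exactly one of `2 ^ n` such translations makes it good. -/
lemma sum_origin_good {N s l : ℕ} (hN : ∀ c : Fin n, sideExp s c + (l + 2) ≤ N) (m i : Cell n)
    (Θ : Cell n → X) :
    ∑ z : Fin n → ZMod (2 ^ N), Θ (gridPos (origin z) s (blk (origin z) s i))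
      = (2 : ℝ) ^ n • ∑ z : Fin n → ZMod (2 ^ N),
        if blk (origin z) s i - m ∈ goodSet n l then
          Θ (gridPos (origin z) s (blk (origin z) s i)) else 0 := by
  set g : Cell n → X := fun t => if blk t s i - m ∈ goodSet n l then
    Θ (gridPos t s (blk t s i)) else 0 with hg
  -- origins that agree modulo `2 ^ N` give the same rectangles, with indices that agree modulo
  -- `2 ^ (l + 2)`
  have hper : ∀ t t' : Cell n, (∀ c, ((2 ^ N : ℕ) : ℤ) ∣ t c - t' c) → g t = g t' := by
    intro t t' h
    choose v hv using h
    have e : t = fun c => t' c + (2 ^ (N - sideExp s c) * v c) * side s c := by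
      ext c
      have : (2 : ℤ) ^ N = 2 ^ (N - sideExp s c) * 2 ^ sideExp s c := by
        rw [← pow_add, Nat.sub_add_cancel (by have := hN c; omega)]
      have h1 := hv c
      push_cast at h1
      rw [this] at h1
      rw [side]; linear_combination h1
    have hgood : ∀ q : Cell n, (q - fun c => 2 ^ (N - sideExp s c) * v c) ∈ goodSet n l
        ↔ q ∈ goodSet n l := by
      intro q
      refine forall_congr' fun c => ?_
      have : (q - fun c => 2 ^ (N - sideExp s c) * v c) c % 2 ^ (l + 2) = q c % 2 ^ (l + 2) := by
        rw [Pi.sub_apply]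
        have h2 : (2 : ℤ) ^ (N - sideExp s c)
            = 2 ^ (l + 2) * 2 ^ (N - sideExp s c - (l + 2)) := by
          rw [← pow_add]; congr 1; have := hN c; omega
        rw [h2, mul_assoc, Int.sub_mul_emod_self_left]
      rw [this]
    simp only [hg]
    rw [e, gridPos_blk_add t' (fun c => 2 ^ (N - sideExp s c) * v c),
      blk_add t' (fun c => 2 ^ (N - sideExp s c) * v c), sub_right_comm, if_congr (hgood _) rfl rfl]
  have hshift : ∀ v : Fin n → Fin 2, ∑ z : Fin n → ZMod (2 ^ N),
      (if (fun c => (blk (origin z) s i - m) c + (v c : ℤ) * 2 ^ (l + 1)) ∈ goodSet n l then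
        Θ (gridPos (origin z) s (blk (origin z) s i)) else 0)
      = ∑ z : Fin n → ZMod (2 ^ N), g (origin z) := by
    intro v
    rw [← sum_origin_add g hper fun c => -((v c : ℤ) * 2 ^ (l + 1)) * side s c]
    refine Finset.sum_congr rfl fun z _ => ?_
    have e : (origin z + fun c => -((v c : ℤ) * 2 ^ (l + 1)) * side s c)
        = fun c => origin z c + (fun c => -((v c : ℤ) * 2 ^ (l + 1))) c * side s c := rfl
    simp only [hg]
    rw [e, gridPos_blk_add, blk_add]
    refine if_congr (iff_of_eq (congrArg (· ∈ goodSet n l) ?_)) rfl rfl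
    ext c
    simp only [Pi.sub_apply]; ring
  calc _ = ∑ z : Fin n → ZMod (2 ^ N), ∑ v : Fin n → Fin 2,
        (if (fun c => (blk (origin z) s i - m) c + (v c : ℤ) * 2 ^ (l + 1)) ∈ goodSet n l then
          Θ (gridPos (origin z) s (blk (origin z) s i)) else 0) := by
        refine Finset.sum_congr rfl fun z _ => ?_
        have h1 := sum_goodSet l (blk (origin z) s i - m)
        conv_lhs => rw [← one_smul ℝ (Θ _), ← h1, Finset.sum_smul]
        refine Finset.sum_congr rfl fun v _ => ?_
        split_ifs <;> simp
    _ = _ := by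
        rw [Finset.sum_comm, Finset.sum_congr rfl fun v _ => hshift v, Finset.sum_const,
          ← Nat.cast_smul_eq_nsmul ℝ]
        congr 1
        simp

end Averaging

/-! ### Decomposition of a matrix along dyadic rectangles -/

section Matrices

variable {n : ℕ}

/-- The indices `m` with `|m c| ≤ M` for all `c`. -/
def box (n M : ℕ) : Finset (Cell n) := Fintype.piFinset fun _ => Finset.Icc (-(M : ℤ)) M

lemma mem_box {M : ℕ} {m : Cell n} : m ∈ box n M ↔ ∀ c, |m c| ≤ M := by
  simp [box, Fintype.mem_piFinset, abs_le]

lemma sum_box_neg {A : Type*} [AddCommMonoid A] (M : ℕ) (g : Cell n → A) :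
    ∑ m ∈ box n M, g (-m) = ∑ m ∈ box n M, g m :=
  Finset.sum_nbij' (fun m => -m) (fun m => -m) (by simp [mem_box]) (by simp [mem_box]) (by simp)
    (by simp) (by simp)

lemma exists_subset_box (S : Set (Cell n)) (hS : S.Finite) :
    ∃ M₀ : ℕ, ∀ M, M₀ ≤ M → ∀ m ∈ S, m ∈ box n M := by
  refine ⟨∑ m ∈ hS.toFinset, ∑ c, (m c).natAbs, fun M hM m hm => mem_box.2 fun c => ?_⟩
  have h1 : (m c).natAbs ≤ ∑ c, (m c).natAbs :=
    Finset.single_le_sum (f := fun c => (m c).natAbs) (fun _ _ => Nat.zero_le _) (Finset.mem_univ c)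
  have h2 : ∑ c, (m c).natAbs ≤ ∑ m ∈ hS.toFinset, ∑ c, (m c).natAbs :=
    Finset.single_le_sum (f := fun m : Cell n => ∑ c, (m c).natAbs) (fun _ _ => Nat.zero_le _)
      (hS.mem_toFinset.2 hm)
  rw [← Int.natCast_natAbs]
  omega

lemma gridPos_gridPos (t : Cell n) (s : ℕ) (q m : Cell n) :
    gridPos (gridPos t s q) s m = gridPos t s (q + m) := by
  ext c; simp only [gridPos, Pi.add_apply]; ring

@[simp] lemma gridPos_zero (u : Cell n) (s : ℕ) : gridPos u s 0 = u := by
  ext c; simp [gridPos]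

lemma gridPos_neg_gridPos (u : Cell n) (s : ℕ) (m : Cell n) :
    gridPos (gridPos u s m) s (-m) = u := by
  rw [gridPos_gridPos, add_neg_cancel, gridPos_zero]

/-- A sum with finite support is the sum over the rectangles of a large part of a grid. -/
lemma eventually_finsum_eq {A : Type*} [AddCommMonoid A] (u : Cell n) (s : ℕ) (g : Cell n → A)
    (hg : (Function.support g).Finite) :
    ∀ᶠ M in atTop, ∑ᶠ j, g j = ∑ m ∈ box n M, ∑ j ∈ rect s (gridPos u s m), g j := by
  obtain ⟨M₀, hM₀⟩ := exists_subset_box _ (hg.image (blk u s))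
  filter_upwards [eventually_ge_atTop M₀] with M hM
  rw [← Finset.sum_biUnion]
  · refine finsum_eq_sum_of_support_subset _ fun j hj => ?_
    rw [Finset.mem_coe, Finset.mem_biUnion]
    exact ⟨blk u s j, hM₀ M hM _ ⟨j, hj, rfl⟩, mem_rect_gridPos.2 rfl⟩
  · intro m _ m' _ hmm
    refine Finset.disjoint_left.2 fun j hj hj' => hmm ?_
    rw [← mem_rect_gridPos.1 hj, mem_rect_gridPos.1 hj']

variable {𝕜 : Type*} [RCLike 𝕜]

/-- The sum of the entries of a block of a matrix. -/
def blockSum (a : Cell n → Cell n → 𝕜) (P Q : Finset (Cell n)) : 𝕜 := ∑ i ∈ P, ∑ j ∈ Q, a i j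

/-- The coefficients of the matrix `a` with respect to two rectangles of level `s + 1`: each
rectangle carries its normalized indicator (for the sign `1`) or its Haar function (for the
sign `-1`). -/
def haarBlock [NeZero n] (a : Cell n → Cell n → 𝕜) (σ τ : ℝ) (s : ℕ) (u v : Cell n) : 𝕜 :=
  (rectCard n (s + 1) : ℝ)⁻¹ • (blockSum a (rect s u) (rect s v)
    + σ • blockSum a (rect s (u + halfShift s)) (rect s v)
    + τ • blockSum a (rect s u) (rect s (v + halfShift s))
    + (σ * τ) • blockSum a (rect s (u + halfShift s)) (rect s (v + halfShift s)))

lemma blockSum_succ [NeZero n] (a : Cell n → Cell n → 𝕜) (s : ℕ) (u v : Cell n) :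
    blockSum a (rect (s + 1) u) (rect (s + 1) v) = blockSum a (rect s u) (rect s v)
      + blockSum a (rect s (u + halfShift s)) (rect s v)
      + blockSum a (rect s u) (rect s (v + halfShift s))
      + blockSum a (rect s (u + halfShift s)) (rect s (v + halfShift s)) := by
  simp only [blockSum, sum_rect_succ, Finset.sum_add_distrib]
  ring

/-- The conditions on a matrix, in terms of dyadic rectangles, under which it defines a bounded
operator: bounded averages, decay of the Haar coefficients with the distance of the rectangles,
and vanishing of the matrix and its transpose on constants. -/
structure IsDyadicCZ [NeZero n] (a : Cell n → Cell n → 𝕜) (C₀ : ℝ≥0) (w : Cell n → ℝ≥0) :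
    Prop where
  size : ∀ s u m, ‖blockSum a (rect s u) (rect s (gridPos u s m))‖ ≤ C₀ * rectCard n s
  decay : ∀ s u m (σ τ : ℝ), (σ = 1 ∨ σ = -1) → (τ = 1 ∨ τ = -1) → (σ = -1 ∨ τ = -1) →
    ‖haarBlock a σ τ s u (gridPos u (s + 1) m)‖ ≤ w m
  neg : ∀ m, w (-m) = w m
  vanish : ∀ s u, Tendsto (fun M : ℕ =>
    ∑ m ∈ box n M, haarBlock a (-1) 1 s u (gridPos u (s + 1) m)) atTop (𝓝 0)
  adjoint_vanish : ∀ s u, Tendsto (fun M : ℕ =>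
    ∑ m ∈ box n M, haarBlock a 1 (-1) s (gridPos u (s + 1) m) u) atTop (𝓝 0)

variable {X : Type*} [NormedAddCommGroup X] [NormedSpace ℝ X] [NormedSpace 𝕜 X]
  [IsScalarTower ℝ 𝕜 X]

/-- The function `E_s a E_s f`, with the conditional expectations `E_s` of a grid. -/
def blockAvg (a : Cell n → Cell n → 𝕜) (f : Cell n → X) (t : Cell n) (s : ℕ) (i : Cell n) : X :=
  ∑ᶠ j, ((rectCard n s : ℝ)⁻¹ • ∑ i' ∈ rect s (gridPos t s (blk t s i)), a i' j) •
    (grid t s).avg f j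

omit [IsScalarTower ℝ 𝕜 X] in
lemma support_blockAvg (a : Cell n → Cell n → 𝕜) (f : Cell n → X)
    (hf : (Function.support f).Finite) (t : Cell n) (s : ℕ) (i : Cell n) :
    (Function.support fun j => ((rectCard n s : ℝ)⁻¹ •
      ∑ i' ∈ rect s (gridPos t s (blk t s i)), a i' j) • (grid t s).avg f j).Finite :=
  ((grid t s).finite_support_avg hf).subset fun _ hj => right_ne_zero_of_smul hj

lemma rect_zero [NeZero n] (u : Cell n) : rect 0 u = {u} := by
  obtain ⟨y, hy⟩ := Finset.card_eq_one.1 (show (rect 0 u).card = 1 by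
    rw [card_rect, rectCard_eq]; rfl)
  have := self_mem_rect 0 u
  rw [hy, Finset.mem_singleton] at this
  rw [hy, this]

lemma gridPos_blk_zero [NeZero n] (t i : Cell n) : gridPos t 0 (blk t 0 i) = i := by
  have h : i ∈ rect 0 (gridPos t 0 (blk t 0 i)) := mem_rect_gridPos.2 rfl
  rw [rect_zero, Finset.mem_singleton] at h
  exact h.symm

omit [IsScalarTower ℝ 𝕜 X] in
lemma blockAvg_zero [NeZero n] (a : Cell n → Cell n → 𝕜) (f : Cell n → X) (t i : Cell n) :
    blockAvg a f t 0 i = ∑ᶠ j, a i j • f j := by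
  refine finsum_congr fun j => ?_
  rw [grid_avg, gridPos_blk_zero, gridPos_blk_zero, rectAvg, rect_zero, rect_zero]
  simp [rectCard_eq]

lemma grid_avg_of_mem {t : Cell n} {s : ℕ} {f : Cell n → X} {q j : Cell n}
    (hj : j ∈ rect s (gridPos t s q)) : (grid t s).avg f j = rectAvg f s (gridPos t s q) := by
  rw [grid_avg, mem_rect_gridPos.1 hj]

lemma sum_smul_blockAvg (a : Cell n → Cell n → 𝕜) (r : ℝ) (P Q : Finset (Cell n)) (x : X)
    (F : Cell n → X) (hF : ∀ j ∈ Q, F j = x) :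
    ∑ j ∈ Q, (r • ∑ i' ∈ P, a i' j) • F j = r • blockSum a P Q • x := by
  rw [Finset.sum_congr rfl fun j hj => by rw [hF j hj], ← Finset.sum_smul, ← Finset.smul_sum,
    smul_assoc, blockSum, Finset.sum_comm]

/-- The averages `E_s a E_s f` over large rectangles tend to zero uniformly. -/
lemma norm_blockAvg_le [NeZero n] {a : Cell n → Cell n → 𝕜} {C₀ : ℝ≥0} {w : Cell n → ℝ≥0}
    (ha : IsDyadicCZ a C₀ w) (f : Cell n → X) (hf : (Function.support f).Finite) (t : Cell n)
    (s : ℕ) (i : Cell n) : ‖blockAvg a f t s i‖ ≤ C₀ * (2 ^ s)⁻¹ * ∑ᶠ j, ‖f j‖ := by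
  obtain ⟨M, h1, h2⟩ := ((eventually_finsum_eq (gridPos t s (blk t s i)) s _
    (support_blockAvg a f hf t s i)).and (eventually_finsum_eq (gridPos t s (blk t s i)) s
      (fun j => ‖f j‖) (by simpa [Function.support] using hf))).exists
  rw [blockAvg, h1, h2, Finset.mul_sum]
  refine norm_sum_le_of_le _ fun m _ => ?_
  rw [gridPos_gridPos, sum_smul_blockAvg a _ _ _ _ _ fun j hj => grid_avg_of_mem hj, norm_smul,
    norm_smul, rectAvg, norm_smul, ← gridPos_gridPos]
  have h3 : ‖∑ j ∈ rect s (gridPos (gridPos t s (blk t s i)) s m), f j‖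
    ≤ ∑ j ∈ rect s (gridPos (gridPos t s (blk t s i)) s m), ‖f j‖ := norm_sum_le _ _
  have h4 := ha.size s (gridPos t s (blk t s i)) m
  have h5 : (0 : ℝ) < rectCard n s := by exact_mod_cast rectCard_pos n s
  have h6 : (rectCard n s : ℝ) = 2 ^ s := by rw [rectCard_eq]; simp
  rw [Real.norm_of_nonneg (inv_nonneg.2 h5.le)]
  calc _ ≤ (rectCard n s : ℝ)⁻¹ * (C₀ * rectCard n s * ((rectCard n s : ℝ)⁻¹ *
        ∑ j ∈ rect s (gridPos (gridPos t s (blk t s i)) s m), ‖f j‖)) := by gcongr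
    _ = _ := by rw [← h6]; field_simp

/-- The contribution of the pairs of rectangles with relative position `m` to the difference
of `E_s a E_s f` and `E_{s+1} a E_{s+1} f`. -/
lemma sum_rect_blockAvg_sub [NeZero n] (a : Cell n → Cell n → 𝕜) (f : Cell n → X) (t : Cell n)
    (s : ℕ) (i : Cell n) (q : Cell n) (u v : Cell n) (hu : u = gridPos t (s + 1) (blk t (s + 1) i))
    (hv : v = gridPos t (s + 1) q) :
    ∑ j ∈ rect (s + 1) v, (((rectCard n s : ℝ)⁻¹ •
        ∑ i' ∈ rect s (gridPos t s (blk t s i)), a i' j) • (grid t s).avg f j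
      - ((rectCard n (s + 1) : ℝ)⁻¹ • ∑ i' ∈ rect (s + 1) (gridPos t (s + 1) (blk t (s + 1) i)),
        a i' j) • (grid t (s + 1)).avg f j)
    = haarSign t s i • haarBlock a (-1) (-1) s u v • haarCoeff f s v
      + haarBlock a 1 (-1) s u v • haarCoeff f s v
      + haarSign t s i • haarBlock a (-1) 1 s u v • rectAvg f (s + 1) v := by
  have e : ∀ j ∈ rect (s + 1) v, (grid t (s + 1)).avg f j = rectAvg f (s + 1) v :=
    fun j hj => by rw [hv] at hj ⊢; exact grid_avg_of_mem hj
  have e' : ∀ j ∈ rect (s + 1) v, (grid t s).avg f j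
      = rectAvg f (s + 1) v + haarSign t s j • haarCoeff f s v := fun j hj => by
    have h1 := grid_avg_sub t s f j
    rw [e j hj] at h1
    rw [hv] at hj
    rw [mem_rect_gridPos.1 hj, ← hv] at h1
    rw [← h1]; abel
  rw [Finset.sum_sub_distrib, sum_smul_blockAvg a _ _ _ _ _ e, sum_rect_succ,
    sum_smul_blockAvg a _ _ _ (rectAvg f (s + 1) v + haarCoeff f s v) _ fun j hj => by
      rw [e' j (mem_rect_succ.2 (Or.inl hj)), haarSign_of_mem.1 (hv ▸ hj), one_smul],
    sum_smul_blockAvg a _ _ _ (rectAvg f (s + 1) v - haarCoeff f s v) _ fun j hj => by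
      rw [e' j (mem_rect_succ.2 (Or.inr hj)), haarSign_of_mem.2 (hv ▸ hj), neg_one_smul,
        sub_eq_add_neg], ← hu, blockSum_succ, gridPos_blk_eq, ← hu]
  simp only [haarBlock]
  have h2 : (rectCard n (s + 1) : ℝ)⁻¹ = (1 / 2) * (rectCard n s : ℝ)⁻¹ := by
    rw [rectCard_succ]; push_cast; rw [mul_inv, one_div]
  rw [h2]
  generalize (rectCard n s : ℝ)⁻¹ = r
  rcases haarSign_eq t s i with h | h
  · rw [if_pos h, h]
    simp only [smul_assoc, add_smul, smul_add, smul_sub]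
    module
  · rw [if_neg (by rw [h]; norm_num), h]
    simp only [smul_assoc, add_smul, smul_add, smul_sub]
    module

variable [NeZero n]

lemma haarSign_eq_ite (t : Cell n) (s : ℕ) (i : Cell n) :
    haarSign t s i = if i ∈ rect s (gridPos t (s + 1) (blk t (s + 1) i)) then 1 else -1 := by
  have h : i ∈ rect (s + 1) (gridPos t (s + 1) (blk t (s + 1) i)) := mem_rect_gridPos.2 rfl
  split_ifs with h1
  · exact haarSign_of_mem.1 h1
  · exact haarSign_of_mem.2 ((mem_rect_succ.1 h).resolve_left h1)

/-- The part of the matrix `a` between Haar functions, for rectangles in relative position `m`, at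
a point `i` of the rectangle `u`. -/
def haarShiftTerm (a : Cell n → Cell n → 𝕜) (f : Cell n → X) (s : ℕ) (i m u : Cell n) : X :=
  (if i ∈ rect s u then (1 : ℝ) else -1) • haarBlock a (-1) (-1) s u (gridPos u (s + 1) (-m)) •
    haarCoeff f s (gridPos u (s + 1) (-m))

/-- The part of the matrix `a` from Haar functions to indicators. -/
def haarMoveTerm (a : Cell n → Cell n → 𝕜) (f : Cell n → X) (s : ℕ) (m u : Cell n) : X :=
  haarBlock a 1 (-1) s u (gridPos u (s + 1) (-m)) • haarCoeff f s (gridPos u (s + 1) (-m))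

/-- The correction of `haarMoveTerm`, whose sum over all `m` vanishes. -/
def haarStayTerm (a : Cell n → Cell n → 𝕜) (f : Cell n → X) (s : ℕ) (m u : Cell n) : X :=
  haarBlock a 1 (-1) s (gridPos u (s + 1) m) u • haarCoeff f s u

/-- The part of the matrix `a` from indicators to Haar functions, with its correction. -/
def haarDiffTerm (a : Cell n → Cell n → 𝕜) (f : Cell n → X) (s : ℕ) (i m u : Cell n) : X :=
  (if i ∈ rect s u then (1 : ℝ) else -1) • haarBlock a (-1) 1 s u (gridPos u (s + 1) m) •
    (rectAvg f (s + 1) (gridPos u (s + 1) m) - rectAvg f (s + 1) u)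

/-- The sum of all parts for rectangles in relative position `m`. -/
def haarTerm (a : Cell n → Cell n → 𝕜) (f : Cell n → X) (s : ℕ) (i m u : Cell n) : X :=
  haarShiftTerm a f s i m u + (haarMoveTerm a f s m u - haarStayTerm a f s m u)
    + haarDiffTerm a f s i m u

/-- The sum of all parts is the difference of `E_s a E_s f` and `E_{s+1} a E_{s+1} f`. The
corrections sum to zero, because `a` and its transpose vanish on constants. -/
lemma tendsto_sum_haarTerm {a : Cell n → Cell n → 𝕜} {C₀ : ℝ≥0} {w : Cell n → ℝ≥0}
    (ha : IsDyadicCZ a C₀ w) (f : Cell n → X) (hf : (Function.support f).Finite) (t : Cell n)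
    (s : ℕ) (i : Cell n) :
    Tendsto (fun M : ℕ => ∑ m ∈ box n M,
        haarTerm a f s i m (gridPos t (s + 1) (blk t (s + 1) i)))
      atTop (𝓝 (blockAvg a f t s i - blockAvg a f t (s + 1) i)) := by
  set u := gridPos t (s + 1) (blk t (s + 1) i) with hu
  have hsub : blockAvg a f t s i - blockAvg a f t (s + 1) i = ∑ᶠ j,
      (((rectCard n s : ℝ)⁻¹ •
        ∑ i' ∈ rect s (gridPos t s (blk t s i)), a i' j) • (grid t s).avg f j
      - ((rectCard n (s + 1) : ℝ)⁻¹ • ∑ i' ∈ rect (s + 1) (gridPos t (s + 1) (blk t (s + 1) i)),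
        a i' j) • (grid t (s + 1)).avg f j) :=
    (finsum_sub_distrib (support_blockAvg a f hf t s i) (support_blockAvg a f hf t (s + 1) i)).symm
  have h1 := ha.adjoint_vanish s u
  have h2 := ha.vanish s u
  have h3 : Tendsto (fun M : ℕ => (blockAvg a f t s i - blockAvg a f t (s + 1) i)
      - (∑ m ∈ box n M, haarBlock a 1 (-1) s (gridPos u (s + 1) m) u) • haarCoeff f s u
      - haarSign t s i • (∑ m ∈ box n M, haarBlock a (-1) 1 s u (gridPos u (s + 1) m)) •
        rectAvg f (s + 1) u) atTop (𝓝 ((blockAvg a f t s i - blockAvg a f t (s + 1) i)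
      - (0 : 𝕜) • haarCoeff f s u - haarSign t s i • (0 : 𝕜) • rectAvg f (s + 1) u)) :=
    (tendsto_const_nhds.sub (h1.smul_const _)).sub ((h2.smul_const _).const_smul _)
  simp only [zero_smul, smul_zero, sub_zero] at h3
  refine h3.congr' ?_
  have hs := ((support_blockAvg a f hf t s i).union (support_blockAvg a f hf t (s + 1) i)).subset
    (Function.support_sub _ _)
  filter_upwards [eventually_finsum_eq u (s + 1) _ hs] with M hM
  have e1 : (blockAvg a f t s i - blockAvg a f t (s + 1) i) = ∑ m ∈ box n M,
      (haarSign t s i • haarBlock a (-1) (-1) s u (gridPos u (s + 1) m) •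
        haarCoeff f s (gridPos u (s + 1) m)
      + haarBlock a 1 (-1) s u (gridPos u (s + 1) m) • haarCoeff f s (gridPos u (s + 1) m)
      + haarSign t s i • haarBlock a (-1) 1 s u (gridPos u (s + 1) m) •
        rectAvg f (s + 1) (gridPos u (s + 1) m)) := by
    rw [hsub]
    refine hM.trans (Finset.sum_congr rfl fun m _ => ?_)
    refine sum_rect_blockAvg_sub a f t s i (blk t (s + 1) i + m) u _ hu ?_
    rw [hu, gridPos_gridPos]
  rw [e1]
  simp only [haarTerm, haarShiftTerm, haarMoveTerm, haarStayTerm, haarDiffTerm]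
  rw [hu, ← haarSign_eq_ite, ← hu]
  simp only [Finset.sum_add_distrib, Finset.sum_sub_distrib]
  -- in the first two parts the second rectangle is the translate by `-m`
  rw [sum_box_neg M fun m => haarSign t s i • haarBlock a (-1) (-1) s u (gridPos u (s + 1) m) •
        haarCoeff f s (gridPos u (s + 1) m),
    sum_box_neg M fun m => haarBlock a 1 (-1) s u (gridPos u (s + 1) m) •
      haarCoeff f s (gridPos u (s + 1) m), Finset.sum_smul, Finset.sum_smul, Finset.smul_sum]
  simp only [smul_sub, Finset.sum_sub_distrib]
  abel

variable {p B : ℝ≥0∞}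

omit [NeZero n] in
lemma ellNorm_average_le (hp : 1 ≤ p) {κ : Type*} [Fintype κ] [Nonempty κ] (F : κ → Cell n → X)
    {K : ℝ≥0∞} (hF : ∀ z, ellNorm p (F z) ≤ K) :
    ellNorm p (fun i => (Fintype.card κ : ℝ)⁻¹ • ∑ z, F z i) ≤ K := by
  rw [ellNorm_const_smul]
  refine (mul_le_mul_right ((ellNorm_sum_le hp _ _).trans
    (Finset.sum_le_sum fun z _ => hF z)) _).trans (le_of_eq ?_)
  have h0 : (Fintype.card κ : ℝ≥0∞) ≠ 0 := by exact_mod_cast Fintype.card_ne_zero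
  rw [Finset.sum_const, Finset.card_univ, nsmul_eq_mul, enorm_inv (by
    exact_mod_cast Fintype.card_ne_zero), ← mul_assoc]
  rw [show ‖(Fintype.card κ : ℝ)‖ₑ = Fintype.card κ by
    rw [← ofReal_norm, Real.norm_natCast, ENNReal.ofReal_natCast],
    ENNReal.inv_mul_cancel h0 (ENNReal.natCast_ne_top _), one_mul]

/-- The diagonal parts are Haar multipliers. -/
lemma ellNorm_haarTerm_zero_le (hp : 1 ≤ p) (hp' : p ≠ ∞) (h : IsDiscreteUMDBound (Cell n) p X B)
    {a : Cell n → Cell n → 𝕜} {C₀ : ℝ≥0} {w : Cell n → ℝ≥0} (ha : IsDyadicCZ a C₀ w)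
    (f : Cell n → X) (hf : (Function.support f).Finite) (t : Cell n) (R : ℕ) :
    ellNorm p (fun i => ∑ s ∈ Finset.range R,
      haarTerm a f s i 0 (gridPos t (s + 1) (blk t (s + 1) i)))
      ≤ 4 * w 0 * B ^ 2 * ellNorm p f := by
  let lam : ℕ → Cell n → 𝕜 := fun s q => if s < R then
    haarBlock a (-1) (-1) s (gridPos t (s + 1) q) (gridPos t (s + 1) q) else 0
  have hlam : ∀ s q, ‖lam s q‖ ≤ w 0 := fun s q => by
    simp only [lam]; split_ifs
    · have := ha.decay s (gridPos t (s + 1) q) 0 (-1) (-1) (Or.inr rfl) (Or.inr rfl) (Or.inl rfl)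
      rwa [gridPos_zero] at this
    · simp
  have key := ellNorm_sum_range_le hp (fun s i => haarSign t s i • lam s (blk t (s + 1) i) •
    haarCoeff f s (gridPos t (s + 1) (blk t (s + 1) i))) 0 R
    (fun s hs => by ext i; simp [lam, not_lt.2 hs]) (K := 4 * w 0 * B * ellNorm p f) fun ρ => by
      have := h.haar_proj hp hp' (fun _ => Set.univ) t 0 ρ R
        (fun k q => lam (chainLevel n 0 ρ R k) q) (fun k q => hlam _ q) f hf
      simpa using this
  refine le_trans (le_of_eq (congrArg _ (funext fun i => ?_))) (key.trans ?_)
  · refine Finset.sum_congr rfl fun s hs => ?_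
    simp [lam, Finset.mem_range.1 hs, haarTerm, haarShiftTerm, haarMoveTerm, haarStayTerm,
      haarDiffTerm, ← haarSign_eq_ite]
  · have := h.mul_ellNorm_le hp f
    calc _ = 4 * w 0 * (B * ellNorm p f) := by simp; ring
      _ ≤ 4 * w 0 * (B ^ 2 * ellNorm p f) := by gcongr
      _ = _ := by ring

end Matrices

/-! ### Boundedness of matrices by averaging over grids -/

section MatrixBound

variable {n : ℕ} [NeZero n] {𝕜 : Type*} [RCLike 𝕜] {X : Type*} [NormedAddCommGroup X]
  [NormedSpace ℝ X] [NormedSpace 𝕜 X] [IsScalarTower ℝ 𝕜 X] {p B : ℝ≥0∞}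

omit [NeZero n] in
lemma sideExp_le (s : ℕ) (c : Fin n) : sideExp s c ≤ s := by
  have hc := c.isLt
  refine Nat.le_of_lt_succ (Nat.div_lt_of_lt_mul ?_)
  nlinarith [Nat.zero_le s]

omit [IsScalarTower ℝ 𝕜 X] in
open Classical in
/-- The sum over all grids may be restricted to good rectangles. It is the first rectangle of a pair
that is required to be good, and this is the translate by `-m` where the coefficient of `f` belongs
to that translate. -/
lemma sum_haarTerm_eq (a : Cell n → Cell n → 𝕜) (f : Cell n → X) (i m : Cell n) {R N l : ℕ}
    (hN : R + (l + 2) ≤ N) :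
    ∑ z : Fin n → ZMod (2 ^ N), ∑ s ∈ Finset.range R,
        haarTerm a f s i m (gridPos (origin z) (s + 1) (blk (origin z) (s + 1) i))
    = ∑ z : Fin n → ZMod (2 ^ N), (2 : ℝ) ^ n • (
      (∑ s ∈ Finset.range R, if blk (origin z) (s + 1) i - m ∈ goodSet n l then
        haarShiftTerm a f s i m (gridPos (origin z) (s + 1) (blk (origin z) (s + 1) i)) else 0)
      + (∑ s ∈ Finset.range R,
        ((if blk (origin z) (s + 1) i - m ∈ goodSet n l then
          haarMoveTerm a f s m (gridPos (origin z) (s + 1) (blk (origin z) (s + 1) i)) else 0)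
        - if blk (origin z) (s + 1) i ∈ goodSet n l then
          haarStayTerm a f s m (gridPos (origin z) (s + 1) (blk (origin z) (s + 1) i)) else 0))
      + ∑ s ∈ Finset.range R, if blk (origin z) (s + 1) i ∈ goodSet n l then
        haarDiffTerm a f s i m (gridPos (origin z) (s + 1) (blk (origin z) (s + 1) i)) else 0) := by
  simp only [← Finset.sum_add_distrib, Finset.smul_sum]
  rw [Finset.sum_comm, Finset.sum_comm (s := Finset.univ (α := Fin n → ZMod (2 ^ N)))]
  refine Finset.sum_congr rfl fun s hs => ?_
  have hs' : ∀ c : Fin n, sideExp (s + 1) c + (l + 2) ≤ N := fun c => by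
    have := sideExp_le (s + 1) c
    have := Finset.mem_range.1 hs
    omega
  simp only [haarTerm, smul_add, smul_sub, Finset.sum_add_distrib, Finset.sum_sub_distrib,
    ← Finset.smul_sum]
  rw [sum_origin_good hs' m i (haarShiftTerm a f s i m),
    sum_origin_good hs' m i (haarMoveTerm a f s m),
    sum_origin_good hs' 0 i (haarStayTerm a f s m), sum_origin_good hs' 0 i (haarDiffTerm a f s i m)]
  simp only [sub_zero]

/-- The contribution of the relative position `m`, averaged over the grids, is bounded by the weight
`w m` and the number `n * (l + 2) + 1` of residue classes of levels. -/
lemma ellNorm_sum_haarTerm_le (hp : 1 ≤ p) (hp' : p ≠ ∞) (h : IsDiscreteUMDBound (Cell n) p X B)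
    {a : Cell n → Cell n → 𝕜} {C₀ : ℝ≥0} {w : Cell n → ℝ≥0} (ha : IsDyadicCZ a C₀ w)
    (f : Cell n → X) (hf : (Function.support f).Finite) {m : Cell n} {l : ℕ}
    (hl : ∀ c, |m c| ≤ 2 ^ l) {R N : ℕ} (hN : R + (l + 2) ≤ N) :
    ellNorm p (fun i => (Fintype.card (Fin n → ZMod (2 ^ N)) : ℝ)⁻¹ •
      ∑ z : Fin n → ZMod (2 ^ N), ∑ s ∈ Finset.range R,
        haarTerm a f s i m (gridPos (origin z) (s + 1) (blk (origin z) (s + 1) i)))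
    ≤ 2 ^ n * (96 * (n * (l + 2) + 1 : ℕ)) * w m * B ^ 2 * ellNorm p f := by
  classical
  by_cases hm : m = 0
  · subst hm
    refine ellNorm_average_le hp _ fun z =>
      (ellNorm_haarTerm_zero_le hp hp' h ha f hf _ R).trans ?_
    gcongr
    have h1 : (1 : ℝ≥0∞) ≤ 2 ^ n := one_le_pow₀ (by norm_num)
    have h2 : (1 : ℝ≥0∞) ≤ ((n * (l + 2) + 1 : ℕ) : ℝ≥0∞) := by exact_mod_cast Nat.succ_pos _
    calc (4 : ℝ≥0∞) ≤ 1 * (96 * 1) := by norm_num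
      _ ≤ _ := by gcongr
  simp only [sum_haarTerm_eq a f _ m hN]
  refine ellNorm_average_le hp _ fun z => ?_
  rw [ellNorm_const_smul]
  have hG := isGood_goodSet hl
  have e1 := ellNorm_haar_shift_le hp hp' h hm hG (origin z) R (fun s q => haarBlock a (-1) (-1) s
    (gridPos (origin z) (s + 1) (q + m)) (gridPos (origin z) (s + 1) q)) (c := w m) (fun s q => by
      have := ha.decay s (gridPos (origin z) (s + 1) (q + m)) (-m) (-1) (-1) (Or.inr rfl)
        (Or.inr rfl) (Or.inl rfl)
      rwa [gridPos_gridPos, add_neg_cancel_right, ha.neg] at this) f hf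
  have e2 := ellNorm_haar_diff_le hp hp' h hm hG (origin z) R (fun s q => -haarBlock a 1 (-1) s
    (gridPos (origin z) (s + 1) (q + m)) (gridPos (origin z) (s + 1) q)) (c := w m) (fun s q => by
      have := ha.decay s (gridPos (origin z) (s + 1) (q + m)) (-m) 1 (-1) (Or.inl rfl)
        (Or.inr rfl) (Or.inr rfl)
      rwa [gridPos_gridPos, add_neg_cancel_right, ha.neg, ← norm_neg] at this) f hf
  have e3 := ellNorm_diff_haar_le hp hp' h hm hG (origin z) R (fun s q => -haarBlock a (-1) 1 s
    (gridPos (origin z) (s + 1) q) (gridPos (origin z) (s + 1) (q + m))) (c := w m) (fun s q => by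
      have := ha.decay s (gridPos (origin z) (s + 1) q) m (-1) 1 (Or.inr rfl)
        (Or.inl rfl) (Or.inl rfl)
      rwa [gridPos_gridPos, ← norm_neg] at this) f hf
  have hsum := (ellNorm_add_le hp _ _).trans (add_le_add
    ((ellNorm_add_le hp _ _).trans (add_le_add e1 e2)) e3)
  have e4 : ‖(2 : ℝ) ^ n‖ₑ = 2 ^ n := by
    rw [enorm_pow]; congr 1
    rw [← ofReal_norm]; norm_num
  rw [e4]
  refine le_trans (mul_le_mul_right (le_trans (le_of_eq (congrArg _ (funext fun i => ?_))) hsum) _)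
    (le_of_eq (by ring))
  congr 1
  · congr 1
    · refine Finset.sum_congr rfl fun s _ => ?_
      rw [haarShiftTerm, gridPos_gridPos, ← haarSign_eq_ite, sub_add_cancel, ← sub_eq_add_neg]
    · refine Finset.sum_congr rfl fun s _ => ?_
      rw [haarMoveTerm, haarStayTerm, gridPos_gridPos, gridPos_gridPos, ← sub_eq_add_neg]
      simp only [sub_add_cancel, neg_smul]
      split_ifs <;> simp [sub_eq_add_neg, add_comm]
  · refine Finset.sum_congr rfl fun s _ => ?_
    rw [haarDiffTerm, gridPos_gridPos, ← haarSign_eq_ite]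
    split_ifs
    · congr 1
      rw [neg_smul, ← smul_neg, neg_sub]
    · rfl

omit [NeZero n] in
/-- Up to level `R`, a grid depends on its origin modulo `2 ^ R` only. -/
lemma gridPos_blk_origin {R s : ℕ} (hs : s ≤ R) (t i : Cell n) :
    gridPos (origin fun c => (t c : ZMod (2 ^ R))) s
      (blk (origin fun c => (t c : ZMod (2 ^ R))) s i) = gridPos t s (blk t s i) := by
  have e : t = fun c => (origin fun c => (t c : ZMod (2 ^ R))) c
      + (t c / 2 ^ R * 2 ^ (R - sideExp s c)) * side s c := by
    ext c
    have h1 : (origin fun c => (t c : ZMod (2 ^ R))) c = t c % 2 ^ R := by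
      simp only [origin, ZMod.val_intCast]
      push_cast; rfl
    have h2 : (2 : ℤ) ^ (R - sideExp s c) * 2 ^ sideExp s c = 2 ^ R := by
      rw [← pow_add, Nat.sub_add_cancel ((sideExp_le s c).trans hs)]
    rw [h1, side, mul_assoc, h2]
    have := Int.emod_add_mul_ediv (t c) (2 ^ R)
    linarith
  have := gridPos_blk_add (origin fun c => (t c : ZMod (2 ^ R)))
    (fun c => t c / 2 ^ R * 2 ^ (R - sideExp s c)) s i
  rw [← e] at this
  exact this.symm

/-- A matrix satisfying the dyadic Calderón–Zygmund conditions is bounded. Averaging over the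
grids makes it possible to treat, for each relative position, only the rectangles which have a
close common ancestor with their translate. -/
lemma IsDyadicCZ.ellNorm_le (hp : 1 ≤ p) (hp' : p ≠ ∞) (h : IsDiscreteUMDBound (Cell n) p X B)
    {a : Cell n → Cell n → 𝕜} {C₀ : ℝ≥0} {w : Cell n → ℝ≥0} (ha : IsDyadicCZ a C₀ w)
    (l : Cell n → ℕ) (hl : ∀ m c, |m c| ≤ 2 ^ l m) (f : Cell n → X)
    (hf : (Function.support f).Finite) :
    ellNorm p (fun i => ∑ᶠ j, a i j • f j)
      ≤ (∑' m, 2 ^ n * (96 * (n * (l m + 2) + 1 : ℕ)) * (w m : ℝ≥0∞)) * B ^ 2 * ellNorm p f := by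
  set D : ℕ → ℕ → Cell n → Cell n → X := fun R M t i => ∑ s ∈ Finset.range R, ∑ m ∈ box n M,
    haarTerm a f s i m (gridPos t (s + 1) (blk t (s + 1) i)) with hD
  have hDt : ∀ R t i, Tendsto (fun M => D R M t i) atTop
      (𝓝 (blockAvg a f t 0 i - blockAvg a f t R i)) := by
    intro R t i
    rw [← Finset.sum_range_sub' (fun s => blockAvg a f t s i)]
    exact tendsto_finsetSum _ fun s _ => tendsto_sum_haarTerm ha f hf t s i
  -- up to level `R` there are only finitely many grids, and so one `M` serves all of them on a
  -- box
  have hM : ∀ R : ℕ, ∃ M : ℕ, ∀ z : Fin n → ZMod (2 ^ R), ∀ i ∈ box n R,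
      ‖D R M (origin z) i - (blockAvg a f (origin z) 0 i - blockAvg a f (origin z) R i)‖
        ≤ (2 ^ R)⁻¹ := by
    intro R
    have : ∀ᶠ M in atTop, ∀ z : Fin n → ZMod (2 ^ R), ∀ i ∈ box n R,
        ‖D R M (origin z) i - (blockAvg a f (origin z) 0 i - blockAvg a f (origin z) R i)‖
          ≤ (2 ^ R)⁻¹ := by
      refine eventually_all.2 fun z => (Filter.eventually_all_finset _).2 fun i _ => ?_
      have h1 := tendsto_iff_norm_sub_tendsto_zero.1 (hDt R (origin z) i)
      exact h1.eventually_le_const (by positivity)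
    exact this.exists
  choose M hM using hM
  have hper : ∀ R M t i, D R M t i = D R M (origin fun c => (t c : ZMod (2 ^ R))) i := by
    intro R M t i
    refine Finset.sum_congr rfl fun s hs => ?_
    rw [gridPos_blk_origin (Finset.mem_range.1 hs)]
  set S : ℝ := ∑ᶠ j, ‖f j‖ with hS
  have hclose : ∀ R t, ∀ i ∈ box n R, ‖D R (M R) t i - ∑ᶠ j, a i j • f j‖
      ≤ (1 + C₀ * S) * (2 ^ R)⁻¹ := by
    intro R t i hi
    rw [hper]
    set z : Fin n → ZMod (2 ^ R) := fun c => (t c : ZMod (2 ^ R))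
    have h1 := hM R z i hi
    have h2 := norm_blockAvg_le ha f hf (origin z) R i
    rw [blockAvg_zero] at h1
    calc _ = ‖(D R (M R) (origin z) i - (∑ᶠ j, a i j • f j - blockAvg a f (origin z) R i))
          - blockAvg a f (origin z) R i‖ := by congr 1; abel
      _ ≤ (2 ^ R)⁻¹ + C₀ * (2 ^ R)⁻¹ * S := (norm_sub_le _ _).trans (add_le_add h1 h2)
      _ = _ := by ring
  -- the period of the grids has to exceed the common ancestors of the pairs in position `m`, for
  -- all `m` in the finite sum
  let N : ℕ → ℕ := fun R => R + ∑ m ∈ box n (M R), (l m + 2)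
  refine ellNorm_le_of_tendsto (f := fun R i => (Fintype.card (Fin n → ZMod (2 ^ N R)) : ℝ)⁻¹ •
    ∑ z : Fin n → ZMod (2 ^ N R), D R (M R) (origin z) i) (fun i => ?_) fun R => ?_
  · obtain ⟨R₀, hR₀⟩ := exists_subset_box {i} (Set.finite_singleton i)
    rw [tendsto_iff_norm_sub_tendsto_zero]
    have hlim : Tendsto (fun R : ℕ => (1 + C₀ * S) * ((2 : ℝ) ^ R)⁻¹) atTop (𝓝 0) := by
      have := (tendsto_pow_atTop_nhds_zero_of_lt_one (r := (1 / 2 : ℝ)) (by norm_num)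
        (by norm_num)).const_mul (1 + C₀ * S)
      simpa using this
    refine squeeze_zero' (Eventually.of_forall fun _ => norm_nonneg _) ?_ hlim
    filter_upwards [eventually_ge_atTop R₀] with R hR
    have hc : (Fintype.card (Fin n → ZMod (2 ^ N R)) : ℝ) ≠ 0 := by
      exact_mod_cast Fintype.card_ne_zero
    have e : (Fintype.card (Fin n → ZMod (2 ^ N R)) : ℝ)⁻¹ •
        ∑ z : Fin n → ZMod (2 ^ N R), D R (M R) (origin z) i - ∑ᶠ j, a i j • f j
        = (Fintype.card (Fin n → ZMod (2 ^ N R)) : ℝ)⁻¹ •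
          ∑ z : Fin n → ZMod (2 ^ N R), (D R (M R) (origin z) i - ∑ᶠ j, a i j • f j) := by
      rw [Finset.sum_sub_distrib, smul_sub, Finset.sum_const, Finset.card_univ,
        ← Nat.cast_smul_eq_nsmul ℝ, inv_smul_smul₀ hc]
    rw [e, norm_smul, norm_inv, Real.norm_natCast, inv_mul_le_iff₀ (by positivity)]
    refine (norm_sum_le_of_le _ fun z _ => hclose R (origin z) i (hR₀ R hR i rfl)).trans ?_
    rw [Finset.sum_const, Finset.card_univ, nsmul_eq_mul]
  · have e : (fun i => (Fintype.card (Fin n → ZMod (2 ^ N R)) : ℝ)⁻¹ •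
        ∑ z : Fin n → ZMod (2 ^ N R), D R (M R) (origin z) i)
        = fun i => ∑ m ∈ box n (M R), (Fintype.card (Fin n → ZMod (2 ^ N R)) : ℝ)⁻¹ •
          ∑ z : Fin n → ZMod (2 ^ N R), ∑ s ∈ Finset.range R,
            haarTerm a f s i m (gridPos (origin z) (s + 1) (blk (origin z) (s + 1) i)) := by
      ext i
      rw [← Finset.smul_sum, Finset.sum_comm (s := box n (M R))]
      refine congrArg _ (Finset.sum_congr rfl fun z _ => ?_)
      simp only [hD]
      rw [Finset.sum_comm]
    rw [e]
    refine (ellNorm_sum_le hp _ _).trans ((Finset.sum_le_sum fun m hm =>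
      ellNorm_sum_haarTerm_le hp hp' h ha f hf (hl m) (R := R) (N := N R) ?_).trans ?_)
    · have : l m + 2 ≤ ∑ m ∈ box n (M R), (l m + 2) :=
        Finset.single_le_sum (f := fun m => l m + 2) (fun _ _ => Nat.zero_le _) hm
      simp only [N]; omega
    · simp only [mul_assoc _ (B ^ 2) (ellNorm p f)]
      rw [← Finset.sum_mul]
      gcongr
      exact ENNReal.sum_le_tsum _

end MatrixBound

/-! ### Summability of the weights -/

section Weights

variable {n : ℕ}

lemma abs_le_norm_cell (m : Cell n) (c : Fin n) : |(m c : ℝ)| ≤ ‖m‖ := by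
  have := norm_le_pi_norm m c
  rwa [Int.norm_eq_abs] at this

/-- The norm is the maximum of the coordinates, so the weights are at most products of summable
weights on the integers. -/
lemma tsum_norm_cell_lt_top [NeZero n] {γ : ℝ} (hγ : 0 < γ) :
    ∑' m : Cell n, ENNReal.ofReal ((1 + ‖m‖) ^ (-((n : ℝ) + γ))) < ∞ := by
  have hn : (0 : ℝ) < n := by exact_mod_cast NeZero.pos n
  set β : ℝ := 1 + γ / n with hβ
  have hβ1 : 1 < β := by rw [hβ]; linarith [div_pos hγ hn]
  have hS : Summable fun k : ℤ => (1 + |(k : ℝ)|) ^ (-β) := by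
    have h0 : Summable fun k : ℕ => (1 + |(k : ℝ)|) ^ (-β) := by
      have := (summable_nat_add_iff 1).2 (Real.summable_nat_rpow.2 (by linarith : -β < -1))
      refine this.congr fun k => ?_
      rw [Nat.abs_cast]; push_cast; rw [add_comm]
    refine Summable.of_nat_of_neg (by simpa using h0) (by simpa using h0)
  set S : ℝ := ∑' k : ℤ, (1 + |(k : ℝ)|) ^ (-β)
  have hterm : ∀ m : Cell n, (1 + ‖m‖) ^ (-((n : ℝ) + γ)) ≤ ∏ c, (1 + |(m c : ℝ)|) ^ (-β) := by
    intro m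
    have e : (1 + ‖m‖) ^ (-((n : ℝ) + γ)) = ∏ _c : Fin n, (1 + ‖m‖) ^ (-β) := by
      rw [Finset.prod_const, Finset.card_univ, Fintype.card_fin, ← Real.rpow_natCast,
        ← Real.rpow_mul (by positivity)]
      congr 1
      rw [hβ]; field_simp
    rw [e]
    refine Finset.prod_le_prod (fun _ _ => by positivity) fun c _ => ?_
    exact Real.rpow_le_rpow_of_nonpos (by positivity) (by linarith [abs_le_norm_cell m c])
      (by linarith)
  refine lt_of_le_of_lt ?_ (ENNReal.ofReal_lt_top (r := S ^ n))
  rw [ENNReal.tsum_eq_iSup_sum]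
  refine iSup_le fun s => ?_
  rw [← ENNReal.ofReal_sum_of_nonneg fun _ _ => by positivity]
  refine ENNReal.ofReal_le_ofReal ?_
  classical
  calc _ ≤ ∑ m ∈ s, ∏ c, (1 + |(m c : ℝ)|) ^ (-β) := Finset.sum_le_sum fun m _ => hterm m
    _ ≤ ∑ m ∈ Fintype.piFinset fun c => (s.image fun m : Cell n => m c), ∏ c, (1 + |(m c : ℝ)|) ^ (-β) := by
        refine Finset.sum_le_sum_of_subset_of_nonneg (fun m hm => ?_) fun _ _ _ => by positivity
        exact Fintype.mem_piFinset.2 fun c => Finset.mem_image_of_mem _ hm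
    _ = ∏ c, ∑ k ∈ (s.image fun m : Cell n => m c), (1 + |(k : ℝ)|) ^ (-β) :=
        (Finset.prod_univ_sum (fun c => s.image fun m : Cell n => m c) fun _ k => (1 + |(k : ℝ)|) ^ (-β)).symm
    _ ≤ ∏ _c : Fin n, S := Finset.prod_le_prod (fun _ _ => Finset.sum_nonneg fun _ _ => by
        positivity) fun c _ => hS.sum_le_tsum _ fun _ _ => by positivity
    _ = S ^ n := by simp

/-- The number of generations after which a rectangle and its translate by `m` may have a common
ancestor. -/
def ancestorLevel (m : Cell n) : ℕ := Nat.log 2 ⌈‖m‖⌉₊ + 1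

lemma abs_le_two_pow (m : Cell n) (c : Fin n) : |m c| ≤ 2 ^ ancestorLevel m := by
  have h1 : (|m c| : ℝ) ≤ (2 ^ ancestorLevel m : ℕ) :=
    (abs_le_norm_cell m c).trans ((Nat.le_ceil _).trans
      (by exact_mod_cast (Nat.lt_pow_succ_log_self one_lt_two _).le))
  exact_mod_cast h1

/-- The weights that bound the coefficients of Calderón–Zygmund matrices. -/
def czWeight (α : ℝ) (C : ℝ≥0) (m : Cell n) : ℝ≥0 := C * (1 + ‖m‖₊) ^ (-((n : ℝ) + α))

lemma tsum_czWeight_lt_top [NeZero n] {α : ℝ} (hα : 0 < α) (C : ℝ≥0) :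
    ∑' m : Cell n, 2 ^ n * (96 * (n * (ancestorLevel m + 2) + 1 : ℕ)) *
      (czWeight α C m : ℝ≥0∞) < ∞ := by
  obtain ⟨K, hK0, hK⟩ : ∃ K : ℝ, 0 ≤ K ∧ ∀ m : Cell n,
      ((n * (ancestorLevel m + 2) + 1 : ℕ) : ℝ) ≤ K * (1 + ‖m‖) ^ (α / 2) := by
    have hlog2 := Real.log_pos one_lt_two
    refine ⟨n * (3 + (2 ^ (α / 2)) / (α / 2) / Real.log 2) + 1, by positivity, fun m => ?_⟩
    have hone : 1 ≤ (1 + ‖m‖) ^ (α / 2) :=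
      Real.one_le_rpow (by linarith [norm_nonneg m]) (by positivity)
    have h1 : (Nat.log 2 ⌈‖m‖⌉₊ : ℝ) ≤ (2 ^ (α / 2)) / (α / 2) / Real.log 2 *
        (1 + ‖m‖) ^ (α / 2) := by
      have h2 := Real.natLog_le_logb ⌈‖m‖⌉₊ 2
      have h3 := Real.log_le_rpow_div (x := (⌈‖m‖⌉₊ : ℝ)) (Nat.cast_nonneg _)
        (half_pos hα)
      have h4 : (⌈‖m‖⌉₊ : ℝ) ≤ 2 * (1 + ‖m‖) := by
        linarith [(Nat.ceil_lt_add_one (norm_nonneg m)).le, norm_nonneg m]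
      rw [Real.logb] at h2
      push_cast at h2
      calc _ ≤ Real.log ⌈‖m‖⌉₊ / Real.log 2 := h2
        _ ≤ ((2 * (1 + ‖m‖)) ^ (α / 2) / (α / 2)) / Real.log 2 := by
            gcongr
            refine h3.trans ?_
            gcongr
        _ = _ := by rw [Real.mul_rpow (by norm_num) (by positivity)]; ring
    rw [ancestorLevel]
    push_cast
    nlinarith [mul_le_mul_of_nonneg_left h1 (Nat.cast_nonneg (α := ℝ) n),
      mul_le_mul_of_nonneg_left hone (Nat.cast_nonneg (α := ℝ) n)]
  have hle : ∀ m : Cell n, 2 ^ n * (96 * (n * (ancestorLevel m + 2) + 1 : ℕ)) *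
      (czWeight α C m : ℝ≥0∞) ≤ ENNReal.ofReal (2 ^ n * 96 * K * C) *
        ENNReal.ofReal ((1 + ‖m‖) ^ (-((n : ℝ) + α / 2))) := by
    intro m
    have e : 2 ^ n * (96 * (n * (ancestorLevel m + 2) + 1 : ℕ)) * (czWeight α C m : ℝ≥0∞)
        = ENNReal.ofReal (2 ^ n * (96 * (n * (ancestorLevel m + 2) + 1 : ℕ)) * czWeight α C m) := by
      rw [ENNReal.ofReal_mul (by positivity), ENNReal.ofReal_mul (by positivity),
        ENNReal.ofReal_mul (by positivity), ENNReal.ofReal_natCast, ENNReal.ofReal_coe_nnreal,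
        ENNReal.ofReal_pow (by positivity)]
      norm_num
    rw [e, ← ENNReal.ofReal_mul (by positivity)]
    refine ENNReal.ofReal_le_ofReal ?_
    have h2 : (1 + ‖m‖) ^ (-((n : ℝ) + α / 2))
        = (1 + ‖m‖) ^ (α / 2) * (1 + ‖m‖) ^ (-((n : ℝ) + α)) := by
      rw [← Real.rpow_add (by positivity)]; congr 1; ring
    have h3 : (czWeight α C m : ℝ) = C * (1 + ‖m‖) ^ (-((n : ℝ) + α)) := by
      rw [czWeight]; push_cast; rfl
    rw [h2, h3]
    calc _ ≤ 2 ^ n * (96 * (K * (1 + ‖m‖) ^ (α / 2))) * (C * (1 + ‖m‖) ^ (-((n : ℝ) + α))) := by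
          gcongr; exact hK m
      _ = _ := by ring
  refine (ENNReal.tsum_le_tsum hle).trans_lt ?_
  rw [ENNReal.tsum_mul_left]
  exact ENNReal.mul_lt_top ENNReal.ofReal_lt_top (tsum_norm_cell_lt_top (half_pos hα))

end Weights

/-! ### From smooth matrices to dyadic conditions -/

section CellMatrices

variable {n : ℕ} {𝕜 : Type*} [RCLike 𝕜]

/-- The indices in `[-k, k)ⁿ`. -/
def centeredBox (n k : ℕ) : Finset (Cell n) := Fintype.piFinset fun _ => Finset.Ico (-(k : ℤ)) k

/-- The conditions on a matrix that reflect the hypotheses on a Calderón–Zygmund operator: bounded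
averages over congruent dyadic rectangles, smoothness in both indices away from the diagonal, and
vanishing of the matrix and of its transpose on constants. -/
structure IsCellCZ (α : ℝ) (C₀ C₁ : ℝ≥0) (a : Cell n → Cell n → 𝕜) : Prop where
  size : ∀ s u m, ‖blockSum a (rect s u) (rect s (gridPos u s m))‖ ≤ C₀ * rectCard n s
  smooth : ∀ (i j : Cell n) (c c' : Fin n) (r : ℤ), 2 * |(r : ℝ)| < |(i c' : ℝ) - j c'| - 1 →
    ‖a i j - a (i + Pi.single c r) j‖
      ≤ C₁ * |(r : ℝ)| ^ α / (|(i c' : ℝ) - j c'| - 1) ^ ((n : ℝ) + α)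
  adjoint_smooth : ∀ (i j : Cell n) (c c' : Fin n) (r : ℤ),
    2 * |(r : ℝ)| < |(i c' : ℝ) - j c'| - 1 →
    ‖a i j - a i (j + Pi.single c r)‖
      ≤ C₁ * |(r : ℝ)| ^ α / (|(i c' : ℝ) - j c'| - 1) ^ ((n : ℝ) + α)
  vanish : ∀ (P : Finset (Cell n)) (v : Cell n), Tendsto (fun k : ℕ =>
    ∑ j ∈ centeredBox n k, ∑ i ∈ P, (a i j - a (i + v) j)) atTop (𝓝 0)
  adjoint_vanish : ∀ (P : Finset (Cell n)) (v : Cell n), Tendsto (fun k : ℕ =>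
    ∑ i ∈ centeredBox n k, ∑ j ∈ P, (a i j - a i (j + v))) atTop (𝓝 0)

lemma blockSum_transpose (a : Cell n → Cell n → 𝕜) (P Q : Finset (Cell n)) :
    blockSum (fun i j => a j i) P Q = blockSum a Q P := Finset.sum_comm

variable {α : ℝ} {C₀ C₁ : ℝ≥0} {a : Cell n → Cell n → 𝕜}

lemma IsCellCZ.transpose (h : IsCellCZ α C₀ C₁ a) : IsCellCZ α C₀ C₁ fun i j => a j i where
  size s u m := by
    have := h.size s (gridPos u s m) (-m)
    rwa [gridPos_neg_gridPos, ← blockSum_transpose] at this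
  smooth i j c c' r hr := by
    rw [abs_sub_comm (i c' : ℝ)] at hr ⊢
    exact h.adjoint_smooth j i c c' r hr
  adjoint_smooth i j c c' r hr := by
    rw [abs_sub_comm (i c' : ℝ)] at hr ⊢
    exact h.smooth j i c c' r hr
  vanish := h.adjoint_vanish
  adjoint_vanish := h.vanish

lemma haarBlock_transpose [NeZero n] (a : Cell n → Cell n → 𝕜) (σ τ : ℝ) (s : ℕ) (u v : Cell n) :
    haarBlock (fun i j => a j i) σ τ s u v = haarBlock a τ σ s v u := by
  simp only [haarBlock, blockSum_transpose]
  rw [mul_comm σ τ]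
  congr 1; ring

lemma sum_rect_add {M : Type*} [AddCommMonoid M] (s : ℕ) (u v : Cell n) (g : Cell n → M) :
    ∑ i ∈ rect s (u + v), g i = ∑ i ∈ rect s u, g (i + v) := by
  refine Finset.sum_nbij' (fun i => i - v) (fun i => i + v) (fun i hi => ?_) (fun i hi => ?_)
    (by simp) (by simp) (by simp)
  · rw [mem_rect] at hi ⊢
    intro c
    have := hi c
    simp only [Pi.add_apply, Pi.sub_apply] at this ⊢
    omega
  · rw [mem_rect] at hi ⊢
    intro c
    have := hi c
    simp only [Pi.add_apply] at this ⊢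
    omega

lemma exists_abs_eq_norm [NeZero n] (m : Cell n) : ∃ c, |(m c : ℝ)| = ‖m‖ := by
  by_contra! h
  have h0 : 0 < ‖m‖ := (abs_nonneg _).trans_lt ((abs_le_norm_cell m 0).lt_of_ne (h 0))
  refine lt_irrefl ‖m‖ ((pi_norm_lt_iff h0).2 fun c => ?_)
  rw [Int.norm_eq_abs]
  exact (abs_le_norm_cell m c).lt_of_ne (h c)

variable [NeZero n]

lemma haarBlock_neg_eq (a : Cell n → Cell n → 𝕜) (τ : ℝ) (s : ℕ) (u v : Cell n) :
    haarBlock a (-1) τ s u v = (rectCard n (s + 1) : ℝ)⁻¹ •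
      (∑ j ∈ rect s v, ∑ i ∈ rect s u, (a i j - a (i + halfShift s) j)
        + τ • ∑ j ∈ rect s (v + halfShift s), ∑ i ∈ rect s u, (a i j - a (i + halfShift s) j)) := by
  simp only [haarBlock, blockSum]
  rw [sum_rect_add s u, sum_rect_add s u]
  simp only [Finset.sum_sub_distrib]
  rw [Finset.sum_comm (t := rect s u), Finset.sum_comm (t := rect s u),
    Finset.sum_comm (t := rect s u), Finset.sum_comm (t := rect s u)]
  module

lemma halfShift_side_le (s : ℕ) :
    side s (axis s : Fin n) ≤ 2 ^ ((s + 1) / n) := by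
  have h1 := sideExp_succ s (axis s : Fin n)
  rw [if_pos rfl] at h1
  have h2 : sideExp (s + 1) (axis s : Fin n) ≤ (s + 1) / n + 1 := by
    have hc := (axis s : Fin n).isLt
    rw [sideExp, ← Nat.add_div_right _ (NeZero.pos n)]
    exact Nat.div_le_div_right (by omega)
  rw [side]
  exact pow_le_pow_right₀ (by norm_num) (by omega)

omit [NeZero n] in
lemma le_side (s : ℕ) (c : Fin n) : (2 : ℤ) ^ (s / n) ≤ side s c :=
  pow_le_pow_right₀ (by norm_num) (Nat.div_le_div_right (Nat.le_add_right _ _))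

lemma rectCard_le (s : ℕ) : (rectCard n s : ℝ) ≤ 2 ^ n * (2 ^ (s / n)) ^ n := by
  rw [rectCard_eq, ← pow_mul, ← pow_add]
  push_cast
  refine pow_le_pow_right₀ (by norm_num) ?_
  have := Nat.div_add_mod s n
  have := Nat.mod_lt s (NeZero.pos n)
  rw [mul_comm (s / n)]
  omega

omit [NeZero n] in
lemma le_abs_sub_of_mem {s : ℕ} {u m i j : Cell n} (hi : i ∈ rect s u)
    (hj : j ∈ rect s (gridPos u s m)) (c : Fin n) :
    (|(m c : ℝ)| - 1) * side s c ≤ |(i c : ℝ) - j c| - 1 := by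
  have h1 := mem_rect.1 hi c
  have h2 := mem_rect.1 hj c
  rw [gridPos] at h2
  have h3 := side_pos s c
  have key : (|m c| - 1) * side s c ≤ |i c - j c| - 1 := by
    rcases abs_cases (m c) with ⟨h, _⟩ | ⟨h, _⟩ <;>
    rcases abs_cases (i c - j c) with ⟨h', _⟩ | ⟨h', _⟩ <;> rw [h, h'] <;> nlinarith
  exact_mod_cast key

/-- For distant rectangles the smoothness of the matrix applies: the two halves of the first
rectangle are translates by at most `L = 2 ^ ((s + 1) / n)`, and the distance to the second one is
at least `(‖m‖ - 1) * L`. -/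
lemma IsCellCZ.haarBlock_le_of_far (h : IsCellCZ α C₀ C₁ a) (hα : 0 < α) (s : ℕ) (u m : Cell n)
    {τ : ℝ} (hτ : τ = 1 ∨ τ = -1) (hm : 6 ≤ ‖m‖) :
    ‖haarBlock a (-1) τ s u (gridPos u (s + 1) m)‖
      ≤ 2 ^ n * C₁ * (‖m‖ - 1) ^ (-((n : ℝ) + α)) := by
  set v := gridPos u (s + 1) m
  set L : ℝ := 2 ^ ((s + 1) / n) with hL
  have hL0 : 0 < L := by positivity
  obtain ⟨c', hc'⟩ := exists_abs_eq_norm m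
  have hr : |((side s (axis s : Fin n) : ℤ) : ℝ)| ≤ L := by
    rw [abs_of_pos (by exact_mod_cast side_pos s _)]
    have := halfShift_side_le (n := n) s
    rw [hL]
    exact_mod_cast this
  have hterm : ∀ i ∈ rect s u, ∀ j ∈ rect (s + 1) v, ‖a i j - a (i + halfShift s) j‖
      ≤ C₁ * L ^ α / ((‖m‖ - 1) * L) ^ ((n : ℝ) + α) := by
    intro i hi j hj
    have h1 := le_abs_sub_of_mem (mem_rect_succ.2 (Or.inl hi)) hj c'
    rw [hc'] at h1
    have h2 : (‖m‖ - 1) * L ≤ |(i c' : ℝ) - j c'| - 1 := by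
      refine le_trans ?_ h1
      gcongr
      · linarith
      · rw [hL]; exact_mod_cast le_side (s + 1) c'
    have h3 : 0 < (‖m‖ - 1) * L := by have : 0 < ‖m‖ - 1 := by linarith
                                      positivity
    refine (h.smooth i j (axis s) c' _ (lt_of_lt_of_le ?_ h2)).trans ?_
    · nlinarith
    · gcongr
  have hcard : (rectCard n (s + 1) : ℝ) = 2 * rectCard n s := by
    rw [rectCard_succ]; push_cast; ring
  have hpos : (0 : ℝ) < rectCard n s := by exact_mod_cast rectCard_pos n s
  have hsum : ∀ Q ⊆ rect (s + 1) v,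
      ‖∑ j ∈ Q, ∑ i ∈ rect s u, (a i j - a (i + halfShift s) j)‖
      ≤ Q.card * (rectCard n s * (C₁ * L ^ α / ((‖m‖ - 1) * L) ^ ((n : ℝ) + α))) := by
    intro Q hQ
    refine (norm_sum_le_of_le _ fun j hj => norm_sum_le_of_le _ fun i hi =>
      hterm i hi j (hQ hj)).trans (le_of_eq ?_)
    simp only [Finset.sum_const, card_rect, nsmul_eq_mul]
  have e1 := hsum (rect s v) fun j hj => mem_rect_succ.2 (Or.inl hj)
  have e2 := hsum (rect s (v + halfShift s)) fun j hj => mem_rect_succ.2 (Or.inr hj)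
  rw [card_rect] at e1 e2
  rw [haarBlock_neg_eq, norm_smul, norm_inv, Real.norm_natCast, hcard]
  have hτ' : ‖τ‖ = 1 := by rcases hτ with rfl | rfl <;> simp
  set E := C₁ * L ^ α / ((‖m‖ - 1) * L) ^ ((n : ℝ) + α) with hE
  calc _ ≤ (2 * (rectCard n s : ℝ))⁻¹ *
        (rectCard n s * (rectCard n s * E) + rectCard n s * (rectCard n s * E)) := by
        gcongr
        refine (norm_add_le _ _).trans (add_le_add e1 ?_)
        rwa [norm_smul, hτ', one_mul]
    _ = rectCard n s * E := by field_simp; ring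
    _ ≤ (2 ^ n * L ^ n) * E := by
        have : 0 ≤ E := by
          have : 0 < ‖m‖ - 1 := by linarith
          positivity
        gcongr
        refine le_trans ?_ (rectCard_le (n := n) (s + 1))
        rw [hcard]; linarith
    _ = _ := by
        have h4 : 0 < ‖m‖ - 1 := by linarith
        rw [hE, Real.mul_rpow h4.le hL0.le, Real.rpow_neg h4.le, Real.rpow_add hL0,
          Real.rpow_natCast]
        have := Real.rpow_pos_of_pos hL0 α
        field_simp

lemma exists_gridPos_add_halfShift (s : ℕ) (u m : Cell n) (b b' : ℤ) :
    ∃ m', gridPos u (s + 1) m + b • halfShift s = gridPos (u + b' • halfShift s) s m' := by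
  refine ⟨fun c => if c = axis s then 2 * m c + b - b' else m c, ?_⟩
  ext c
  simp only [gridPos, Pi.add_apply, Pi.smul_apply, side_succ, halfShift, smul_eq_mul]
  split_ifs with hc
  · subst hc; rw [Pi.single_eq_same]; ring
  · rw [Pi.single_eq_of_ne hc]; ring

/-- The bound without decay, from the averages over the four pairs of halves. -/
lemma IsCellCZ.haarBlock_le (h : IsCellCZ α C₀ C₁ a) (s : ℕ) (u m : Cell n) {σ τ : ℝ}
    (hσ : σ = 1 ∨ σ = -1) (hτ : τ = 1 ∨ τ = -1) :
    ‖haarBlock a σ τ s u (gridPos u (s + 1) m)‖ ≤ 2 * C₀ := by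
  have key : ∀ b b' : ℤ, ‖blockSum a (rect s (u + b' • halfShift s))
      (rect s (gridPos u (s + 1) m + b • halfShift s))‖ ≤ C₀ * rectCard n s := by
    intro b b'
    obtain ⟨m', hm'⟩ := exists_gridPos_add_halfShift s u m b b'
    rw [hm']
    exact h.size s _ m'
  have h00 := key 0 0
  have h01 := key 0 1
  have h10 := key 1 0
  have h11 := key 1 1
  simp only [zero_smul, one_smul, add_zero] at h00 h01 h10 h11
  have hσ' : ‖σ‖ = 1 := by rcases hσ with rfl | rfl <;> simp
  have hτ' : ‖τ‖ = 1 := by rcases hτ with rfl | rfl <;> simp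
  have hcard : (rectCard n (s + 1) : ℝ) = 2 * rectCard n s := by
    rw [rectCard_succ]; push_cast; ring
  have hpos : (0 : ℝ) < rectCard n s := by exact_mod_cast rectCard_pos n s
  rw [haarBlock, norm_smul, norm_inv, Real.norm_natCast, hcard]
  calc _ ≤ (2 * (rectCard n s : ℝ))⁻¹ * (C₀ * rectCard n s + C₀ * rectCard n s
        + C₀ * rectCard n s + C₀ * rectCard n s) := by
        gcongr
        refine (norm_add_le _ _).trans (add_le_add ((norm_add_le _ _).trans
          (add_le_add ((norm_add_le _ _).trans (add_le_add h00 ?_)) ?_)) ?_)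
        · rwa [norm_smul, hσ', one_mul]
        · rwa [norm_smul, hτ', one_mul]
        · rwa [norm_smul, norm_mul, hσ', hτ', one_mul, one_mul]
    _ = _ := by field_simp; ring

/-- The constant in the weights of a Calderón–Zygmund matrix. The first summand is for `‖m‖ < 6`,
where `1 + ‖m‖ ≤ 7`, and the second for `6 ≤ ‖m‖`, where `1 + ‖m‖ ≤ 2 * (‖m‖ - 1)`. -/
def czConst (n : ℕ) (α : ℝ) (C₀ C₁ : ℝ≥0) : ℝ≥0 :=
  2 * C₀ * 7 ^ ((n : ℝ) + α) + 2 ^ n * C₁ * 2 ^ ((n : ℝ) + α)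

lemma IsCellCZ.haarBlock_le_weight (h : IsCellCZ α C₀ C₁ a) (hα : 0 < α) (s : ℕ) (u m : Cell n)
    {τ : ℝ} (hτ : τ = 1 ∨ τ = -1) :
    ‖haarBlock a (-1) τ s u (gridPos u (s + 1) m)‖ ≤ czWeight α (czConst n α C₀ C₁) m := by
  have e : (czWeight α (czConst n α C₀ C₁) m : ℝ)
      = (2 * C₀ * 7 ^ ((n : ℝ) + α) + 2 ^ n * C₁ * 2 ^ ((n : ℝ) + α))
        * (1 + ‖m‖) ^ (-((n : ℝ) + α)) := by
    rw [czWeight, czConst]; push_cast; rfl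
  have hm0 := norm_nonneg m
  have hq : 0 < (1 + ‖m‖) ^ (-((n : ℝ) + α)) := by positivity
  rw [e, add_mul]
  rcases lt_or_ge ‖m‖ 6 with hm | hm
  · refine (h.haarBlock_le s u m (Or.inr rfl) hτ).trans ((?_ : (2 * C₀ : ℝ) ≤ _).trans
      (le_add_of_nonneg_right (by positivity)))
    have h1 : 1 ≤ (7 : ℝ) ^ ((n : ℝ) + α) * (1 + ‖m‖) ^ (-((n : ℝ) + α)) := by
      rw [Real.rpow_neg (by positivity), ← div_eq_mul_inv, ← Real.div_rpow (by norm_num)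
        (by positivity)]
      refine Real.one_le_rpow ?_ (by positivity)
      rw [le_div_iff₀ (by positivity)]; linarith
    rw [mul_assoc]
    exact le_mul_of_one_le_right (by positivity) h1
  · refine (h.haarBlock_le_of_far hα s u m hτ hm).trans (le_trans ?_
      (le_add_of_nonneg_left (by positivity)))
    rw [mul_assoc (2 ^ n * (C₁ : ℝ))]
    gcongr
    rw [Real.rpow_neg (by linarith), Real.rpow_neg (by positivity), ← div_eq_mul_inv,
      ← one_div, div_le_div_iff₀ (Real.rpow_pos_of_pos (by linarith) _) (by positivity), one_mul,
      ← Real.mul_rpow (by norm_num) (by linarith)]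
    gcongr
    linarith

/-- The column sums of a Haar function are absolutely summable. -/
lemma IsCellCZ.summable_sum_sub (h : IsCellCZ α C₀ C₁ a) (hα : 0 < α) (s : ℕ) (u : Cell n) :
    Summable fun j => ∑ i ∈ rect s u, (a i j - a (i + halfShift s) j) := by
  set σ : ℤ := side s (axis s : Fin n) with hσ
  obtain ⟨W, hWσ, hW⟩ : ∃ W : ℝ, |(σ : ℝ)| ≤ W ∧ ∀ i ∈ rect s u, ‖i - u‖ ≤ W := by
    obtain ⟨W, hW⟩ := ((rect s u).image fun i => ‖i - u‖).exists_le
    exact ⟨max |(σ : ℝ)| W, le_max_left _ _,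
      fun i hi => (hW _ (Finset.mem_image_of_mem _ hi)).trans (le_max_right _ _)⟩
  have hW0 : 0 ≤ W := (abs_nonneg _).trans hWσ
  set g : Cell n → ℝ := fun m => (1 + ‖m‖) ^ (-((n : ℝ) + α)) with hg
  have hgs : Summable g := by
    have := ENNReal.summable_toReal (tsum_norm_cell_lt_top (n := n) hα).ne
    refine this.congr fun m => ENNReal.toReal_ofReal (by positivity)
  have hgs' : Summable fun j => rectCard n s * (C₁ * |(σ : ℝ)| ^ α * 2 ^ ((n : ℝ) + α)) *
      g (j - u) := ((Equiv.subRight u).summable_iff.2 hgs).mul_left _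
  refine Summable.of_norm_bounded_eventually hgs' ?_
  have hfin : {j : Cell n | ‖j - u‖ < 4 * W + 4}.Finite := by
    refine ((box n ⌈4 * W + 4⌉₊).finite_toSet.image (· + u)).subset fun j hj => ⟨j - u, ?_, by simp⟩
    rw [Finset.mem_coe, mem_box]
    intro c
    have h1 : |((j - u) c : ℝ)| ≤ (⌈4 * W + 4⌉₊ : ℝ) :=
      (abs_le_norm_cell _ c).trans ((le_of_lt hj).trans (Nat.le_ceil _))
    exact_mod_cast h1
  filter_upwards [hfin.compl_mem_cofinite] with j hj
  have hj' : 4 * W + 4 ≤ ‖j - u‖ := not_lt.1 hj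
  obtain ⟨c', hc'⟩ := exists_abs_eq_norm (j - u)
  have hone : ∀ i ∈ rect s u, ‖a i j - a (i + halfShift s) j‖
      ≤ C₁ * |(σ : ℝ)| ^ α * 2 ^ ((n : ℝ) + α) * g (j - u) := ?_
  · refine (norm_sum_le_of_le _ hone).trans (le_of_eq ?_)
    rw [Finset.sum_const, card_rect, nsmul_eq_mul]; ring
  intro i hi
  have h1 : ‖j - u‖ - W - 1 ≤ |(i c' : ℝ) - j c'| - 1 := by
    have h2 := (abs_le_norm_cell (i - u) c').trans (hW i hi)
    have h3 := abs_sub_abs_le_abs_sub ((j - u) c' : ℝ) ((i - u) c' : ℝ)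
    rw [hc'] at h3
    have h4 : (((j - u) c' : ℤ) : ℝ) - (((i - u) c' : ℤ) : ℝ) = -((i c' : ℝ) - j c') := by
      simp only [Pi.sub_apply]; push_cast; ring
    rw [h4, abs_neg] at h3
    linarith
  have h5 : (1 + ‖j - u‖) / 2 ≤ |(i c' : ℝ) - j c'| - 1 := by linarith
  refine (h.smooth i j (axis s) c' σ (by linarith)).trans ?_
  rw [mul_assoc (C₁ * |(σ : ℝ)| ^ α), div_eq_mul_inv]
  gcongr
  calc ((|(i c' : ℝ) - j c'| - 1) ^ ((n : ℝ) + α))⁻¹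
      ≤ (((1 + ‖j - u‖) / 2) ^ ((n : ℝ) + α))⁻¹ := by gcongr
    _ = 2 ^ ((n : ℝ) + α) * g (j - u) := by
        rw [hg]
        simp only
        rw [Real.div_rpow (by positivity) (by norm_num), Real.rpow_neg (by positivity), inv_div,
          div_eq_mul_inv]

omit [NeZero n] in
lemma tendsto_centeredBox : Tendsto (centeredBox n) atTop atTop := by
  refine tendsto_atTop_finset_of_monotone (fun k k' hk i hi => ?_) fun i => ?_
  · simp only [centeredBox, Fintype.mem_piFinset, Finset.mem_Ico] at hi ⊢
    intro c; have := hi c; omega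
  · obtain ⟨M, hM⟩ := exists_subset_box {i} (Set.finite_singleton i)
    refine ⟨M + 1, ?_⟩
    have := mem_box.1 (hM M le_rfl i rfl)
    simp only [centeredBox, Fintype.mem_piFinset, Finset.mem_Ico]
    intro c; have := abs_le.1 (this c); omega

/-- The matrix also vanishes on constants if these are exhausted by rectangles of level `s + 1`
instead of centered cubes: by absolute summability the order of summation is irrelevant. -/
lemma IsCellCZ.tendsto_sum_haarBlock (h : IsCellCZ α C₀ C₁ a) (hα : 0 < α) (s : ℕ) (u : Cell n) :
    Tendsto (fun M : ℕ => ∑ m ∈ box n M, haarBlock a (-1) 1 s u (gridPos u (s + 1) m))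
      atTop (𝓝 0) := by
  classical
  set b : Cell n → 𝕜 := fun j => ∑ i ∈ rect s u, (a i j - a (i + halfShift s) j) with hb
  obtain ⟨S, hS⟩ := h.summable_sum_sub hα s u
  have hS0 : S = 0 := tendsto_nhds_unique (hS.comp tendsto_centeredBox)
    (h.vanish (rect s u) (halfShift s))
  rw [hS0] at hS
  have e : ∀ M : ℕ, ∑ m ∈ box n M, haarBlock a (-1) 1 s u (gridPos u (s + 1) m)
      = (rectCard n (s + 1) : ℝ)⁻¹ •
        ∑ j ∈ (box n M).biUnion fun m => rect (s + 1) (gridPos u (s + 1) m), b j := by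
    intro M
    rw [Finset.sum_biUnion, Finset.smul_sum]
    · refine Finset.sum_congr rfl fun m _ => ?_
      rw [haarBlock_neg_eq, one_smul, sum_rect_succ]
    · intro m _ m' _ hmm
      refine Finset.disjoint_left.2 fun j hj hj' => hmm ?_
      rw [← mem_rect_gridPos.1 hj, ← mem_rect_gridPos.1 hj']
  simp only [e]
  have ht : Tendsto (fun M : ℕ => (box n M).biUnion fun m => rect (s + 1) (gridPos u (s + 1) m))
      atTop atTop := by
    refine tendsto_atTop_finset_of_monotone (fun M M' hM => ?_) fun j => ?_
    · refine Finset.biUnion_subset_biUnion_of_subset_left _ fun m hm => ?_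
      rw [mem_box] at hm ⊢
      intro c; have := hm c; omega
    · obtain ⟨M, hM⟩ := exists_subset_box {blk u (s + 1) j} (Set.finite_singleton _)
      exact ⟨M, Finset.mem_biUnion.2 ⟨_, hM M le_rfl _ rfl, mem_rect_gridPos.2 rfl⟩⟩
  have := (hS.comp ht).const_smul (rectCard n (s + 1) : ℝ)⁻¹
  rwa [smul_zero] at this

lemma IsCellCZ.isDyadicCZ (h : IsCellCZ α C₀ C₁ a) (hα : 0 < α) :
    IsDyadicCZ a C₀ (czWeight α (czConst n α C₀ C₁)) where
  size := h.size
  decay s u m σ τ hσ hτ hστ := by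
    by_cases h1 : σ = -1
    · subst h1
      exact h.haarBlock_le_weight hα s u m hτ
    · have h2 : τ = -1 := hστ.resolve_left h1
      subst h2
      have := h.transpose.haarBlock_le_weight hα s (gridPos u (s + 1) m) (-m) hσ
      rw [gridPos_neg_gridPos, haarBlock_transpose] at this
      refine this.trans (le_of_eq ?_)
      rw [czWeight, nnnorm_neg, ← czWeight]
  neg m := by rw [czWeight, nnnorm_neg, ← czWeight]
  vanish s u := h.tendsto_sum_haarBlock hα s u
  adjoint_vanish s u := by
    have := h.transpose.tendsto_sum_haarBlock hα s u
    simpa only [haarBlock_transpose] using this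

end CellMatrices

/-! ### Cells -/

section Cells

variable {n : ℕ} {δ : ℝ}

/-- The lower corner of the cell with index `i`, for the mesh size `δ`. -/
def cellCorner (δ : ℝ) (i : Cell n) : EuclideanSpace ℝ (Fin n) := WithLp.toLp 2 fun c => δ * i c

/-- The cell with index `i`. -/
def cell (δ : ℝ) (i : Cell n) : Set (EuclideanSpace ℝ (Fin n)) := cube (cellCorner δ i) δ

/-- The index of the cell that contains `x`. -/
def cellOf (δ : ℝ) (x : EuclideanSpace ℝ (Fin n)) : Cell n := fun c => ⌊x c / δ⌋

lemma cellCorner_apply (δ : ℝ) (i : Cell n) (c : Fin n) : cellCorner δ i c = δ * i c := rfl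

lemma le_cellOf_iff (hδ : 0 < δ) (x : EuclideanSpace ℝ (Fin n)) (c : Fin n) (p : ℤ) :
    p ≤ cellOf δ x c ↔ δ * p ≤ x c := by
  rw [cellOf, Int.le_floor, le_div_iff₀ hδ, mul_comm]

lemma cellOf_lt_iff (hδ : 0 < δ) (x : EuclideanSpace ℝ (Fin n)) (c : Fin n) (p : ℤ) :
    cellOf δ x c < p ↔ x c < δ * p := by
  rw [← not_le, le_cellOf_iff hδ, not_le]

lemma mem_cell (hδ : 0 < δ) {x : EuclideanSpace ℝ (Fin n)} {i : Cell n} :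
    x ∈ cell δ i ↔ cellOf δ x = i := by
  have : ∀ c, (cellCorner δ i c ≤ x c ∧ x c < cellCorner δ i c + δ) ↔ cellOf δ x c = i c := by
    intro c
    have h1 := le_cellOf_iff hδ x c (i c)
    have h2 := cellOf_lt_iff hδ x c (i c + 1)
    push_cast at h2
    rw [cellCorner_apply, ← h1, show δ * i c + δ = δ * ((i c : ℝ) + 1) by ring, ← h2]
    omega
  exact (forall_congr' this).trans funext_iff.symm

lemma measurable_cellOf : Measurable (cellOf (n := n) δ) := by
  refine measurable_pi_lambda _ fun c => ?_
  have : Measurable fun x : EuclideanSpace ℝ (Fin n) => x c / δ := by fun_prop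
  exact Int.measurable_floor.comp this

lemma measurableSet_cell (i : Cell n) : MeasurableSet (cell δ i) := measurableSet_cube _ _

lemma volume_box (a b : Fin n → ℝ) :
    volume {x : EuclideanSpace ℝ (Fin n) | ∀ c, a c ≤ x c ∧ x c < b c}
      = ∏ c, ENNReal.ofReal (b c - a c) := by
  rw [← Real.volume_pi_Ico, ← (PiLp.volume_preserving_ofLp (Fin n)).measure_preimage
    (MeasurableSet.univ_pi fun _ => measurableSet_Ico).nullMeasurableSet]
  congr 1
  ext x
  simp

lemma volume_cube (a : EuclideanSpace ℝ (Fin n)) (l : ℝ) :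
    volume (cube a l) = ENNReal.ofReal l ^ n := by
  rw [cube, volume_box a fun c => a c + l]
  simp

lemma volume_cell (i : Cell n) : volume (cell δ i) = ENNReal.ofReal δ ^ n := volume_cube _ _

lemma volume_hyperplane (c : Fin n) (r : ℝ) :
    volume {x : EuclideanSpace ℝ (Fin n) | x c = r} = 0 := by
  have := (PiLp.volume_preserving_ofLp (Fin n)).quasiMeasurePreserving.preimage_null
    (Measure.pi_hyperplane (fun _ : Fin n => (volume : Measure ℝ)) c r)
  exact this

lemma abs_sub_le_norm (x y : EuclideanSpace ℝ (Fin n)) (c : Fin n) : |x c - y c| ≤ ‖x - y‖ := by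
  have := PiLp.norm_apply_le (x - y) c
  simpa using this

/-- Points of cells whose indices differ by `k` in some coordinate have distance at least
`δ (k - 1)`. -/
lemma le_norm_sub_of_mem_cell {i j : Cell n} {x y : EuclideanSpace ℝ (Fin n)}
    (hx : x ∈ cell δ i) (hy : y ∈ cell δ j) (c : Fin n) :
    δ * (|(i c : ℝ) - j c| - 1) ≤ ‖x - y‖ := by
  refine le_trans ?_ (abs_sub_le_norm x y c)
  have h1 := hx c
  have h2 := hy c
  rw [cellCorner_apply] at h1 h2
  rcases abs_cases ((i c : ℝ) - j c) with ⟨h, _⟩ | ⟨h, _⟩ <;>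
  rcases abs_cases (x c - y c) with ⟨h', _⟩ | ⟨h', _⟩ <;> rw [h, h'] <;> nlinarith

lemma cell_add (i v : Cell n) (x : EuclideanSpace ℝ (Fin n)) :
    x + cellCorner δ v ∈ cell δ (i + v) ↔ x ∈ cell δ i := by
  refine forall_congr' fun c => ?_
  simp only [cellCorner_apply, PiLp.add_apply, Pi.add_apply, Int.cast_add]
  constructor <;> rintro ⟨h1, h2⟩ <;> constructor <;> linarith

lemma norm_cellCorner_single (hδ : 0 < δ) (c : Fin n) (r : ℤ) :
    ‖cellCorner δ (Pi.single c r : Cell n)‖ = δ * |(r : ℝ)| := by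
  have : cellCorner δ (Pi.single c r : Cell n) = PiLp.single 2 c (δ * r) := by
    ext c'
    rw [cellCorner_apply, PiLp.single_apply, Pi.single_apply]
    split_ifs <;> simp
  rw [this, PiLp.norm_single, norm_mul, Real.norm_of_nonneg hδ.le, Real.norm_eq_abs]

end Cells

/-! ### The bilinear pairing -/

section Pairing

variable {n : ℕ} {𝕜 : Type*} [RCLike 𝕜]
  {K : EuclideanSpace ℝ (Fin n) → EuclideanSpace ℝ (Fin n) → 𝕜}
  {T : stepFun n 𝕜 →ₗ[𝕜] (EuclideanSpace ℝ (Fin n) →ₘ[volume] 𝕜)}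

lemma cubeInd_mul (a : EuclideanSpace ℝ (Fin n)) (l : ℝ) (F : EuclideanSpace ℝ (Fin n) → 𝕜) :
    (fun x => cubeInd 𝕜 a l x * F x) = (cube a l).indicator F := by
  ext x
  by_cases hx : x ∈ cube a l <;> simp [cubeInd, hx]

lemma cube_subset_compact (a : EuclideanSpace ℝ (Fin n)) (l : ℝ) :
    ∃ S : Set (EuclideanSpace ℝ (Fin n)), IsCompact S ∧ cube a l ⊆ S :=
  ⟨_, (EuclideanSpace.equiv (Fin n) ℝ).toHomeomorph.isCompact_preimage.2
    (isCompact_Icc (a := fun i => a i) (b := fun i => a i + l)),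
    fun _ hx => ⟨fun i => (hx i).1, fun i => (hx i).2.le⟩⟩

lemma IsSingularIntegral.integrableOn_cube (hT : IsSingularIntegral K T) (f : stepFun n 𝕜)
    (a : EuclideanSpace ℝ (Fin n)) (l : ℝ) : IntegrableOn (T f) (cube a l) := by
  obtain ⟨S, hS, h⟩ := cube_subset_compact a l
  exact ((hT.locallyIntegrable f).integrableOn_isCompact hS).mono_set h

lemma IsSingularIntegral.integrable_mul (hT : IsSingularIntegral K T) (g f : stepFun n 𝕜) :
    Integrable fun x => (g : EuclideanSpace ℝ (Fin n) → 𝕜) x * T f x := by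
  obtain ⟨g, hg⟩ := g
  induction hg using Submodule.span_induction with
  | mem g hg =>
    obtain ⟨a, l, -, rfl⟩ := hg
    have := (hT.integrableOn_cube f a l).integrable_indicator (measurableSet_cube a l)
    rwa [← cubeInd_mul] at this
  | zero => simp
  | add g g' _ _ h h' =>
    refine (h.add h').congr (Eventually.of_forall fun x => ?_)
    simp [add_mul]
  | smul r g _ h =>
    refine (h.const_mul r).congr (Eventually.of_forall fun x => ?_)
    simp [mul_assoc]

/-- The pairing as a bilinear form. -/
def IsSingularIntegral.form (hT : IsSingularIntegral K T) :
    stepFun n 𝕜 →ₗ[𝕜] stepFun n 𝕜 →ₗ[𝕜] 𝕜 :=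
  LinearMap.mk₂ 𝕜 (pairing T)
    (fun g g' f => by
      rw [pairing, pairing, pairing, ← integral_add (hT.integrable_mul g f)
        (hT.integrable_mul g' f)]
      exact integral_congr_ae (Eventually.of_forall fun x => add_mul _ _ _))
    (fun r g f => by
      rw [pairing, pairing, smul_eq_mul, ← integral_const_mul]
      exact integral_congr_ae (Eventually.of_forall fun x => mul_assoc _ _ _))
    (fun g f f' => by
      rw [pairing, pairing, pairing, ← integral_add (hT.integrable_mul g f)
        (hT.integrable_mul g f'), map_add]
      refine integral_congr_ae ?_
      filter_upwards [AEEqFun.coeFn_add (T f) (T f')] with x hx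
      rw [hx, Pi.add_apply, mul_add])
    (fun r g f => by
      rw [pairing, pairing, map_smul, smul_eq_mul, ← integral_const_mul]
      refine integral_congr_ae ?_
      filter_upwards [AEEqFun.coeFn_smul r (T f)] with x hx
      rw [hx, Pi.smul_apply, smul_eq_mul, mul_left_comm])

lemma IsSingularIntegral.form_apply (hT : IsSingularIntegral K T) (g f : stepFun n 𝕜) :
    hT.form g f = pairing T g f := rfl

lemma pairing_cubeStep (a : EuclideanSpace ℝ (Fin n)) {l : ℝ} (hl : 0 < l) (f : stepFun n 𝕜) :
    pairing T (cubeStep 𝕜 a hl) f = ∫ x in cube a l, T f x := by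
  rw [pairing, ← integral_indicator (measurableSet_cube a l), ← cubeInd_mul]
  rfl

/-- The kernel representation for cubes, off the closed cube. -/
lemma IsSingularIntegral.repr_cube (hT : IsSingularIntegral K T) (a : EuclideanSpace ℝ (Fin n))
    {l : ℝ} (hl : 0 < l) : ∀ᵐ x : EuclideanSpace ℝ (Fin n), (∃ c, x c < a c ∨ a c + l < x c) →
      T (cubeStep 𝕜 a hl) x = ∫ y in cube a l, K x y := by
  filter_upwards [hT.repr (cubeStep 𝕜 a hl)] with x hx hc
  rw [hx, ← integral_indicator (measurableSet_cube a l)]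
  · refine integral_congr_ae (Eventually.of_forall fun y => ?_)
    by_cases hy : y ∈ cube a l <;> simp [cubeStep, cubeInd, hy]
  · intro hx'
    have hsub : tsupport (cubeInd 𝕜 a l) ⊆ {x | ∀ c, a c ≤ x c ∧ x c ≤ a c + l} := by
      refine closure_minimal (fun y hy => ?_) ?_
      · have : y ∈ cube a l := by
          by_contra h0
          exact hy (by simp [cubeInd, h0])
        exact fun c => ⟨(this c).1, (this c).2.le⟩
      · have : {x : EuclideanSpace ℝ (Fin n) | ∀ c, a c ≤ x c ∧ x c ≤ a c + l}
            = ⋂ c, {x | a c ≤ x c ∧ x c ≤ a c + l} := by ext; simp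
        rw [this]
        refine isClosed_iInter fun c => ?_
        have hm : Continuous fun x : EuclideanSpace ℝ (Fin n) => x c := by fun_prop
        exact (isClosed_le continuous_const hm).inter (isClosed_le hm continuous_const)
    obtain ⟨c, h | h⟩ := hc
    · exact absurd (hsub hx' c).1 (not_le.2 h)
    · exact absurd (hsub hx' c).2 (not_le.2 h)

end Pairing

/-! ### The matrix of an operator: smoothness -/

section Kernel

variable {n : ℕ} {𝕜 : Type*} [RCLike 𝕜] {α : ℝ} {CK : ℝ≥0}
  {K : EuclideanSpace ℝ (Fin n) → EuclideanSpace ℝ (Fin n) → 𝕜}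
  {T : stepFun n 𝕜 →ₗ[𝕜] (EuclideanSpace ℝ (Fin n) →ₘ[volume] 𝕜)}

lemma IsStandardKernel.toNNReal {c : ℝ} (hK : IsStandardKernel α c K) :
    IsStandardKernel α c.toNNReal K where
  size x y hxy := (hK.size x y hxy).trans (by gcongr; exact Real.le_coe_toNNReal c)
  smooth x y h hh := (hK.smooth x y h hh).trans (by gcongr; exact Real.le_coe_toNNReal c)

lemma tendsto_smooth_bound (hα : 0 < α) (c D : ℝ) :
    Tendsto (fun h : EuclideanSpace ℝ (Fin n) => c * ‖h‖ ^ α / D) (𝓝 0) (𝓝 0) := by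
  have : Tendsto (fun h : EuclideanSpace ℝ (Fin n) => ‖h‖ ^ α) (𝓝 0) (𝓝 0) := by
    have h1 : Continuous fun h : EuclideanSpace ℝ (Fin n) => ‖h‖ ^ α :=
      continuous_norm.rpow_const fun _ => Or.inr hα.le
    have := h1.tendsto 0
    rwa [norm_zero, Real.zero_rpow hα.ne'] at this
  simpa using (this.const_mul c).div_const D

lemma eventually_two_mul_norm_lt {x y : EuclideanSpace ℝ (Fin n)} (hxy : x ≠ y) :
    ∀ᶠ h : EuclideanSpace ℝ (Fin n) in 𝓝 0, 2 * ‖h‖ < ‖x - y‖ := by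
  have h1 : Continuous fun h : EuclideanSpace ℝ (Fin n) => 2 * ‖h‖ := by fun_prop
  have := h1.tendsto 0
  rw [norm_zero, mul_zero] at this
  exact this.eventually_lt_const (norm_pos_iff.2 (sub_ne_zero.2 hxy))

lemma IsStandardKernel.continuousAt_right (hK : IsStandardKernel α CK K) (hα : 0 < α)
    {x y : EuclideanSpace ℝ (Fin n)} (hxy : x ≠ y) : ContinuousAt (K x) y := by
  have hsub : Tendsto (fun y' : EuclideanSpace ℝ (Fin n) => y' - y) (𝓝 y) (𝓝 0) := by
    have : Continuous fun y' : EuclideanSpace ℝ (Fin n) => y' - y := by fun_prop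
    simpa using this.tendsto y
  rw [ContinuousAt, tendsto_iff_norm_sub_tendsto_zero]
  refine squeeze_zero' (Eventually.of_forall fun _ => norm_nonneg _) ?_
    ((tendsto_smooth_bound hα CK (‖x - y‖ ^ ((n : ℝ) + α))).comp hsub)
  filter_upwards [hsub.eventually (eventually_two_mul_norm_lt hxy)] with y' hy'
  have := (le_add_of_nonneg_left (norm_nonneg _)).trans (hK.smooth x y (y' - y) hy')
  rwa [add_sub_cancel] at this

/-- The kernel is integrable in the second variable over sets away from the first variable. -/
lemma IsStandardKernel.integrableOn (hK : IsStandardKernel α CK K) (hα : 0 < α)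
    {x : EuclideanSpace ℝ (Fin n)} {A : Set (EuclideanSpace ℝ (Fin n))} (hA : MeasurableSet A)
    (hA' : volume A ≠ ∞) {D : ℝ} (hD : 0 < D) (hxA : ∀ y ∈ A, D ≤ ‖x - y‖) :
    IntegrableOn (K x) A := by
  have hne : ∀ y ∈ A, x ≠ y := fun y hy h => by
    have := hxA y hy; rw [h, sub_self, norm_zero] at this; linarith
  refine IntegrableOn.of_bound hA'.lt_top ?_ (CK / D ^ n) ?_
  · exact (ContinuousOn.aestronglyMeasurable (fun y hy =>
      (hK.continuousAt_right hα (hne y hy)).continuousWithinAt) hA)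
  · refine (ae_restrict_iff' hA).2 (Eventually.of_forall fun y hy => ?_)
    refine (hK.size x y (hne y hy)).trans ?_
    have := hxA y hy
    gcongr

variable {δ : ℝ}

/-- The matrix of the operator with respect to the normalized indicators of the cells. -/
def czMatrix (T : stepFun n 𝕜 →ₗ[𝕜] (EuclideanSpace ℝ (Fin n) →ₘ[volume] 𝕜)) (hδ : 0 < δ)
    (i j : Cell n) : 𝕜 :=
  (δ ^ n)⁻¹ • pairing T (cubeStep 𝕜 (cellCorner δ i) hδ) (cubeStep 𝕜 (cellCorner δ j) hδ)

/-- The integral of the kernel over a cell. -/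
def cellKernel (K : EuclideanSpace ℝ (Fin n) → EuclideanSpace ℝ (Fin n) → 𝕜) (δ : ℝ) (j : Cell n)
    (x : EuclideanSpace ℝ (Fin n)) : 𝕜 := ∫ y in cell δ j, K x y

lemma volume_cell_real (hδ : 0 < δ) (i : Cell n) : volume.real (cell δ i) = δ ^ n := by
  rw [Measure.real, volume_cell, ENNReal.toReal_pow, ENNReal.toReal_ofReal hδ.le]

lemma volume_cell_ne_top (i : Cell n) : volume (cell δ i) ≠ ∞ := (volume_cube_lt_top _ _).ne

/-- Off the diagonal, the operator is given by the kernel. -/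
lemma IsSingularIntegral.ae_cell (hT : IsSingularIntegral K T) (hδ : 0 < δ) {i j : Cell n}
    (hij : i ≠ j) : ∀ᵐ x ∂volume.restrict (cell δ i),
      T (cubeStep 𝕜 (cellCorner δ j) hδ) x = cellKernel K δ j x := by
  rw [ae_restrict_iff' (measurableSet_cell i)]
  have h0 : ∀ᵐ x : EuclideanSpace ℝ (Fin n), ∀ c, x c ≠ cellCorner δ j c + δ :=
    ae_all_iff.2 fun c => by
      simpa [ae_iff] using volume_hyperplane c (cellCorner δ j c + δ)
  filter_upwards [hT.repr_cube (cellCorner δ j) hδ, h0] with x hx hx0 hxi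
  refine hx ?_
  by_contra! hc
  refine hij ?_
  rw [← (mem_cell hδ).1 hxi, ← (mem_cell hδ (i := j)).1]
  exact fun c => ⟨(hc c).1, (hc c).2.lt_of_ne (hx0 c)⟩

lemma IsSingularIntegral.integrableOn_cellKernel (hT : IsSingularIntegral K T) (hδ : 0 < δ)
    {i j : Cell n} (hij : i ≠ j) : IntegrableOn (cellKernel K δ j) (cell δ i) :=
  (integrable_congr (hT.ae_cell hδ hij)).1 (hT.integrableOn_cube _ _ _)

lemma IsSingularIntegral.pairing_cell (hT : IsSingularIntegral K T) (hδ : 0 < δ)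
    {i j : Cell n} (hij : i ≠ j) :
    pairing T (cubeStep 𝕜 (cellCorner δ i) hδ) (cubeStep 𝕜 (cellCorner δ j) hδ)
      = ∫ x in cell δ i, cellKernel K δ j x := by
  rw [pairing_cubeStep]
  exact integral_congr_ae (hT.ae_cell hδ hij)

lemma cell_preimage (i v : Cell n) :
    (fun x => x + cellCorner δ v) ⁻¹' cell δ (i + v) = cell δ i :=
  Set.ext fun x => cell_add i v x

lemma setIntegral_cell_add {F : Type*} [NormedAddCommGroup F] [NormedSpace ℝ F] (i v : Cell n)
    (g : EuclideanSpace ℝ (Fin n) → F) :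
    ∫ x in cell δ (i + v), g x = ∫ x in cell δ i, g (x + cellCorner δ v) := by
  rw [← cell_preimage i v]
  exact ((measurePreserving_add_right volume (cellCorner δ v)).setIntegral_preimage_emb
    (MeasurableEquiv.addRight _).measurableEmbedding g _).symm

lemma integrableOn_cell_add {F : Type*} [NormedAddCommGroup F] {i v : Cell n}
    {g : EuclideanSpace ℝ (Fin n) → F} (hg : IntegrableOn g (cell δ (i + v))) :
    IntegrableOn (fun x => g (x + cellCorner δ v)) (cell δ i) := by
  rw [← cell_preimage i v]
  exact ((measurePreserving_add_right volume (cellCorner δ v)).integrableOn_comp_preimage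
    (MeasurableEquiv.addRight _).measurableEmbedding).2 hg

lemma cell_ne_of_far {i j : Cell n} {c' : Fin n} {r : ℝ} (hr : 0 ≤ r)
    (h : 2 * r < |(i c' : ℝ) - j c'| - 1) : i ≠ j := by
  rintro rfl; simp at h; linarith

lemma cell_add_ne_of_far {i j : Cell n} {c c' : Fin n} {r : ℤ}
    (h : 2 * |(r : ℝ)| < |(i c' : ℝ) - j c'| - 1) : i + Pi.single c r ≠ j := by
  rintro rfl
  rw [Pi.add_apply, Pi.single_apply] at h
  have h0 := abs_nonneg (r : ℝ)
  split_ifs at h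
  · push_cast at h
    rw [sub_add_cancel_left, abs_neg] at h; linarith
  · simp at h; linarith

/-- The common form of the smoothness estimates in both variables. -/
lemma norm_setIntegral_cell_le (hδ : 0 < δ) (hα : 0 < α) {i j : Cell n} {c c' : Fin n} {r : ℤ}
    (hr : 2 * |(r : ℝ)| < |(i c' : ℝ) - j c'| - 1)
    {G : EuclideanSpace ℝ (Fin n) → EuclideanSpace ℝ (Fin n) → 𝕜}
    (hG : ∀ x ∈ cell δ i, ∀ y ∈ cell δ j, ‖G x y‖ ≤
      CK * ‖cellCorner δ (Pi.single c r : Cell n)‖ ^ α / ‖x - y‖ ^ ((n : ℝ) + α)) :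
    (δ ^ n)⁻¹ * ‖∫ x in cell δ i, ∫ y in cell δ j, G x y‖
      ≤ CK * |(r : ℝ)| ^ α / (|(i c' : ℝ) - j c'| - 1) ^ ((n : ℝ) + α) := by
  set d := |(i c' : ℝ) - j c'| - 1
  have hd : 0 < d := lt_of_le_of_lt (by positivity) hr
  have h1 : ∀ x ∈ cell δ i, ‖∫ y in cell δ j, G x y‖
      ≤ CK * (δ * |(r : ℝ)|) ^ α / (δ * d) ^ ((n : ℝ) + α) * δ ^ n := by
    intro x hx
    rw [← volume_cell_real hδ j]
    refine norm_setIntegral_le_of_norm_le_const (volume_cube_lt_top _ _) fun y hy => ?_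
    refine (hG x hx y hy).trans ?_
    rw [norm_cellCorner_single hδ]
    have := le_norm_sub_of_mem_cell hx hy c'
    gcongr
  have h2 : ‖∫ x in cell δ i, ∫ y in cell δ j, G x y‖
      ≤ CK * (δ * |(r : ℝ)|) ^ α / (δ * d) ^ ((n : ℝ) + α) * δ ^ n * δ ^ n := by
    conv_rhs => rw [← volume_cell_real hδ i]
    rw [volume_cell_real hδ i, ← volume_cell_real hδ i]
    exact norm_setIntegral_le_of_norm_le_const (volume_cube_lt_top _ _)
      fun x hx => (h1 x hx).trans (by rw [volume_cell_real hδ])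
  calc _ ≤ (δ ^ n)⁻¹ * (CK * (δ * |(r : ℝ)|) ^ α / (δ * d) ^ ((n : ℝ) + α) * δ ^ n * δ ^ n) := by
        gcongr
    _ = _ := by
        rw [Real.mul_rpow hδ.le (abs_nonneg _), Real.mul_rpow hδ.le hd.le, Real.rpow_add hδ,
          Real.rpow_natCast]
        have := Real.rpow_pos_of_pos hδ α
        have := Real.rpow_pos_of_pos hd ((n : ℝ) + α)
        field_simp

lemma czMatrix_smooth (hK : IsStandardKernel α CK K) (hα : 0 < α) (hT : IsSingularIntegral K T)
    (hδ : 0 < δ) (i j : Cell n) (c c' : Fin n) (r : ℤ)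
    (hr : 2 * |(r : ℝ)| < |(i c' : ℝ) - j c'| - 1) :
    ‖czMatrix T hδ i j - czMatrix T hδ (i + Pi.single c r) j‖
      ≤ CK * |(r : ℝ)| ^ α / (|(i c' : ℝ) - j c'| - 1) ^ ((n : ℝ) + α) := by
  have hij := cell_ne_of_far (abs_nonneg _) hr
  have hij' := cell_add_ne_of_far (c := c) hr
  set η := cellCorner δ (Pi.single c r : Cell n) with hη
  have hηn : ‖η‖ = δ * |(r : ℝ)| := norm_cellCorner_single hδ c r
  rw [czMatrix, czMatrix, ← smul_sub, hT.pairing_cell hδ hij, hT.pairing_cell hδ hij',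
    setIntegral_cell_add, ← integral_sub (hT.integrableOn_cellKernel hδ hij)
      (integrableOn_cell_add (hT.integrableOn_cellKernel hδ hij')), norm_smul, norm_inv,
    norm_pow, Real.norm_of_nonneg hδ.le]
  have hfar : ∀ x ∈ cell δ i, ∀ y ∈ cell δ j, 2 * ‖η‖ < ‖x - y‖ := fun x hx y hy => by
    have := le_norm_sub_of_mem_cell hx hy c'
    rw [hηn]; nlinarith
  have e : ∫ x in cell δ i, (cellKernel K δ j x - cellKernel K δ j (x + η))
      = ∫ x in cell δ i, ∫ y in cell δ j, (K x y - K (x + η) y) := by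
    refine setIntegral_congr_fun (measurableSet_cell i) fun x hx => ?_
    have hd : 0 < δ * (|(i c' : ℝ) - j c'| - 1 - |(r : ℝ)|) := by
      have := abs_nonneg (r : ℝ)
      have : 0 < |(i c' : ℝ) - j c'| - 1 - |(r : ℝ)| := by linarith
      positivity
    refine (integral_sub (hK.integrableOn hα (measurableSet_cell j) (volume_cell_ne_top j) hd
      fun y hy => ?_) (hK.integrableOn hα (measurableSet_cell j) (volume_cell_ne_top j) hd
      fun y hy => ?_)).symm
    · have := le_norm_sub_of_mem_cell hx hy c'
      have := abs_nonneg (r : ℝ)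
      nlinarith
    · have h1 := le_norm_sub_of_mem_cell hx hy c'
      have h2 := norm_sub_le (x + η - y) η
      rw [hηn, show x + η - y - η = x - y by abel] at h2
      nlinarith
  rw [e]
  refine norm_setIntegral_cell_le (c := c) hδ hα hr fun x hx y hy => ?_
  have := hK.smooth x y η (hfar x hx y hy)
  rw [norm_sub_rev]
  exact (le_add_of_nonneg_right (norm_nonneg _)).trans this

lemma czMatrix_adjoint_smooth (hK : IsStandardKernel α CK K) (hα : 0 < α)
    (hT : IsSingularIntegral K T) (hδ : 0 < δ) (i j : Cell n) (c c' : Fin n) (r : ℤ)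
    (hr : 2 * |(r : ℝ)| < |(i c' : ℝ) - j c'| - 1) :
    ‖czMatrix T hδ i j - czMatrix T hδ i (j + Pi.single c r)‖
      ≤ CK * |(r : ℝ)| ^ α / (|(i c' : ℝ) - j c'| - 1) ^ ((n : ℝ) + α) := by
  have hij := cell_ne_of_far (abs_nonneg _) hr
  have hij' : i ≠ j + Pi.single c r := by
    rw [abs_sub_comm] at hr
    exact (cell_add_ne_of_far (c := c) hr).symm
  set η := cellCorner δ (Pi.single c r : Cell n) with hη
  have hηn : ‖η‖ = δ * |(r : ℝ)| := norm_cellCorner_single hδ c r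
  rw [czMatrix, czMatrix, ← smul_sub, hT.pairing_cell hδ hij, hT.pairing_cell hδ hij',
    ← integral_sub (hT.integrableOn_cellKernel hδ hij)
      (hT.integrableOn_cellKernel hδ hij'), norm_smul, norm_inv,
    norm_pow, Real.norm_of_nonneg hδ.le]
  have hfar : ∀ x ∈ cell δ i, ∀ y ∈ cell δ j, 2 * ‖η‖ < ‖x - y‖ := fun x hx y hy => by
    have := le_norm_sub_of_mem_cell hx hy c'
    rw [hηn]; nlinarith
  have e : ∫ x in cell δ i, (cellKernel K δ j x - cellKernel K δ (j + Pi.single c r) x)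
      = ∫ x in cell δ i, ∫ y in cell δ j, (K x y - K x (y + η)) := by
    refine setIntegral_congr_fun (measurableSet_cell i) fun x hx => ?_
    have hd : 0 < δ * (|(i c' : ℝ) - j c'| - 1 - |(r : ℝ)|) := by
      have := abs_nonneg (r : ℝ)
      have : 0 < |(i c' : ℝ) - j c'| - 1 - |(r : ℝ)| := by linarith
      positivity
    simp only [cellKernel]
    rw [setIntegral_cell_add]
    refine (integral_sub (hK.integrableOn hα (measurableSet_cell j) (volume_cell_ne_top j) hd
      fun y hy => ?_) (integrableOn_cell_add (hK.integrableOn hα (measurableSet_cell _)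
        (volume_cell_ne_top _) hd fun y hy => ?_))).symm
    · have := le_norm_sub_of_mem_cell hx hy c'
      have := abs_nonneg (r : ℝ)
      nlinarith
    · have hy' : y - η ∈ cell δ j := by
        rw [← cell_add j (Pi.single c r)]
        simpa [hη] using hy
      have h1 := le_norm_sub_of_mem_cell hx hy' c'
      have h2 := norm_sub_le (x - y) (-η)
      rw [norm_neg, hηn, show x - y - -η = x - (y - η) by abel] at h2
      nlinarith
  rw [e]
  refine norm_setIntegral_cell_le (c := c) hδ hα hr fun x hx y hy => ?_
  have := hK.smooth x y η (hfar x hx y hy)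
  rw [norm_sub_rev]
  exact (le_add_of_nonneg_left (norm_nonneg _)).trans this

end Kernel

/-! ### The size of the kernel on adjacent boxes -/

section Size

variable {n : ℕ}

/-- The integral of `|z|^{1-n}` over a ball is proportional to the radius. -/
lemma lintegral_ball_norm [NeZero n] :
    ∃ V : ℝ≥0, ∀ L : ℝ, 0 < L → ∫⁻ z in Metric.ball (0 : EuclideanSpace ℝ (Fin n)) L,
      ENNReal.ofReal ((‖z‖ ^ n)⁻¹ * ‖z‖) = V * ENNReal.ofReal L := by
  refine ⟨n * (volume.real (Metric.ball (0 : EuclideanSpace ℝ (Fin n)) 1)).toNNReal,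
    fun L hL => ?_⟩
  have : Nontrivial (EuclideanSpace ℝ (Fin n)) := by
    have : Nonempty (Fin n) := ⟨0⟩
    infer_instance
  set f : ℝ → ℝ := (Set.Iio L).indicator fun r => (r ^ n)⁻¹ * r with hf
  have h1 : ∀ y ∈ Set.Ioi (0 : ℝ), y ^ (Module.finrank ℝ (EuclideanSpace ℝ (Fin n)) - 1) • f y
      = (Set.Ioo 0 L).indicator (fun _ => (1 : ℝ)) y := by
    intro y hy
    have hy' : 0 < y := hy
    rw [finrank_euclideanSpace_fin]
    by_cases hL' : y < L
    · rw [hf, Set.indicator_of_mem (show y ∈ Set.Iio L from hL'),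
        Set.indicator_of_mem (show y ∈ Set.Ioo 0 L from ⟨hy, hL'⟩), smul_eq_mul, mul_left_comm,
        ← pow_succ, Nat.sub_add_cancel (NeZero.pos n), inv_mul_cancel₀ (by positivity)]
    · rw [hf, Set.indicator_of_notMem (show y ∉ Set.Iio L from hL'),
        Set.indicator_of_notMem (fun h => hL' h.2), smul_zero]
  have hint : Integrable (fun z : EuclideanSpace ℝ (Fin n) => f ‖z‖) := by
    rw [integrable_fun_norm_addHaar volume, integrableOn_congr_fun h1 measurableSet_Ioi]
    refine ((integrable_indicator_iff measurableSet_Ioo).2 ?_).integrableOn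
    exact integrableOn_const (by simp)
  have e : ∫⁻ z in Metric.ball (0 : EuclideanSpace ℝ (Fin n)) L,
      ENNReal.ofReal ((‖z‖ ^ n)⁻¹ * ‖z‖) = ∫⁻ z : EuclideanSpace ℝ (Fin n), ENNReal.ofReal (f ‖z‖) := by
    rw [← lintegral_indicator Metric.isOpen_ball.measurableSet]
    refine lintegral_congr fun z => ?_
    by_cases hz : ‖z‖ < L
    · rw [Set.indicator_of_mem (by simpa using hz), hf,
        Set.indicator_of_mem (show ‖z‖ ∈ Set.Iio L from hz)]
    · rw [Set.indicator_of_notMem (by simpa using hz), hf,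
        Set.indicator_of_notMem (show ‖z‖ ∉ Set.Iio L from hz), ENNReal.ofReal_zero]
  have hf0 : ∀ z : EuclideanSpace ℝ (Fin n), 0 ≤ f ‖z‖ := fun z => by
    rw [hf, Set.indicator_apply]
    split_ifs <;> positivity
  rw [e, ← ofReal_integral_eq_lintegral_ofReal hint (Eventually.of_forall hf0)]
  · rw [integral_fun_norm_addHaar volume f, setIntegral_congr_fun measurableSet_Ioi h1,
      setIntegral_indicator measurableSet_Ioo,
      Set.inter_eq_self_of_subset_right Set.Ioo_subset_Ioi_self]
    rw [finrank_euclideanSpace_fin]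
    simp only [nsmul_eq_mul, smul_eq_mul, setIntegral_const, Real.volume_real_Ioo_of_le hL.le,
      sub_zero, mul_one]
    rw [← mul_assoc, ENNReal.ofReal_mul (by positivity), ENNReal.ofReal_mul (by positivity),
      ENNReal.ofReal_natCast]
    push_cast
    rfl

/-- Boxes with sides at most `2L`. -/
lemma volume_box_le {a b : Fin n → ℝ} {L : ℝ} (hL : 0 ≤ L) (hab : ∀ c, b c - a c ≤ 2 * L) :
    volume {x : EuclideanSpace ℝ (Fin n) | ∀ c, a c ≤ x c ∧ x c < b c}
      ≤ ENNReal.ofReal ((2 * L) ^ n) := by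
  rw [volume_box, ENNReal.ofReal_pow (by positivity)]
  exact (Finset.prod_le_prod' fun c _ => ENNReal.ofReal_le_ofReal (hab c)).trans (by simp)

/-- If two boxes are separated in one coordinate, a translation by `z` moves only points close to
the separating hyperplane from one to the other. -/
lemma volume_inter_box_le [NeZero n] {a b a' b' : Fin n → ℝ} {L : ℝ} (hL : 0 ≤ L)
    (hab : ∀ c, b c - a c ≤ 2 * L) {c₀ : Fin n} (hsep : b c₀ ≤ a' c₀ ∨ b' c₀ ≤ a c₀)
    (z : EuclideanSpace ℝ (Fin n)) :
    volume {x : EuclideanSpace ℝ (Fin n) | (∀ c, a c ≤ x c ∧ x c < b c) ∧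
      ∀ c, a' c ≤ (x - z) c ∧ (x - z) c < b' c} ≤ ENNReal.ofReal (‖z‖ * (2 * L) ^ (n - 1)) := by
  have hz := PiLp.norm_apply_le z c₀
  rw [Real.norm_eq_abs] at hz
  have hz' := abs_le.1 hz
  have key : ∀ a₁ b₁ : Fin n → ℝ, (∀ c, c ≠ c₀ → b₁ c - a₁ c ≤ 2 * L) → b₁ c₀ - a₁ c₀ ≤ ‖z‖ →
      volume {x : EuclideanSpace ℝ (Fin n) | ∀ c, a₁ c ≤ x c ∧ x c < b₁ c}
        ≤ ENNReal.ofReal (‖z‖ * (2 * L) ^ (n - 1)) := by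
    intro a₁ b₁ h1 h2
    rw [volume_box, ← Finset.mul_prod_erase _ _ (Finset.mem_univ c₀),
      ENNReal.ofReal_mul (norm_nonneg z), ENNReal.ofReal_pow (by positivity)]
    gcongr
    refine (Finset.prod_le_pow_card _ _ (ENNReal.ofReal (2 * L)) fun c hc =>
      ENNReal.ofReal_le_ofReal (h1 c (Finset.ne_of_mem_erase hc))).trans (le_of_eq ?_)
    rw [Finset.card_erase_of_mem (Finset.mem_univ c₀), Finset.card_univ, Fintype.card_fin]
  rcases hsep with h | h
  · refine le_trans (measure_mono ?_) (key (Function.update a c₀ (b c₀ - ‖z‖)) b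
      (fun c hc => by rw [Function.update_of_ne hc]; exact hab c)
      (by rw [Function.update_self]; linarith))
    rintro x ⟨h1, h2⟩ c
    by_cases hc : c = c₀
    · subst hc
      rw [Function.update_self]
      have := (h2 c).1
      rw [PiLp.sub_apply] at this
      exact ⟨by linarith, (h1 c).2⟩
    · rw [Function.update_of_ne hc]; exact h1 c
  · refine le_trans (measure_mono ?_) (key a (Function.update b c₀ (a c₀ + ‖z‖))
      (fun c hc => by rw [Function.update_of_ne hc]; exact hab c)
      (by rw [Function.update_self]; linarith))
    rintro x ⟨h1, h2⟩ c
    by_cases hc : c = c₀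
    · subst hc
      rw [Function.update_self]
      have := (h2 c).2
      rw [PiLp.sub_apply] at this
      exact ⟨(h1 c).1, by linarith⟩
    · rw [Function.update_of_ne hc]; exact h1 c

/-- The double integral of `|x - y|^{-n}` over two boxes of comparable size which are separated in
one coordinate is at most a multiple of their measure. With `z = x - y`, the integrand gains a
factor `|z|` for `|z| < L` from `volume_inter_box_le`, and for `|z| ≥ L` it is at most `L^{-n}`. -/
lemma lintegral_box_le [NeZero n] : ∃ C : ℝ≥0, ∀ (a b a' b' : Fin n → ℝ) (L : ℝ), 0 < L →
    (∀ c, b c - a c ≤ 2 * L) → (∀ c, b' c - a' c ≤ 2 * L) →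
    (∃ c₀, b c₀ ≤ a' c₀ ∨ b' c₀ ≤ a c₀) →
    ∫⁻ x in {x : EuclideanSpace ℝ (Fin n) | ∀ c, a c ≤ x c ∧ x c < b c},
      ∫⁻ y in {x : EuclideanSpace ℝ (Fin n) | ∀ c, a' c ≤ x c ∧ x c < b' c},
        ENNReal.ofReal ((‖x - y‖ ^ n)⁻¹) ≤ C * ENNReal.ofReal (L ^ n) := by
  obtain ⟨V, hV⟩ := lintegral_ball_norm (n := n)
  refine ⟨V * 2 ^ (n - 1) + 4 ^ n, fun a b a' b' L hL hab hab' ⟨c₀, hsep⟩ => ?_⟩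
  set P := {x : EuclideanSpace ℝ (Fin n) | ∀ c, a c ≤ x c ∧ x c < b c} with hP
  set Q := {x : EuclideanSpace ℝ (Fin n) | ∀ c, a' c ≤ x c ∧ x c < b' c} with hQ
  have hmeas : ∀ a b : Fin n → ℝ,
      MeasurableSet {x : EuclideanSpace ℝ (Fin n) | ∀ c, a c ≤ x c ∧ x c < b c} := by
    intro a b
    have : {x : EuclideanSpace ℝ (Fin n) | ∀ c, a c ≤ x c ∧ x c < b c}
        = ⋂ c, {x | a c ≤ x c ∧ x c < b c} := by ext; simp
    rw [this]
    refine MeasurableSet.iInter fun c => ?_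
    have hm : Measurable fun x : EuclideanSpace ℝ (Fin n) => x c := by fun_prop
    exact (measurableSet_le measurable_const hm).inter (measurableSet_lt hm measurable_const)
  have hPm : MeasurableSet P := hmeas a b
  have hQm : MeasurableSet Q := hmeas a' b'
  set φ : EuclideanSpace ℝ (Fin n) → ℝ≥0∞ := (Metric.ball 0 L).indicator
    fun z => ENNReal.ofReal ((‖z‖ ^ n)⁻¹) with hφ
  have hφm : Measurable φ := by
    refine Measurable.indicator ?_ Metric.isOpen_ball.measurableSet
    fun_prop
  have hsplit : ∀ z : EuclideanSpace ℝ (Fin n), ENNReal.ofReal ((‖z‖ ^ n)⁻¹)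
      ≤ φ z + ENNReal.ofReal ((L ^ n)⁻¹) := by
    intro z
    by_cases hz : ‖z‖ < L
    · rw [hφ, Set.indicator_of_mem (by simpa using hz)]
      exact le_self_add
    · refine le_add_left (ENNReal.ofReal_le_ofReal ?_)
      have := not_lt.1 hz
      gcongr
  have hnear : ∫⁻ x in P, ∫⁻ y in Q, φ (x - y) ≤ V * 2 ^ (n - 1) * ENNReal.ofReal (L ^ n) := by
    calc ∫⁻ x in P, ∫⁻ y in Q, φ (x - y)
        = ∫⁻ x, ∫⁻ z, P.indicator 1 x * Q.indicator 1 (x - z) * φ z := by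
          rw [← lintegral_indicator hPm]
          refine lintegral_congr fun x => ?_
          by_cases hx : x ∈ P
          · rw [Set.indicator_of_mem hx, Set.indicator_of_mem hx, ← lintegral_indicator hQm,
              ← lintegral_sub_left_eq_self
                (fun z => (1 : EuclideanSpace ℝ (Fin n) → ℝ≥0∞) x * Q.indicator 1 (x - z) * φ z) x]
            refine lintegral_congr fun y => ?_
            rw [sub_sub_cancel]
            by_cases hy : y ∈ Q <;> simp [hy]
          · simp [hx]
      _ = ∫⁻ z, ∫⁻ x, P.indicator 1 x * Q.indicator 1 (x - z) * φ z := by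
          refine lintegral_lintegral_swap ?_
          refine Measurable.aemeasurable ?_
          refine Measurable.mul (Measurable.mul ?_ ?_) (hφm.comp measurable_snd)
          · exact (measurable_one.indicator hPm).comp measurable_fst
          · exact (measurable_one.indicator hQm).comp (measurable_fst.sub measurable_snd)
      _ ≤ ∫⁻ z in Metric.ball (0 : EuclideanSpace ℝ (Fin n)) L,
          ENNReal.ofReal ((2 * L) ^ (n - 1)) * ENNReal.ofReal ((‖z‖ ^ n)⁻¹ * ‖z‖) := by
          rw [← lintegral_indicator Metric.isOpen_ball.measurableSet]
          refine lintegral_mono fun z => ?_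
          by_cases hz : z ∈ Metric.ball (0 : EuclideanSpace ℝ (Fin n)) L
          · rw [Set.indicator_of_mem hz, hφ]
            simp only [Set.indicator_of_mem hz]
            rw [lintegral_mul_const' _ _ ENNReal.ofReal_ne_top]
            have e : ∫⁻ x, P.indicator 1 x * Q.indicator 1 (x - z)
                = volume (P ∩ (fun x => x - z) ⁻¹' Q) := by
              have hm : MeasurableSet (P ∩ (fun x => x - z) ⁻¹' Q) :=
                hPm.inter ((measurable_id.sub_const z) hQm)
              rw [← lintegral_indicator_one hm]
              refine lintegral_congr fun x => ?_
              by_cases h1 : x ∈ P <;> by_cases h2 : x - z ∈ Q <;> simp [h1, h2]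
            rw [e]
            refine (mul_le_mul_left (volume_inter_box_le hL.le hab hsep z) _).trans (le_of_eq ?_)
            rw [← ENNReal.ofReal_mul (by positivity), ← ENNReal.ofReal_mul (by positivity)]
            congr 1; ring
          · rw [Set.indicator_of_notMem hz, hφ]
            simp [Set.indicator_of_notMem hz]
      _ = V * 2 ^ (n - 1) * ENNReal.ofReal (L ^ n) := by
          rw [lintegral_const_mul' _ _ ENNReal.ofReal_ne_top, hV L hL, mul_pow,
            ENNReal.ofReal_mul (by positivity), ENNReal.ofReal_pow (by norm_num),
            ENNReal.ofReal_pow hL.le, ENNReal.ofReal_pow hL.le]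
          obtain ⟨k, hk⟩ := Nat.exists_eq_succ_of_ne_zero (NeZero.ne n)
          rw [hk, Nat.succ_sub_one, pow_succ (ENNReal.ofReal L), ENNReal.ofReal_ofNat]
          ring
  calc _ ≤ ∫⁻ x in P, ∫⁻ y in Q, (φ (x - y) + ENNReal.ofReal ((L ^ n)⁻¹)) :=
        lintegral_mono fun x => lintegral_mono fun y => hsplit (x - y)
    _ = ∫⁻ x in P, ((∫⁻ y in Q, φ (x - y)) + ENNReal.ofReal ((L ^ n)⁻¹) * volume Q) := by
        refine lintegral_congr fun x => ?_
        rw [lintegral_add_right _ measurable_const, setLIntegral_const]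
    _ = (∫⁻ x in P, ∫⁻ y in Q, φ (x - y)) + ENNReal.ofReal ((L ^ n)⁻¹) * volume Q * volume P := by
        rw [lintegral_add_right _ measurable_const, setLIntegral_const]
    _ ≤ V * 2 ^ (n - 1) * ENNReal.ofReal (L ^ n) + ENNReal.ofReal ((L ^ n)⁻¹) *
        ENNReal.ofReal ((2 * L) ^ n) * ENNReal.ofReal ((2 * L) ^ n) := by
        gcongr
        · exact volume_box_le hL.le hab'
        · exact volume_box_le hL.le hab
    _ = _ := by
        have : ENNReal.ofReal ((L ^ n)⁻¹) * ENNReal.ofReal ((2 * L) ^ n)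
            * ENNReal.ofReal ((2 * L) ^ n) = 4 ^ n * ENNReal.ofReal (L ^ n) := by
          rw [show (4 : ℝ≥0∞) ^ n = ENNReal.ofReal (4 ^ n) by
              rw [ENNReal.ofReal_pow (by norm_num)]; norm_num,
            ← ENNReal.ofReal_mul (by positivity), ← ENNReal.ofReal_mul (by positivity),
            ← ENNReal.ofReal_mul (by positivity)]
          congr 1
          rw [mul_pow, show (4 : ℝ) = 2 * 2 by norm_num, mul_pow]
          field_simp
        rw [this, ← add_mul]
        push_cast
        rfl

end Size

/-! ### The matrix of an operator: size and vanishing -/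

section OperatorMatrix

variable {n : ℕ} {𝕜 : Type*} [RCLike 𝕜] {α : ℝ} {CK CW : ℝ≥0}
  {K : EuclideanSpace ℝ (Fin n) → EuclideanSpace ℝ (Fin n) → 𝕜}
  {T : stepFun n 𝕜 →ₗ[𝕜] (EuclideanSpace ℝ (Fin n) →ₘ[volume] 𝕜)} {δ : ℝ}

lemma sum_cellStep_apply (hδ : 0 < δ) (P : Finset (Cell n)) (x : EuclideanSpace ℝ (Fin n)) :
    ((∑ i ∈ P, cubeStep 𝕜 (cellCorner δ i) hδ : stepFun n 𝕜) :
      EuclideanSpace ℝ (Fin n) → 𝕜) x = if cellOf δ x ∈ P then 1 else 0 := by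
  rw [AddSubmonoidClass.coe_finsetSum, Finset.sum_apply]
  have : ∀ i, (cubeStep 𝕜 (cellCorner δ i) hδ : EuclideanSpace ℝ (Fin n) → 𝕜) x
      = if cellOf δ x = i then 1 else 0 := fun i => by
    by_cases h : cellOf δ x = i
    · have h' : x ∈ cube (cellCorner δ i) δ := (mem_cell hδ).2 h
      simp [cubeStep, cubeInd, h', h]
    · have h' : x ∉ cube (cellCorner δ i) δ := fun h' => h ((mem_cell hδ).1 h')
      simp [cubeStep, cubeInd, h', h]
  simp only [this, Finset.sum_ite_eq]

lemma sum_cellStep_eq (hδ : 0 < δ) (P : Finset (Cell n)) (a : EuclideanSpace ℝ (Fin n)) {l : ℝ}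
    (hl : 0 < l) (h : ∀ x, cellOf δ x ∈ P ↔ x ∈ cube a l) :
    ∑ i ∈ P, cubeStep 𝕜 (cellCorner δ i) hδ = cubeStep 𝕜 a hl := by
  refine Subtype.ext (funext fun x => ?_)
  rw [sum_cellStep_apply]
  by_cases hx : x ∈ cube a l
  · rw [if_pos ((h x).2 hx)]; simp [cubeStep, cubeInd, hx]
  · rw [if_neg (mt (h x).1 hx)]; simp [cubeStep, cubeInd, hx]

lemma IsSingularIntegral.blockSum_czMatrix (hT : IsSingularIntegral K T) (hδ : 0 < δ)
    (P Q : Finset (Cell n)) : blockSum (czMatrix T hδ) P Q = (δ ^ n)⁻¹ •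
      pairing T (∑ i ∈ P, cubeStep 𝕜 (cellCorner δ i) hδ)
        (∑ j ∈ Q, cubeStep 𝕜 (cellCorner δ j) hδ) := by
  rw [← hT.form_apply, map_sum hT.form, LinearMap.sum_apply, Finset.smul_sum]
  simp only [map_sum, Finset.smul_sum]
  rfl

/-- The blocks on the diagonal: the weak boundedness property gives the estimate for cubes, which
are divided from the rectangles of intermediate levels. -/
lemma norm_blockSum_diag_le [NeZero n] (hT : IsSingularIntegral K T)
    (hW : WeakBoundedness (CW : ℝ) T) (hδ : 0 < δ) {C : ℝ≥0}
    (hoff : ∀ s u m, m ≠ 0 → ‖blockSum (czMatrix T hδ) (rect s u) (rect s (gridPos u s m))‖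
      ≤ C * rectCard n s) (k r : ℕ) (u : Cell n) :
    ‖blockSum (czMatrix T hδ) (rect (n * k + r) u) (rect (n * k + r) u)‖
      ≤ (CW + r * C) * rectCard n (n * k + r) := by
  induction r generalizing u with
  | zero =>
    have hside : ∀ c : Fin n, side (n * k) c = 2 ^ k := fun c => by
      rw [side, sideExp, Nat.mul_add_div (NeZero.pos n), Nat.div_eq_of_lt c.isLt, add_zero]
    have hl : 0 < δ * 2 ^ k := by positivity
    have hsum := sum_cellStep_eq (𝕜 := 𝕜) hδ (rect (n * k) u) (cellCorner δ u) hl fun x => by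
      rw [mem_rect]
      refine forall_congr' fun c => ?_
      rw [le_cellOf_iff hδ, cellOf_lt_iff hδ, hside, cellCorner_apply]
      push_cast
      rw [mul_add]
    have h1 := hW (cellCorner δ u) _ hl
    have h2 : volume.real (cube (cellCorner δ u) (δ * 2 ^ k)) = δ ^ n * rectCard n (n * k) := by
      rw [Measure.real, volume_cube, ENNReal.toReal_pow, ENNReal.toReal_ofReal hl.le, mul_pow,
        rectCard_eq]
      push_cast
      rw [← pow_mul, mul_comm k n]
    rw [add_zero, hT.blockSum_czMatrix hδ, hsum, norm_smul, norm_inv, norm_pow,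
      Real.norm_of_nonneg hδ.le, Nat.cast_zero, zero_mul, add_zero,
      inv_mul_le_iff₀ (by positivity)]
    rw [h2] at h1
    linarith
  | succ r ih =>
    rw [← add_assoc, blockSum_succ]
    have h00 := ih u
    have h11 := ih (u + halfShift (n * k + r))
    set s := n * k + r
    have hne : ∀ b : ℤ, b ≠ 0 → ∀ u : Cell n, ∃ m, m ≠ 0 ∧ gridPos u s m = u + b • halfShift s := by
      intro b hb u
      refine ⟨Pi.single (axis s) b, fun h0 => hb (by simpa using congrFun h0 (axis s)), ?_⟩
      ext c
      simp only [gridPos, halfShift, Pi.add_apply, Pi.smul_apply, smul_eq_mul]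
      by_cases hc : c = axis s
      · subst hc; rw [Pi.single_eq_same, Pi.single_eq_same]
      · rw [Pi.single_eq_of_ne hc, Pi.single_eq_of_ne hc]; ring
    have h01 : ‖blockSum (czMatrix T hδ) (rect s u) (rect s (u + halfShift s))‖
        ≤ C * rectCard n s := by
      obtain ⟨m, hm, hm'⟩ := hne 1 one_ne_zero u
      have := hoff s u m hm
      rwa [hm', one_smul] at this
    have h10 : ‖blockSum (czMatrix T hδ) (rect s (u + halfShift s)) (rect s u)‖
        ≤ C * rectCard n s := by
      obtain ⟨m, hm, hm'⟩ := hne (-1) (by norm_num) (u + halfShift s)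
      have := hoff s (u + halfShift s) m hm
      rwa [hm', neg_one_smul, add_neg_cancel_right] at this
    have hcard : (rectCard n (s + 1) : ℝ) = 2 * rectCard n s := by
      rw [rectCard_succ]; push_cast; ring
    rw [hcard]
    refine (norm_add_le _ _).trans ((add_le_add ((norm_add_le _ _).trans (add_le_add
      ((norm_add_le _ _).trans (add_le_add h00 h10)) h01)) h11).trans (le_of_eq ?_))
    push_cast; ring

lemma biUnion_cell (hδ : 0 < δ) (s : ℕ) (u : Cell n) : ⋃ i ∈ rect s u, cell δ i
    = {x : EuclideanSpace ℝ (Fin n) | ∀ c, δ * u c ≤ x c ∧ x c < δ * (u c + side s c)} := by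
  ext x
  simp only [Set.mem_iUnion, mem_cell hδ, exists_prop, exists_eq_right']
  rw [mem_rect]
  refine forall_congr' fun c => ?_
  rw [le_cellOf_iff hδ, cellOf_lt_iff hδ]
  push_cast
  rfl

lemma enorm_czMatrix_le (hK : IsStandardKernel α CK K) (hT : IsSingularIntegral K T) (hδ : 0 < δ)
    {i j : Cell n} (hij : i ≠ j) : ‖czMatrix T hδ i j‖ₑ ≤ ENNReal.ofReal ((δ ^ n)⁻¹) * (CK *
      ∫⁻ x in cell δ i, ∫⁻ y in cell δ j, ENNReal.ofReal ((‖x - y‖ ^ n)⁻¹)) := by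
  rw [czMatrix, hT.pairing_cell hδ hij, enorm_smul, ← ofReal_norm (((δ ^ n)⁻¹ : ℝ)),
    Real.norm_of_nonneg (by positivity), ← lintegral_const_mul' _ _ ENNReal.coe_ne_top]
  gcongr
  refine (enorm_integral_le_lintegral_enorm _).trans (setLIntegral_mono' (measurableSet_cell i)
    fun x hx => ?_)
  rw [← lintegral_const_mul' _ _ ENNReal.coe_ne_top]
  refine (enorm_integral_le_lintegral_enorm _).trans (setLIntegral_mono' (measurableSet_cell j)
    fun y hy => ?_)
  have hxy : x ≠ y := by
    rintro rfl
    exact hij (((mem_cell hδ).1 hx).symm.trans ((mem_cell hδ).1 hy))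
  have := hK.size x y hxy
  rw [← ofReal_norm, ← ENNReal.ofReal_coe_nnreal, ← ENNReal.ofReal_mul (by positivity)]
  exact ENNReal.ofReal_le_ofReal (by rwa [← div_eq_mul_inv])

lemma side_le (s : ℕ) [NeZero n] (c : Fin n) : side s c ≤ 2 * 2 ^ (s / n) := by
  rw [side, ← pow_succ']
  refine pow_le_pow_right₀ (by norm_num) ?_
  rw [sideExp, ← Nat.add_div_right _ (NeZero.pos n)]
  exact Nat.div_le_div_right (by have := c.isLt; omega)

/-- The blocks off the diagonal are bounded by the size of the kernel. -/
lemma exists_norm_blockSum_le [NeZero n] : ∃ C : ℝ≥0, ∀ (𝕜 : Type*) [RCLike 𝕜] (α : ℝ) (CK : ℝ≥0)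
    (K : EuclideanSpace ℝ (Fin n) → EuclideanSpace ℝ (Fin n) → 𝕜)
    (T : stepFun n 𝕜 →ₗ[𝕜] (EuclideanSpace ℝ (Fin n) →ₘ[volume] 𝕜)),
    IsStandardKernel α CK K → IsSingularIntegral K T → ∀ (δ : ℝ) (hδ : 0 < δ) (s : ℕ)
    (u m : Cell n), m ≠ 0 →
    ‖blockSum (czMatrix T hδ) (rect s u) (rect s (gridPos u s m))‖ ≤ CK * C * rectCard n s := by
  obtain ⟨C, hC⟩ := lintegral_box_le (n := n)
  refine ⟨C, fun 𝕜 _ α CK K T hK hT δ hδ s u m hm => ?_⟩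
  set v := gridPos u s m with hv
  set F : EuclideanSpace ℝ (Fin n) → EuclideanSpace ℝ (Fin n) → ℝ≥0∞ :=
    fun x y => ENNReal.ofReal ((‖x - y‖ ^ n)⁻¹) with hF
  have hFm : Measurable (Function.uncurry F) := by
    simp only [hF, Function.uncurry_def]
    fun_prop
  have hFi : ∀ j : Cell n, Measurable fun x => ∫⁻ y in cell δ j, F x y :=
    fun j => Measurable.lintegral_prod_right' (f := Function.uncurry F) hFm
  obtain ⟨c₀, hc₀⟩ := Function.ne_iff.1 hm
  have hpos : (0 : ℝ) < (2 : ℝ) ^ (s / n) := by positivity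
  have hsides : ∀ (u : Cell n) c, δ * (u c + side s c) - δ * u c ≤ 2 * (δ * 2 ^ (s / n)) := by
    intro u c
    have h1 : (side s c : ℝ) ≤ 2 * 2 ^ (s / n) := by exact_mod_cast side_le s c
    nlinarith
  have hbox := hC (fun c => δ * u c) (fun c => δ * (u c + side s c)) (fun c => δ * v c)
    (fun c => δ * (v c + side s c)) (δ * 2 ^ (s / n)) (by positivity) (hsides u) (hsides v) (by
      refine ⟨c₀, ?_⟩
      have hs : (0 : ℝ) < side s c₀ := by exact_mod_cast side_pos s c₀
      have hvc : (v c₀ : ℝ) = u c₀ + m c₀ * side s c₀ := by rw [hv, gridPos]; push_cast; ring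
      rcases lt_or_gt_of_ne hc₀ with h | h
      · right
        have h' : (m c₀ : ℝ) ≤ -1 := by
          have : m c₀ ≤ -1 := by simp at h; omega
          exact_mod_cast this
        refine mul_le_mul_of_nonneg_left ?_ hδ.le
        rw [hvc]; nlinarith
      · left
        have h' : (1 : ℝ) ≤ m c₀ := by
          have : 1 ≤ m c₀ := by simp at h; omega
          exact_mod_cast this
        refine mul_le_mul_of_nonneg_left ?_ hδ.le
        rw [hvc]; nlinarith)
  rw [← biUnion_cell hδ, ← biUnion_cell hδ] at hbox
  have hdisj : ∀ P : Finset (Cell n), Set.PairwiseDisjoint (P : Set (Cell n)) (cell δ) :=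
    fun P i _ j _ hij => Set.disjoint_left.2 fun x hx hx' =>
      hij (((mem_cell hδ).1 hx).symm.trans ((mem_cell hδ).1 hx'))
  have hne : ∀ i ∈ rect s u, ∀ j ∈ rect s v, i ≠ j := by
    rintro i hi j hj rfl
    have h1 : blk u s i = 0 := mem_rect_gridPos.1 (by rw [gridPos_zero]; exact hi)
    have h2 : blk u s i = m := mem_rect_gridPos.1 hj
    exact hm (h2.symm.trans h1)
  have key : ‖blockSum (czMatrix T hδ) (rect s u) (rect s v)‖ₑ
      ≤ ENNReal.ofReal (CK * C * rectCard n s) := by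
    calc _ ≤ ∑ i ∈ rect s u, ∑ j ∈ rect s v, ‖czMatrix T hδ i j‖ₑ :=
          (enorm_sum_le _ _).trans (Finset.sum_le_sum fun i _ => enorm_sum_le _ _)
      _ ≤ ∑ i ∈ rect s u, ∑ j ∈ rect s v, ENNReal.ofReal ((δ ^ n)⁻¹) * (CK *
            ∫⁻ x in cell δ i, ∫⁻ y in cell δ j, F x y) :=
          Finset.sum_le_sum fun i hi => Finset.sum_le_sum fun j hj =>
            enorm_czMatrix_le hK hT hδ (hne i hi j hj)
      _ = ENNReal.ofReal ((δ ^ n)⁻¹) * (CK *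
            ∫⁻ x in ⋃ i ∈ rect s u, cell δ i, ∫⁻ y in ⋃ j ∈ rect s v, cell δ j, F x y) := by
          rw [lintegral_biUnion_finset (hdisj _) (fun i _ => measurableSet_cell i)]
          simp only [← Finset.mul_sum]
          congr 2
          refine Finset.sum_congr rfl fun i _ => ?_
          rw [← lintegral_finsetSum _ fun j _ => hFi j]
          refine lintegral_congr fun x => ?_
          rw [lintegral_biUnion_finset (hdisj _) (fun i _ => measurableSet_cell i)]
      _ ≤ ENNReal.ofReal ((δ ^ n)⁻¹) * (CK * (C * ENNReal.ofReal ((δ * 2 ^ (s / n)) ^ n))) := by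
          gcongr
      _ = ENNReal.ofReal ((δ ^ n)⁻¹ * (CK * (C * (δ * 2 ^ (s / n)) ^ n))) := by
          rw [ENNReal.ofReal_mul (by positivity), ENNReal.ofReal_mul (by positivity),
            ENNReal.ofReal_mul (by positivity), ENNReal.ofReal_coe_nnreal,
            ENNReal.ofReal_coe_nnreal]
      _ ≤ _ := by
          refine ENNReal.ofReal_le_ofReal ?_
          have h1 : ((2 : ℝ) ^ (s / n)) ^ n ≤ rectCard n s := by
            rw [rectCard_eq, ← pow_mul]
            push_cast
            exact pow_le_pow_right₀ (by norm_num) (Nat.div_mul_le_self s n)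
          calc _ = CK * C * ((2 : ℝ) ^ (s / n)) ^ n := by rw [mul_pow]; field_simp
            _ ≤ _ := by gcongr
  rw [← ofReal_norm, ENNReal.ofReal_le_ofReal_iff (by positivity)] at key
  exact key

lemma IsSingularIntegral.sum_sub_czMatrix (hT : IsSingularIntegral K T) (hδ : 0 < δ)
    (P Q : Finset (Cell n)) (v : Cell n) :
    ∑ j ∈ Q, ∑ i ∈ P, (czMatrix T hδ i j - czMatrix T hδ (i + v) j) = (δ ^ n)⁻¹ • pairing T
      (∑ i ∈ P, (cubeStep 𝕜 (cellCorner δ i) hδ - cubeStep 𝕜 (cellCorner δ (i + v)) hδ))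
      (∑ j ∈ Q, cubeStep 𝕜 (cellCorner δ j) hδ) := by
  rw [← hT.form_apply, map_sum (hT.form _), Finset.smul_sum]
  refine Finset.sum_congr rfl fun j _ => ?_
  rw [map_sum, LinearMap.sum_apply, Finset.smul_sum]
  refine Finset.sum_congr rfl fun i _ => ?_
  rw [map_sub, LinearMap.sub_apply, smul_sub]
  rfl

lemma IsSingularIntegral.sum_sub_czMatrix' (hT : IsSingularIntegral K T) (hδ : 0 < δ)
    (P Q : Finset (Cell n)) (v : Cell n) :
    ∑ i ∈ Q, ∑ j ∈ P, (czMatrix T hδ i j - czMatrix T hδ i (j + v)) = (δ ^ n)⁻¹ • pairing T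
      (∑ i ∈ Q, cubeStep 𝕜 (cellCorner δ i) hδ)
      (∑ j ∈ P, (cubeStep 𝕜 (cellCorner δ j) hδ - cubeStep 𝕜 (cellCorner δ (j + v)) hδ)) := by
  rw [← hT.form_apply, map_sum hT.form, LinearMap.sum_apply, Finset.smul_sum]
  refine Finset.sum_congr rfl fun i _ => ?_
  rw [map_sum, Finset.smul_sum]
  refine Finset.sum_congr rfl fun j _ => ?_
  rw [map_sub, smul_sub]
  rfl

lemma integral_cellStep (hδ : 0 < δ) (i : Cell n) :
    ∫ x, (cubeStep 𝕜 (cellCorner δ i) hδ : EuclideanSpace ℝ (Fin n) → 𝕜) x = (δ ^ n : ℝ) := by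
  have : (fun x => (cubeStep 𝕜 (cellCorner δ i) hδ : EuclideanSpace ℝ (Fin n) → 𝕜) x)
    = (cell δ i).indicator fun _ => 1 := rfl
  rw [this, integral_indicator (measurableSet_cell i), setIntegral_const, volume_cell_real hδ,
    RCLike.real_smul_eq_coe_mul, mul_one]

lemma integral_sum_sub_cellStep (hδ : 0 < δ) (P : Finset (Cell n)) (v : Cell n) :
    ∫ x, ((∑ i ∈ P, (cubeStep 𝕜 (cellCorner δ i) hδ - cubeStep 𝕜 (cellCorner δ (i + v)) hδ) :
      stepFun n 𝕜) : EuclideanSpace ℝ (Fin n) → 𝕜) x = 0 := by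
  have hint : ∀ f : stepFun n 𝕜, Integrable (f : EuclideanSpace ℝ (Fin n) → 𝕜) :=
    fun f => memLp_one_iff_integrable.1 (stepFun_memLp f 1)
  simp only [AddSubmonoidClass.coe_finsetSum, Finset.sum_apply]
  rw [integral_finsetSum _ fun i _ => hint _]
  refine Finset.sum_eq_zero fun i _ => ?_
  simp only [AddSubgroupClass.coe_sub, Pi.sub_apply]
  rw [integral_sub (hint _) (hint _), integral_cellStep, integral_cellStep, sub_self]

lemma centeredBox_sum_eq (hδ : 0 < δ) (k : ℕ) :
    ∑ j ∈ centeredBox n (k + 1), cubeStep 𝕜 (cellCorner δ j) hδ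
      = centeredStep 𝕜 n (R := δ * (k + 1)) (by positivity) := by
  refine sum_cellStep_eq hδ _ _ _ fun x => ?_
  rw [centeredBox, Fintype.mem_piFinset]
  refine forall_congr' fun c => ?_
  rw [Finset.mem_Ico, le_cellOf_iff hδ, cellOf_lt_iff hδ]
  push_cast
  refine and_congr (by rw [mul_neg]) (by
    rw [show -(δ * ((k : ℝ) + 1)) + 2 * (δ * (k + 1)) = δ * (k + 1) by ring])

/-- The radii of the centered cubes that are unions of cells. -/
lemma tendsto_centered_radius (hδ : 0 < δ) :
    Tendsto (fun k : ℕ => (⟨δ * (k + 1), Set.mem_Ioi.2 (by positivity)⟩ : Set.Ioi (0 : ℝ))) atTop atTop := by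
  rw [tendsto_Ioi_atTop]
  exact (tendsto_atTop_add_const_right _ _ tendsto_natCast_atTop_atTop).const_mul_atTop hδ

/-- The matrices of a Calderón–Zygmund operator satisfy the discrete conditions, with constants
independent of the mesh size. -/
lemma exists_isCellCZ_czMatrix [NeZero n] : ∃ C : ℝ≥0, ∀ (𝕜 : Type*) [RCLike 𝕜] (α : ℝ)
    (CK CW : ℝ≥0) (K : EuclideanSpace ℝ (Fin n) → EuclideanSpace ℝ (Fin n) → 𝕜)
    (T : stepFun n 𝕜 →ₗ[𝕜] (EuclideanSpace ℝ (Fin n) →ₘ[volume] 𝕜)), 0 < α →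
    IsStandardKernel α CK K → IsSingularIntegral K T → WeakBoundedness (CW : ℝ) T →
    VanishesOnOne T → AdjointVanishesOnOne T → ∀ (δ : ℝ) (hδ : 0 < δ),
    IsCellCZ α (CW + (n + 1) * (CK * C)) CK (czMatrix T hδ) := by
  obtain ⟨C, hC⟩ := exists_norm_blockSum_le.{_} (n := n)
  refine ⟨C, fun 𝕜 _ α CK CW K T hα hK hT hW hv hv' δ hδ => ⟨fun s u m => ?_,
    czMatrix_smooth hK hα hT hδ, czMatrix_adjoint_smooth hK hα hT hδ, fun P v => ?_,
    fun P v => ?_⟩⟩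
  -- on the diagonal, the rectangles of level `s` are reached from cubes in `s % n` steps
  · by_cases hm : m = 0
    · subst hm
      rw [gridPos_zero]
      have h1 := norm_blockSum_diag_le hT hW hδ (C := CK * C)
        (fun s u m hm => by
          have := hC 𝕜 α CK K T hK hT δ hδ s u m hm
          exact_mod_cast this) (s / n) (s % n) u
      rw [Nat.div_add_mod] at h1
      refine h1.trans ?_
      push_cast
      have : ((s % n : ℕ) : ℝ) ≤ n + 1 := by
        have := Nat.mod_lt s (NeZero.pos n)
        exact_mod_cast (by omega : s % n ≤ n + 1)
      gcongr
    · refine (hC 𝕜 α CK K T hK hT δ hδ s u m hm).trans ?_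
      push_cast
      gcongr
      have h1 : (0 : ℝ) ≤ CW := CW.2
      have h2 : (0 : ℝ) ≤ n * (CK * C) := by positivity
      linarith
  · rw [← tendsto_add_atTop_iff_nat 1]
    have := ((hv _ (integral_sum_sub_cellStep (𝕜 := 𝕜) hδ P v)).comp
      (tendsto_centered_radius hδ)).const_smul ((δ ^ n)⁻¹ : ℝ)
    rw [smul_zero] at this
    refine this.congr fun k => ?_
    rw [hT.sum_sub_czMatrix hδ, centeredBox_sum_eq]
    rfl
  · rw [← tendsto_add_atTop_iff_nat 1]
    have := ((hv' _ (integral_sum_sub_cellStep (𝕜 := 𝕜) hδ P v)).comp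
      (tendsto_centered_radius hδ)).const_smul ((δ ^ n)⁻¹ : ℝ)
    rw [smul_zero] at this
    refine this.congr fun k => ?_
    rw [hT.sum_sub_czMatrix' hδ, centeredBox_sum_eq]
    rfl

end OperatorMatrix

/-! ### The unconditionality constant on the lattice of cells -/

section UmdConst

variable {X : Type*} [NormedAddCommGroup X] [NormedSpace ℝ X] {p : ℝ≥0∞}

/-- On a σ-finite space, the unconditionality constant of a UMD space is finite. -/
lemma IsUMD.umdConst_lt_top (h : IsUMD X) (hp : 1 < p) (hp' : p < ∞) {S : Type}
    [MeasurableSpace S] (μ : Measure S) [SigmaFinite μ] : umdConst μ p X < ∞ := by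
  obtain ⟨B, hB, h⟩ := h p hp hp'
  exact (sInf_le (h S μ)).trans_lt hB

/-- The infimum in the definition of the unconditionality constant is attained. -/
lemma isUMDBound_umdConst {S : Type*} [MeasurableSpace S] (μ : Measure S)
    (hne : umdConst μ p X < ∞) : IsUMDBound μ p X (umdConst μ p X) := by
  obtain ⟨B₀, hB₀, hlt⟩ := sInf_lt_iff.1 hne
  intro ℱ d ε N h1 h2 h3 h4 h5
  set y := eLpNorm (fun s => ∑ k ∈ Finset.range N, d k s) p μ with hy
  have hytop : y ≠ ∞ := (memLp_finsetSum _ fun k _ => h3 k).eLpNorm_ne_top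
  have hle := fun B (hB : IsUMDBound μ p X B) => hB ℱ d ε N h1 h2 h3 h4 h5
  -- if `y = 0`, the inequality with one finite constant suffices
  rcases eq_or_ne y 0 with h0 | h0
  · have := hle B₀ hB₀
    rw [← hy, h0, mul_zero] at this
    rw [h0, mul_zero]
    exact this
  · rw [← ENNReal.div_le_iff_le_mul (Or.inl h0) (Or.inl hytop)]
    refine le_sInf fun B hB => ?_
    rw [ENNReal.div_le_iff_le_mul (Or.inl h0) (Or.inl hytop)]
    exact hle B hB

variable {n : ℕ} {δ : ℝ}

lemma map_cellOf (hδ : 0 < δ) :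
    (volume : Measure (EuclideanSpace ℝ (Fin n))).map (cellOf δ)
      = ENNReal.ofReal δ ^ n • (Measure.count : Measure (Cell n)) := by
  refine Measure.ext_of_singleton fun i => ?_
  rw [Measure.map_apply measurable_cellOf (measurableSet_singleton i), Measure.smul_apply,
    Measure.count_singleton, smul_eq_mul, mul_one, ← volume_cell i]
  congr 1
  ext x
  exact (mem_cell hδ).symm

/-- The unconditionality constant on `ℝⁿ` serves for the lattice, by mapping each point to the index
of the unit cell that contains it. -/
lemma IsUMD.isDiscreteUMDBound [CompleteSpace X] (h : IsUMD X) (hp : 1 < p) (hp' : p < ∞) :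
    IsDiscreteUMDBound (Cell n) p X
      (umdConst (volume : Measure (EuclideanSpace ℝ (Fin n))) p X) := by
  have h1 := (isUMDBound_umdConst _ (h.umdConst_lt_top hp hp'
    (volume : Measure (EuclideanSpace ℝ (Fin n))))).map (measurable_cellOf (δ := 1))
  rw [map_cellOf one_pos] at h1
  exact h1.discrete (by simp) (by simp) hp'.ne

omit [NormedSpace ℝ X] in
lemma eLpNorm_comp_cellOf (hδ : 0 < δ) (hp : p ≠ ∞) (u : Cell n → X) :
    eLpNorm (fun x => u (cellOf δ x)) p volume
      = (ENNReal.ofReal δ ^ n) ^ (1 / p).toReal * ellNorm p u := by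
  have h := eLpNorm_map_measure (μ := volume) (p := p)
    (StronglyMeasurable.of_discrete (f := u)).aestronglyMeasurable
    (measurable_cellOf (n := n) (δ := δ)).aemeasurable
  rw [map_cellOf hδ, eLpNorm_smul_measure_of_ne_top hp, smul_eq_mul, ← ellNorm_eq] at h
  exact h.symm

end UmdConst

/-! ### Averages over small cells -/

section Averages

variable {n : ℕ} {X : Type*} [NormedAddCommGroup X] [NormedSpace ℝ X] {δ : ℝ}

/-- The average over the cell that contains a point. -/
def cellAvg (δ : ℝ) (g : EuclideanSpace ℝ (Fin n) → X) (i : Cell n) : X :=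
  (δ ^ n)⁻¹ • ∫ x in cell δ i, g x

lemma cellAvg_eq_average (hδ : 0 < δ) (g : EuclideanSpace ℝ (Fin n) → X) (i : Cell n) :
    cellAvg δ g i = ⨍ x in Metric.closedBall (fun c => δ * i c + δ / 2) (δ / 2),
      g (WithLp.toLp 2 x) := by
  have hball : Metric.closedBall (fun c => δ * i c + δ / 2) (δ / 2)
      = Set.Icc (fun c => δ * i c) (fun c : Fin n => δ * i c + δ) := by
    rw [closedBall_pi _ (by positivity), ← Set.pi_univ_Icc]
    refine Set.pi_congr rfl fun c _ => ?_
    rw [Real.closedBall_eq_Icc]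
    congr 1 <;> ring
  have hae : (Metric.closedBall (fun c => δ * i c + δ / 2) (δ / 2) : Set (Fin n → ℝ))
      =ᵐ[volume] (WithLp.toLp 2 : (Fin n → ℝ) → _) ⁻¹' cell δ i := by
    have hset : (WithLp.toLp 2 : (Fin n → ℝ) → _) ⁻¹' cell δ i
        = Set.univ.pi fun c => Set.Ico (δ * i c) (δ * i c + δ) := by
      ext x
      simp [cell, cube, cellCorner_apply, Set.mem_pi]
    rw [hball, hset]
    exact Measure.univ_pi_Ico_ae_eq_Icc.symm
  have hm := (PiLp.volume_preserving_toLp (Fin n) : MeasurePreserving (WithLp.toLp 2) _ _)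
  have hv : volume.real (Metric.closedBall (fun c => δ * i c + δ / 2) (δ / 2)
      : Set (Fin n → ℝ)) = δ ^ n := by
    rw [measureReal_congr hae, measureReal_def,
      hm.measure_preimage (measurableSet_cell i).nullMeasurableSet, ← measureReal_def,
      volume_cell_real hδ]
  rw [setAverage_eq, hv, cellAvg, setIntegral_congr_set hae,
    hm.setIntegral_preimage_emb (MeasurableEquiv.toLp 2 (Fin n → ℝ)).measurableEmbedding]

/-- Lebesgue's differentiation theorem for cells. -/
lemma ae_tendsto_cellAvg [CompleteSpace X] {g : EuclideanSpace ℝ (Fin n) → X} (hg : LocallyIntegrable g)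
    {δ : ℕ → ℝ} (hδ : ∀ k, 0 < δ k) (hlim : Tendsto δ atTop (𝓝 0)) :
    ∀ᵐ x, Tendsto (fun k => cellAvg (δ k) g (cellOf (δ k) x)) atTop (𝓝 (g x)) := by
  have hm := (PiLp.volume_preserving_toLp (Fin n) : MeasurePreserving (WithLp.toLp 2) _ _)
  have hm' := (PiLp.volume_preserving_ofLp (Fin n) : MeasurePreserving (WithLp.ofLp (p := 2)) _ _)
  have hg' : LocallyIntegrable (fun x : Fin n → ℝ => g (WithLp.toLp 2 x)) := by
    rw [locallyIntegrable_iff] at hg ⊢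
    intro k hk
    have hcont : Continuous (WithLp.toLp 2 : (Fin n → ℝ) → EuclideanSpace ℝ (Fin n)) := by
      fun_prop
    have := (hm.integrableOn_comp_preimage
      (MeasurableEquiv.toLp 2 (Fin n → ℝ)).measurableEmbedding).2 (hg _ (hk.image hcont))
    exact this.mono_set (Set.subset_preimage_image _ _)
  have key := IsUnifLocDoublingMeasure.ae_tendsto_average volume hg' 1
  filter_upwards [hm'.quasiMeasurePreserving.ae key] with x hx
  have hlim' : Tendsto (fun k => δ k / 2) atTop (𝓝[>] 0) := by
    refine tendsto_nhdsWithin_iff.2 ⟨by simpa using hlim.div_const 2,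
      Eventually.of_forall fun k => half_pos (hδ k)⟩
  have := hx (fun k c => δ k * cellOf (δ k) x c + δ k / 2) _ hlim'
    (Eventually.of_forall fun k => ?_)
  · refine this.congr fun k => ?_
    rw [cellAvg_eq_average (hδ k)]
  · rw [one_mul, Metric.mem_closedBall, dist_pi_le_iff (half_pos (hδ k)).le]
    intro c
    have h1 := (mem_cell (hδ k)).2 (rfl : cellOf (δ k) x = _) c
    rw [cellCorner_apply] at h1
    rw [Real.dist_eq, abs_le]
    constructor <;> linarith [h1.1, h1.2]

end Averages

/-! ### Boundedness on step functions of one mesh size -/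

section OneMesh

variable {n : ℕ} {𝕜 : Type*} [RCLike 𝕜] {δ : ℝ}

/-- For the mesh size `δ`, the index of the cell that contains the cell of index `i` and mesh
size `δ / 2 ^ k`. -/
def parent (k : ℕ) (i : Cell n) : Cell n := fun c => i c / 2 ^ k

/-- The indices `i` with `parent k i = j`. -/
def children (k : ℕ) (j : Cell n) : Finset (Cell n) :=
  Fintype.piFinset fun c => Finset.Ico (j c * 2 ^ k) ((j c + 1) * 2 ^ k)

lemma mem_children {k : ℕ} {i j : Cell n} : i ∈ children k j ↔ parent k i = j := by
  have h : (0 : ℤ) < 2 ^ k := by positivity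
  simp only [children, Fintype.mem_piFinset, Finset.mem_Ico, funext_iff, parent]
  refine forall_congr' fun c => ?_
  rw [← Int.le_ediv_iff_mul_le h, ← Int.ediv_lt_iff_lt_mul h]
  omega

lemma parent_cellOf (hδ : 0 < δ) (k : ℕ) (x : EuclideanSpace ℝ (Fin n)) :
    parent k (cellOf (δ / 2 ^ k) x) = cellOf δ x := by
  have hδk : 0 < δ / 2 ^ k := by positivity
  funext c
  refine eq_of_forall_le_iff fun r => ?_
  rw [parent, Int.le_ediv_iff_mul_le (by positivity), le_cellOf_iff hδk, le_cellOf_iff hδ]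
  push_cast
  rw [show δ / 2 ^ k * (r * 2 ^ k) = δ * r by field_simp]

/-- The indicator of a cell as a step function. -/
def cellStep (𝕜 : Type*) [RCLike 𝕜] (hδ : 0 < δ) (j : Cell n) : stepFun n 𝕜 :=
  cubeStep 𝕜 (cellCorner δ j) hδ

lemma sum_children (hδ : 0 < δ) {k : ℕ} (hδk : 0 < δ / 2 ^ k) (j : Cell n) :
    ∑ i ∈ children k j, cellStep 𝕜 hδk i = cellStep 𝕜 hδ j :=
  sum_cellStep_eq _ _ _ _ fun x => by
    rw [mem_children, parent_cellOf hδ]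
    exact (mem_cell hδ).symm

variable {X : Type*} [NormedAddCommGroup X] [NormedSpace ℝ X] [NormedSpace 𝕜 X]
  {K : EuclideanSpace ℝ (Fin n) → EuclideanSpace ℝ (Fin n) → 𝕜}
  {T : stepFun n 𝕜 →ₗ[𝕜] (EuclideanSpace ℝ (Fin n) →ₘ[volume] 𝕜)}

/-- The image under `T ⊗ id` of the step function with value `h j` on the `j`-th cell. -/
def stepImage (T : stepFun n 𝕜 →ₗ[𝕜] (EuclideanSpace ℝ (Fin n) →ₘ[volume] 𝕜)) (hδ : 0 < δ)
    (h : Cell n →₀ X) (x : EuclideanSpace ℝ (Fin n)) : X :=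
  ∑ j ∈ h.support, T (cellStep 𝕜 hδ j) x • h j

omit [NormedSpace ℝ X] in
lemma IsSingularIntegral.locallyIntegrable_stepImage (hT : IsSingularIntegral K T) (hδ : 0 < δ)
    (h : Cell n →₀ X) : LocallyIntegrable (stepImage T hδ h) := by
  unfold stepImage
  refine locallyIntegrable_finsetSum _ fun j _ => ?_
  rw [locallyIntegrable_iff]
  intro k hk
  exact Integrable.smul_const (hT.locallyIntegrable _ |>.integrableOn_isCompact hk) _

/-- The averages of the image over smaller cells, in terms of the matrix of `T`. -/
lemma IsSingularIntegral.cellAvg_stepImage [IsScalarTower ℝ 𝕜 X] [CompleteSpace X]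
    (hT : IsSingularIntegral K T) (hδ : 0 < δ) {k : ℕ} (hδk : 0 < δ / 2 ^ k) (h : Cell n →₀ X)
    (i : Cell n) :
    cellAvg (δ / 2 ^ k) (stepImage T hδ h) i
      = ∑ᶠ i', czMatrix T hδk i i' • h (parent k i') := by
  classical
  have hsub : (Function.support fun i' => czMatrix T hδk i i' • h (parent k i'))
      ⊆ (h.support.biUnion (children k) : Finset (Cell n)) := by
    intro i' hi'
    have : h (parent k i') ≠ 0 := fun h0 => hi' (by simp [h0])
    simp only [Finset.coe_biUnion, Set.mem_iUnion, Finset.mem_coe]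
    exact ⟨_, Finsupp.mem_support_iff.2 this, mem_children.2 rfl⟩
  rw [finsum_eq_sum_of_support_subset _ hsub, Finset.sum_biUnion, cellAvg,
    show stepImage T hδ h = fun x => ∑ j ∈ h.support, T (cellStep 𝕜 hδ j) x • h j from rfl]
  · rw [integral_finsetSum, Finset.smul_sum]
    · refine Finset.sum_congr rfl fun j _ => ?_
      have h1 : ∀ i' ∈ children k j, czMatrix T hδk i i' • h (parent k i')
          = czMatrix T hδk i i' • h j := fun i' hi' => by rw [mem_children.1 hi']
      rw [Finset.sum_congr rfl h1, ← Finset.sum_smul, integral_smul_const, ← smul_assoc]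
      congr 1
      have h2 : ∫ x in cell (δ / 2 ^ k) i, T (cellStep 𝕜 hδ j) x
          = hT.form (cellStep 𝕜 hδk i) (cellStep 𝕜 hδ j) :=
        (pairing_cubeStep _ hδk _).symm
      rw [h2, ← sum_children hδ hδk, map_sum, Finset.smul_sum]
      rfl
    · exact fun j _ => Integrable.smul_const (hT.integrableOn_cube _ _ _) _
  · intro j _ j' _ hne
    rw [Function.onFun, Finset.disjoint_left]
    exact fun i' h1 h2 => hne ((mem_children.1 h1).symm.trans (mem_children.1 h2))

/-- The operator is bounded on the step functions of one mesh size: the averages of the image over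
smaller and smaller cells are bounded by the discrete estimate, uniformly in the mesh size. -/
lemma IsSingularIntegral.eLpNorm_stepImage_le [NeZero n] [IsScalarTower ℝ 𝕜 X] [CompleteSpace X]
    (hT : IsSingularIntegral K T) {p B : ℝ≥0∞} (hp : 1 ≤ p) (hp' : p ≠ ∞)
    (hB : IsDiscreteUMDBound (Cell n) p X B) {C₀ : ℝ≥0} {w : Cell n → ℝ≥0}
    (ha : ∀ (δ : ℝ) (hδ : 0 < δ), IsDyadicCZ (czMatrix T hδ) C₀ w) (hδ : 0 < δ)
    (h : Cell n →₀ X) :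
    eLpNorm (stepImage T hδ h) p volume
      ≤ (∑' m, 2 ^ n * (96 * (n * (ancestorLevel m + 2) + 1 : ℕ)) * (w m : ℝ≥0∞)) * B ^ 2
        * eLpNorm (fun x => h (cellOf δ x)) p volume := by
  have hδk : ∀ k : ℕ, 0 < δ / 2 ^ k := fun k => by positivity
  have hlim : Tendsto (fun k : ℕ => δ / 2 ^ k) atTop (𝓝 0) := by
    have := (tendsto_pow_atTop_nhds_zero_of_lt_one (r := (1 / 2 : ℝ)) (by norm_num)
      (by norm_num)).const_mul δ
    rw [mul_zero] at this
    refine this.congr fun k => ?_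
    rw [one_div, inv_pow, div_eq_mul_inv]
  have hloc := hT.locallyIntegrable_stepImage hδ h
  -- the averages over small cells converge to the image almost everywhere
  refine Lp.eLpNorm_le_of_ae_tendsto
    (f := fun k x => cellAvg (δ / 2 ^ k) (stepImage T hδ h) (cellOf (δ / 2 ^ k) x))
    (Eventually.of_forall fun k => ?_)
    (fun k => ((StronglyMeasurable.of_discrete
      (f := cellAvg (δ / 2 ^ k) (stepImage T hδ h))).comp_measurable
      measurable_cellOf).aestronglyMeasurable)
    (ae_tendsto_cellAvg hloc hδk hlim)
  have hnorm : eLpNorm (fun x : EuclideanSpace ℝ (Fin n) => h (cellOf δ x)) p volume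
      = (ENNReal.ofReal (δ / 2 ^ k) ^ n) ^ (1 / p).toReal
        * ellNorm p fun i => h (parent k i) := by
    rw [← eLpNorm_comp_cellOf (hδk k) hp']
    simp only [parent_cellOf hδ]
  -- the volume of the small cells is a common factor of both sides
  rw [eLpNorm_comp_cellOf (hδk k) hp', hnorm, mul_left_comm]
  gcongr
  have hfin : (Function.support fun i => h (parent k i)).Finite := by
    classical
    refine (h.support.biUnion (children k)).finite_toSet.subset fun i hi => ?_
    simp only [Finset.coe_biUnion, Set.mem_iUnion, Finset.mem_coe]
    exact ⟨_, Finsupp.mem_support_iff.2 hi, mem_children.2 rfl⟩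
  have := (ha _ (hδk k)).ellNorm_le hp hp' hB ancestorLevel abs_le_two_pow
    (fun i => h (parent k i)) hfin
  refine le_of_eq_of_le ?_ this
  congr 1
  funext i
  exact hT.cellAvg_stepImage hδ (hδk k) h i

end OneMesh

/-! ### Sampling at the corners of small dyadic cells -/

section Sampling

variable {n : ℕ}

/-- The mesh size of the dyadic cells of level `N`. -/
def mesh (N : ℕ) : ℝ := 1 / 2 ^ N

lemma mesh_pos (N : ℕ) : 0 < mesh N := by unfold mesh; positivity

lemma mesh_le_one (N : ℕ) : mesh N ≤ 1 := by
  unfold mesh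
  exact div_le_one_of_le₀ (one_le_pow₀ one_le_two) (by positivity)

lemma mesh_add (M k : ℕ) : mesh (M + k) = mesh M / 2 ^ k := by
  unfold mesh
  rw [pow_add, div_div]

lemma tendsto_mesh : Tendsto mesh atTop (𝓝 0) := by
  have := tendsto_pow_atTop_nhds_zero_of_lt_one (r := (1 / 2 : ℝ)) (by norm_num) (by norm_num)
  refine this.congr fun k => ?_
  rw [mesh, one_div, one_div, inv_pow]

/-- The lower corner of the dyadic cell of level `N` that contains `x`. -/
def corner (N : ℕ) (x : EuclideanSpace ℝ (Fin n)) : EuclideanSpace ℝ (Fin n) :=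
  cellCorner (mesh N) (cellOf (mesh N) x)

lemma corner_le (N : ℕ) (x : EuclideanSpace ℝ (Fin n)) (c : Fin n) :
    corner N x c ≤ x c ∧ x c < corner N x c + mesh N :=
  (mem_cell (mesh_pos N)).2 (rfl : cellOf (mesh N) x = _) c

lemma tendsto_corner (x : EuclideanSpace ℝ (Fin n)) :
    Tendsto (fun N => corner N x) atTop (𝓝 x) := by
  have h : Tendsto (fun N => WithLp.ofLp (corner N x)) atTop (𝓝 (WithLp.ofLp x)) := by
    refine tendsto_pi_nhds.2 fun c => ?_
    refine tendsto_of_tendsto_of_tendsto_of_le_of_le (g := fun N => x c - mesh N)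
      (h := fun _ => x c) ?_ tendsto_const_nhds (fun N => ?_) (fun N => (corner_le N x c).1)
    · simpa using tendsto_mesh.const_sub (x c)
    · have := (corner_le N x c).2
      simp only
      linarith
  have hc : Continuous (WithLp.toLp 2 : (Fin n → ℝ) → EuclideanSpace ℝ (Fin n)) := by fun_prop
  exact (hc.tendsto _).comp h

lemma cellOf_cellCorner {δ : ℝ} (hδ : 0 < δ) (i : Cell n) : cellOf δ (cellCorner δ i) = i := by
  funext c
  rw [cellOf, cellCorner_apply, mul_div_cancel_left₀ _ hδ.ne', Int.floor_intCast]

/-- Dyadic cells are nested, and so `x` and `corner N x` lie in the same cell of every coarser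
level. -/
lemma cellOf_corner {M N : ℕ} (h : M ≤ N) (x : EuclideanSpace ℝ (Fin n)) :
    cellOf (mesh M) (corner N x) = cellOf (mesh M) x := by
  obtain ⟨k, rfl⟩ := Nat.exists_eq_add_of_le h
  rw [← parent_cellOf (mesh_pos M) k, ← parent_cellOf (mesh_pos M) k x, ← mesh_add, corner,
    cellOf_cellCorner (mesh_pos _)]

variable {X : Type*} [NormedAddCommGroup X]

lemma measurable_comp_corner (N : ℕ) (F : EuclideanSpace ℝ (Fin n) → X) :
    StronglyMeasurable fun x => F (corner N x) :=
  (StronglyMeasurable.of_discrete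
    (f := fun i : Cell n => F (cellCorner (mesh N) i))).comp_measurable measurable_cellOf

/-- If `F` vanishes off `[-R, R]ⁿ`, then its samples vanish off a larger cube. -/
lemma comp_corner_eq_zero {F : EuclideanSpace ℝ (Fin n) → X} {R : ℝ}
    (hR : ∀ x c, R < |x c| → F x = 0) (N : ℕ) {x : EuclideanSpace ℝ (Fin n)}
    (hx : x ∉ cube (WithLp.toLp 2 fun _ : Fin n => -(R + 2)) (2 * (R + 2))) :
    F (corner N x) = 0 ∧ F x = 0 := by
  simp only [cube, Set.mem_ofPred_eq, not_forall] at hx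
  obtain ⟨c, hc⟩ := hx
  have h1 := corner_le N x c
  have h2 := mesh_le_one N
  have h3 : R + 1 < |x c| := by
    by_contra! h
    obtain ⟨h5, h6⟩ := abs_le.1 h
    exact hc ⟨by linarith, by linarith⟩
  refine ⟨hR _ c ?_, hR _ c (by linarith)⟩
  rcases abs_cases (x c) with ⟨h, _⟩ | ⟨h, _⟩ <;>
  rcases abs_cases (corner N x c) with ⟨h', _⟩ | ⟨h', _⟩ <;> linarith

/-- The samples of a bounded, almost everywhere continuous function of bounded support converge to
it in `L^p`. -/
lemma tendsto_eLpNorm_comp_corner_sub {p : ℝ≥0∞} (hp : p ≠ 0) (hp' : p ≠ ∞)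
    {F : EuclideanSpace ℝ (Fin n) → X} (hF : AEStronglyMeasurable F volume) {M R : ℝ}
    (hM : ∀ x, ‖F x‖ ≤ M) (hR : ∀ x c, R < |x c| → F x = 0)
    (hcont : ∀ᵐ x, ContinuousAt F x) :
    Tendsto (fun N => eLpNorm (fun x => F (corner N x) - F x) p volume) atTop (𝓝 0) := by
  have hpos := ENNReal.toReal_pos hp hp'
  simp only [eLpNorm_eq_lintegral_rpow_enorm_toReal hp hp']
  have key : Tendsto (fun N => ∫⁻ x, ‖F (corner N x) - F x‖ₑ ^ p.toReal) atTop
      (𝓝 (∫⁻ _ : EuclideanSpace ℝ (Fin n), 0)) := by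
    set S := cube (WithLp.toLp 2 fun _ : Fin n => -(R + 2)) (2 * (R + 2)) with hS
    refine tendsto_lintegral_of_dominated_convergence'
      (S.indicator fun _ => ENNReal.ofReal (M + M) ^ p.toReal) (fun N => ?_) (fun N => ?_) ?_ ?_
    · exact ((measurable_comp_corner N F).aestronglyMeasurable.sub hF).enorm.pow_const _
    · refine Eventually.of_forall fun x => ?_
      beta_reduce
      by_cases hx : x ∈ S
      · rw [Set.indicator_of_mem hx]
        gcongr
        rw [← ofReal_norm]
        exact ENNReal.ofReal_le_ofReal ((norm_sub_le _ _).trans (add_le_add (hM _) (hM _)))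
      · have := comp_corner_eq_zero hR N hx
        rw [this.1, this.2]
        simp [hpos]
    · rw [lintegral_indicator (measurableSet_cube _ _), setLIntegral_const]
      exact ENNReal.mul_ne_top (ENNReal.rpow_ne_top_of_nonneg hpos.le ENNReal.ofReal_ne_top)
        (volume_cube_lt_top _ _).ne
    · filter_upwards [hcont] with x hx
      have h1 : Tendsto (fun N => F (corner N x) - F x) atTop (𝓝 0) := by
        simpa using (hx.tendsto.comp (tendsto_corner x)).sub_const (F x)
      have h2 := (h1.enorm).ennrpow_const p.toReal
      simpa [hpos] using h2
  have := key.ennrpow_const (1 / p.toReal)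
  simpa [hpos] using this

lemma finite_support_corner {F : EuclideanSpace ℝ (Fin n) → X} {R : ℝ}
    (hR : ∀ x c, R < |x c| → F x = 0) {δ : ℝ} (hδ : 0 < δ) :
    (Function.support fun i => F (cellCorner δ i)).Finite := by
  set m : ℤ := ⌈R / δ⌉ with hm
  refine (Set.finite_Icc (fun _ : Fin n => -m) fun _ => m).subset fun i hi => ?_
  have : ∀ c, |i c| ≤ m := by
    intro c
    by_contra! h
    refine hi (hR _ c ?_)
    have h1 : R / δ < |(i c : ℝ)| := (Int.le_ceil _).trans_lt (by exact_mod_cast h)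
    rw [cellCorner_apply, abs_mul, abs_of_pos hδ]
    rwa [div_lt_iff₀' hδ] at h1
  exact ⟨fun c => (abs_le.1 (this c)).1, fun c => (abs_le.1 (this c)).2⟩

end Sampling

/-! ### Extension to `L^p` by density -/

section Extension

variable {n : ℕ} {𝕜 : Type*} [RCLike 𝕜] {X : Type*} [NormedAddCommGroup X] [NormedSpace 𝕜 X]
  {p : ℝ≥0∞} {T : stepFun n 𝕜 →ₗ[𝕜] (EuclideanSpace ℝ (Fin n) →ₘ[volume] 𝕜)}

lemma coeFn_stepTensor (f : stepFun n 𝕜) (x : X) :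
    (stepTensor p f x : EuclideanSpace ℝ (Fin n) → X)
      =ᵐ[volume] fun t => (f : EuclideanSpace ℝ (Fin n) → 𝕜) t • x :=
  MemLp.coeFn_toLp _

variable (𝕜 X p n) in
/-- The elementary tensors as a bilinear map. -/
def tensorMap : stepFun n 𝕜 →ₗ[𝕜] X →ₗ[𝕜] Lp X p (volume : Measure (EuclideanSpace ℝ (Fin n))) :=
  LinearMap.mk₂ 𝕜 (stepTensor p)
    (fun f g x => by
      rw [stepTensor, stepTensor, stepTensor, ← MemLp.toLp_add]
      exact MemLp.toLp_congr _ _ (Eventually.of_forall fun t => add_smul _ _ _))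
    (fun r f x => by
      rw [stepTensor, stepTensor, ← MemLp.toLp_const_smul]
      exact MemLp.toLp_congr _ _ (Eventually.of_forall fun t => mul_smul _ _ _))
    (fun f x y => by
      rw [stepTensor, stepTensor, stepTensor, ← MemLp.toLp_add]
      exact MemLp.toLp_congr _ _ (Eventually.of_forall fun t => smul_add _ _ _))
    (fun r f x => by
      rw [stepTensor, stepTensor, ← MemLp.toLp_const_smul]
      exact MemLp.toLp_congr _ _ (Eventually.of_forall fun t => smul_comm _ _ _))

lemma coeFn_map_add_smul (f g : stepFun n 𝕜) (x : X) :
    (fun t => T (f + g) t • x) =ᵐ[volume] fun t => T f t • x + T g t • x := by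
  rw [map_add]
  filter_upwards [AEEqFun.coeFn_add (T f) (T g)] with t ht
  rw [ht, Pi.add_apply, add_smul]

lemma coeFn_map_smul_smul (r : 𝕜) (f : stepFun n 𝕜) (x : X) :
    (fun t => T (r • f) t • x) =ᵐ[volume] fun t => r • T f t • x := by
  rw [map_smul]
  filter_upwards [AEEqFun.coeFn_smul r (T f)] with t ht
  rw [ht, Pi.smul_apply, smul_assoc]

lemma coeFn_map_zero_smul (x : X) : (fun t => T 0 t • x) =ᵐ[volume] fun _ => 0 := by
  rw [map_zero]
  filter_upwards [AEEqFun.coeFn_zero (μ := (volume : Measure (EuclideanSpace ℝ (Fin n))))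
    (β := 𝕜)] with t ht
  rw [ht, Pi.zero_apply, zero_smul]

variable (T X p) in
/-- The step functions `f` for which all the functions `(T f)(·) x` belong to `L^p`. -/
def memLpStep : Submodule 𝕜 (stepFun n 𝕜) where
  carrier := {f | ∀ x : X, MemLp (fun t => T f t • x) p volume}
  zero_mem' x := (memLp_congr_ae (coeFn_map_zero_smul x)).2 MemLp.zero'
  add_mem' hf hg x := (memLp_congr_ae (coeFn_map_add_smul _ _ x)).2 ((hf x).add (hg x))
  smul_mem' r _ hf x := (memLp_congr_ae (coeFn_map_smul_smul r _ x)).2 ((hf x).const_smul r)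

variable (T X p) in
/-- The bilinear map `(f, x) ↦ (T f)(·) x`. -/
def imageMap : memLpStep X p T →ₗ[𝕜] X →ₗ[𝕜]
    Lp X p (volume : Measure (EuclideanSpace ℝ (Fin n))) :=
  LinearMap.mk₂ 𝕜 (fun f x => (f.2 x).toLp)
    (fun f g x => by
      rw [← MemLp.toLp_add]
      exact MemLp.toLp_congr _ _ (coeFn_map_add_smul _ _ x))
    (fun r f x => by
      rw [← MemLp.toLp_const_smul]
      exact MemLp.toLp_congr _ _ (coeFn_map_smul_smul r _ x))
    (fun f x y => by
      rw [← MemLp.toLp_add]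
      exact MemLp.toLp_congr _ _ (Eventually.of_forall fun t => smul_add _ _ _))
    (fun r f x => by
      rw [← MemLp.toLp_const_smul]
      exact MemLp.toLp_congr _ _ (Eventually.of_forall fun t => smul_comm _ _ _))

variable (T) in
/-- The step functions on which an operator on `L^p` agrees with `T`. -/
def agreeStep [Fact (1 ≤ p)] (U : Lp X p (volume : Measure (EuclideanSpace ℝ (Fin n))) →L[𝕜]
    Lp X p (volume : Measure (EuclideanSpace ℝ (Fin n)))) : Submodule 𝕜 (stepFun n 𝕜) where
  carrier := {f | ∀ x : X, (U (stepTensor p f x) : EuclideanSpace ℝ (Fin n) → X)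
    =ᵐ[volume] fun t => T f t • x}
  zero_mem' x := by
    have : stepTensor p (0 : stepFun n 𝕜) x = 0 := LinearMap.map_zero₂ (tensorMap n 𝕜 X p) x
    rw [this, map_zero]
    exact (Lp.coeFn_zero X p volume).trans (coeFn_map_zero_smul x).symm
  add_mem' {f g} hf hg x := by
    have : stepTensor p (f + g) x = stepTensor p f x + stepTensor p g x :=
      LinearMap.map_add₂ (tensorMap n 𝕜 X p) f g x
    rw [this, map_add]
    exact (Lp.coeFn_add _ _).trans (((hf x).add (hg x)).trans (coeFn_map_add_smul f g x).symm)
  smul_mem' r f hf x := by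
    have : stepTensor p (r • f) x = r • stepTensor p f x :=
      LinearMap.map_smul₂ (tensorMap n 𝕜 X p) r f x
    rw [this, map_smul]
    exact (Lp.coeFn_smul _ _).trans (((hf x).const_smul r).trans
      (coeFn_map_smul_smul r f x).symm)

lemma mem_agreeStep_iff [Fact (1 ≤ p)]
    {U : Lp X p (volume : Measure (EuclideanSpace ℝ (Fin n))) →L[𝕜]
      Lp X p (volume : Measure (EuclideanSpace ℝ (Fin n)))} {f : stepFun n 𝕜} :
    f ∈ agreeStep T U ↔ ∀ x : X, (U (stepTensor p f x) : EuclideanSpace ℝ (Fin n) → X)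
      =ᵐ[volume] fun t => T f t • x := Iff.rfl

lemma stepImage_single {δ : ℝ} (hδ : 0 < δ) (j : Cell n) (x : X) :
    stepImage T hδ (Finsupp.single j x) = fun t => T (cellStep 𝕜 hδ j) t • x := by
  funext t
  exact Finsupp.sum_single_index (h := fun j v => T (cellStep 𝕜 hδ j) t • v) (smul_zero _)

lemma stepImage_add {δ : ℝ} (hδ : 0 < δ) (h h' : Cell n →₀ X) :
    stepImage T hδ (h + h') = stepImage T hδ h + stepImage T hδ h' := by
  funext t
  exact Finsupp.sum_add_index' (h := fun j v => T (cellStep 𝕜 hδ j) t • v)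
    (fun _ => smul_zero _) fun _ _ _ => smul_add _ _ _

lemma cellStep_apply {δ : ℝ} (hδ : 0 < δ) (j : Cell n) (t : EuclideanSpace ℝ (Fin n)) :
    (cellStep 𝕜 hδ j : EuclideanSpace ℝ (Fin n) → 𝕜) t = if cellOf δ t = j then 1 else 0 := by
  have := sum_cellStep_apply (𝕜 := 𝕜) hδ {j} t
  rwa [Finset.sum_singleton, ite_congr (Finset.mem_singleton.eq) (fun _ => rfl) fun _ => rfl] at this

variable (𝕜 X p n) in
/-- Formal combinations of elementary tensors over dyadic cells, as elements of `L^p`. -/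
def dyadicTensor : (ℕ × Cell n →₀ X) →ₗ[𝕜]
    Lp X p (volume : Measure (EuclideanSpace ℝ (Fin n))) :=
  Finsupp.lsum 𝕜 fun q => tensorMap n 𝕜 X p (cellStep 𝕜 (mesh_pos q.1) q.2)

lemma coeFn_dyadicTensor (N : ℕ) (h : Cell n →₀ X) :
    (dyadicTensor n 𝕜 X p (h.mapDomain (Prod.mk N)) : EuclideanSpace ℝ (Fin n) → X)
      =ᵐ[volume] fun t => h (cellOf (mesh N) t) := by
  induction h using Finsupp.induction_linear with
  | zero =>
    rw [Finsupp.mapDomain_zero, map_zero]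
    exact Lp.coeFn_zero X p volume
  | add f g hf hg =>
    rw [Finsupp.mapDomain_add, map_add]
    exact (Lp.coeFn_add _ _).trans (hf.add hg)
  | single j x =>
    rw [Finsupp.mapDomain_single, dyadicTensor, Finsupp.lsum_single]
    refine (coeFn_stepTensor _ _).trans (Eventually.of_forall fun t => ?_)
    beta_reduce
    rw [cellStep_apply]
    by_cases ht : cellOf (mesh N) t = j <;> simp [ht]

/-- Combinations of elementary tensors over dyadic cells are dense, because continuous functions
of compact support are, and these are limits of their samples. -/
lemma denseRange_dyadicTensor [NormedSpace ℝ X] [Fact (1 ≤ p)] (hp' : p ≠ ∞) :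
    DenseRange (dyadicTensor n 𝕜 X p) := by
  have hp : p ≠ 0 := (zero_lt_one.trans_le (Fact.out : 1 ≤ p)).ne'
  intro g
  refine Metric.mem_closure_iff.2 fun ε hε => ?_
  have hε2 : ENNReal.ofReal (ε / 2) ≠ 0 := by simpa using hε
  obtain ⟨F, hFc, hFg, hF, hFm⟩ := (Lp.memLp g).exists_hasCompactSupport_eLpNorm_sub_le hp' hε2
  obtain ⟨R, hR⟩ := hFc.isBounded.exists_norm_le
  have hR' : ∀ x c, R < |x c| → F x = 0 := by
    intro x c hx
    by_contra h
    have h1 := hR x (subset_tsupport F h)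
    have h2 := PiLp.norm_apply_le x c
    rw [Real.norm_eq_abs] at h2
    linarith
  obtain ⟨M, hM⟩ := hF.bounded_above_of_compact_support hFc
  have hlim := tendsto_eLpNorm_comp_corner_sub hp hp' hF.aestronglyMeasurable hM hR'
    (Eventually.of_forall fun x => hF.continuousAt)
  obtain ⟨N, hN⟩ := (hlim.eventually_lt_const (pos_iff_ne_zero.2 hε2)).exists
  set h : Cell n →₀ X := Finsupp.ofSupportFinite (fun i => F (cellCorner (mesh N) i))
    (finite_support_corner hR' (mesh_pos N)) with hh
  refine ⟨_, ⟨h.mapDomain (Prod.mk N), rfl⟩, ?_⟩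
  rw [Lp.dist_def]
  refine ENNReal.toReal_lt_of_lt_ofReal ?_
  have e1 : (g : EuclideanSpace ℝ (Fin n) → X)
      - (dyadicTensor n 𝕜 X p (h.mapDomain (Prod.mk N)) : EuclideanSpace ℝ (Fin n) → X) =ᵐ[volume]
      ((g : EuclideanSpace ℝ (Fin n) → X) - F) - fun x => F (corner N x) - F x := by
    filter_upwards [coeFn_dyadicTensor (𝕜 := 𝕜) (p := p) N h] with x hx
    simp only [Pi.sub_apply]
    rw [hx]
    change _ - F (corner N x) = _
    abel
  rw [eLpNorm_congr_ae e1]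
  refine lt_of_le_of_lt (eLpNorm_sub_le ((Lp.aestronglyMeasurable g).sub hF.aestronglyMeasurable)
    ((measurable_comp_corner N F).aestronglyMeasurable.sub hF.aestronglyMeasurable) Fact.out) ?_
  refine (ENNReal.add_lt_add_of_le_of_lt (ne_top_of_le_ne_top ENNReal.ofReal_ne_top hFg) hFg
    hN).trans_eq ?_
  rw [← ENNReal.ofReal_add (by positivity) (by positivity), add_halves]

/-- A formal combination over cells of several levels can be replaced by one over the cells of a
single level, without changing the element of `L^p` or the value of a bilinear map. -/
lemma eventually_exists_dyadicTensor_eq {Y : Type*} [AddCommGroup Y] [Module 𝕜 Y]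
    (φ : Submodule 𝕜 (stepFun n 𝕜)) (hφ : ∀ N j, cellStep 𝕜 (mesh_pos N) j ∈ φ)
    (B : φ →ₗ[𝕜] X →ₗ[𝕜] Y) (w : ℕ × Cell n →₀ X) :
    ∀ᶠ N in atTop, ∃ h : Cell n →₀ X,
      dyadicTensor n 𝕜 X p w = dyadicTensor n 𝕜 X p (h.mapDomain (Prod.mk N)) ∧
      Finsupp.lsum 𝕜 (fun q => B ⟨_, hφ q.1 q.2⟩) w
        = Finsupp.lsum 𝕜 (fun q => B ⟨_, hφ q.1 q.2⟩) (h.mapDomain (Prod.mk N)) := by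
  induction w using Finsupp.induction_linear with
  | zero => exact Eventually.of_forall fun N => ⟨0, by simp, by simp⟩
  | add f g hf hg =>
    filter_upwards [hf, hg] with N hf hg
    obtain ⟨h, h1, h2⟩ := hf
    obtain ⟨h', h1', h2'⟩ := hg
    refine ⟨h + h', ?_, ?_⟩
    · rw [Finsupp.mapDomain_add, map_add, map_add, h1, h1']
    · rw [Finsupp.mapDomain_add, map_add, map_add, h2, h2']
  | single q x =>
    obtain ⟨M, j⟩ := q
    filter_upwards [eventually_ge_atTop M] with N hN
    obtain ⟨k, rfl⟩ := Nat.exists_eq_add_of_le hN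
    have hsum : ∑ i ∈ children k j, cellStep 𝕜 (mesh_pos (M + k)) i = cellStep 𝕜 (mesh_pos M) j := by
      have := sum_children (𝕜 := 𝕜) (mesh_pos M) (by rw [← mesh_add]; exact mesh_pos _ :
        0 < mesh M / 2 ^ k) j
      simpa only [← mesh_add] using this
    refine ⟨∑ i ∈ children k j, Finsupp.single i x, ?_, ?_⟩
    · rw [Finsupp.mapDomain_finsetSum, map_sum]
      simp only [Finsupp.mapDomain_single, dyadicTensor, Finsupp.lsum_single]
      rw [← LinearMap.sum_apply, ← map_sum, hsum]
    · rw [Finsupp.mapDomain_finsetSum, map_sum]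
      simp only [Finsupp.mapDomain_single, Finsupp.lsum_single]
      rw [← LinearMap.sum_apply, ← map_sum]
      congr 2
      refine Subtype.ext ?_
      rw [AddSubmonoidClass.coe_finsetSum]
      exact hsum.symm

/-- An operator that is bounded, with one constant, on the step functions of each mesh size extends
to `L^p`. -/
lemma exists_extension [NormedSpace ℝ X] [CompleteSpace X] [Fact (1 ≤ p)] (hp' : p ≠ ∞) {A : ℝ≥0∞}
    (hA : A ≠ ∞)
    (hb : ∀ (δ : ℝ) (hδ : 0 < δ) (h : Cell n →₀ X), eLpNorm (stepImage T hδ h) p volume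
      ≤ A * eLpNorm (fun x => h (cellOf δ x)) p volume) :
    ∃ U : Lp X p (volume : Measure (EuclideanSpace ℝ (Fin n))) →L[𝕜]
        Lp X p (volume : Measure (EuclideanSpace ℝ (Fin n))),
      (∀ N j, cellStep 𝕜 (mesh_pos N) j ∈ agreeStep T U) ∧ ‖U‖ₑ ≤ A := by
  have hmem : ∀ N j, cellStep 𝕜 (mesh_pos N) j ∈ memLpStep X p T := by
    intro N j x
    refine ⟨(AEEqFun.aestronglyMeasurable _).smul_const x, ?_⟩
    rw [← stepImage_single (mesh_pos N)]
    refine (hb _ _ _).trans_lt (ENNReal.mul_lt_top hA.lt_top ?_)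
    rw [← eLpNorm_congr_ae (coeFn_dyadicTensor (𝕜 := 𝕜) (p := p) N _)]
    exact Lp.eLpNorm_lt_top _
  set e := dyadicTensor n 𝕜 X p with he
  set f : (ℕ × Cell n →₀ X) →ₗ[𝕜] Lp X p (volume : Measure (EuclideanSpace ℝ (Fin n))) :=
    Finsupp.lsum 𝕜 fun q => imageMap X p T ⟨_, hmem q.1 q.2⟩ with hf
  have hf' : ∀ N (h : Cell n →₀ X), (f (h.mapDomain (Prod.mk N)) : EuclideanSpace ℝ (Fin n) → X)
      =ᵐ[volume] stepImage T (mesh_pos N) h := by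
    intro N h
    induction h using Finsupp.induction_linear with
    | zero =>
      rw [Finsupp.mapDomain_zero, map_zero]
      exact Lp.coeFn_zero X p volume
    | add f g hf hg =>
      rw [Finsupp.mapDomain_add, map_add, stepImage_add]
      exact (Lp.coeFn_add _ _).trans (hf.add hg)
    | single j x =>
      rw [Finsupp.mapDomain_single, hf, Finsupp.lsum_single, stepImage_single]
      exact MemLp.coeFn_toLp (hmem N j x)
  have hle : ∀ w, ‖f w‖ ≤ A.toReal * ‖e w‖ := by
    intro w
    obtain ⟨N, h, h1, h2⟩ :=
      (eventually_exists_dyadicTensor_eq (p := p) _ hmem (imageMap X p T) w).exists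
    rw [he, hf, h1, h2, ← hf, Lp.norm_def, Lp.norm_def, ← ENNReal.toReal_mul,
      eLpNorm_congr_ae (hf' N h)]
    refine ENNReal.toReal_mono (ENNReal.mul_ne_top hA (Lp.eLpNorm_ne_top _)) ?_
    rw [eLpNorm_congr_ae (coeFn_dyadicTensor N h)]
    exact hb _ _ _
  have hdense : DenseRange e := denseRange_dyadicTensor hp'
  refine ⟨f.extendOfNorm e, fun N j x => ?_, ?_⟩
  · have h1 : stepTensor p (cellStep 𝕜 (mesh_pos N) j) x = e (Finsupp.single (N, j) x) := by
      rw [he, dyadicTensor, Finsupp.lsum_single]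
      rfl
    rw [h1, LinearMap.extendOfNorm_eq hdense ⟨_, hle⟩, hf, Finsupp.lsum_single]
    exact MemLp.coeFn_toLp (hmem N j x)
  · have := LinearMap.opNorm_extendOfNorm_le hdense ENNReal.toReal_nonneg hle
    rw [← ofReal_norm]
    exact (ENNReal.ofReal_le_ofReal this).trans_eq (ENNReal.ofReal_toReal hA)

end Extension

/-! ### Arbitrary cubes as limits of unions of dyadic cells -/

section DyadicApproximation

variable {n : ℕ} {𝕜 : Type*} [RCLike 𝕜] {α : ℝ} {CK : ℝ≥0}
  {K : EuclideanSpace ℝ (Fin n) → EuclideanSpace ℝ (Fin n) → 𝕜}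
  {T : stepFun n 𝕜 →ₗ[𝕜] (EuclideanSpace ℝ (Fin n) →ₘ[volume] 𝕜)}

lemma ae_apply_ne (r : Fin n → ℝ) : ∀ᵐ x : EuclideanSpace ℝ (Fin n), ∀ c, x c ≠ r c := by
  refine ae_all_iff.2 fun c => ?_
  rw [ae_iff]
  simpa using volume_hyperplane c (r c)

/-- Almost every point is an interior point of the dyadic cells that contain it. -/
lemma ae_eventually_cellOf_eq : ∀ᵐ z : EuclideanSpace ℝ (Fin n),
    ∀ M, ∀ᶠ x in 𝓝 z, cellOf (mesh M) x = cellOf (mesh M) z := by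
  refine ae_all_iff.2 fun M => ?_
  have h : ∀ᵐ z : EuclideanSpace ℝ (Fin n), ∀ c, ∀ r : ℤ, z c ≠ mesh M * r := by
    refine ae_all_iff.2 fun c => ae_all_iff.2 fun r => ?_
    rw [ae_iff]
    simpa using volume_hyperplane c (mesh M * r)
  filter_upwards [h] with z hz
  have hmem := (mem_cell (mesh_pos M)).2 (rfl : cellOf (mesh M) z = _)
  have hev : ∀ᶠ x : EuclideanSpace ℝ (Fin n) in 𝓝 z, ∀ c,
      cellCorner (mesh M) (cellOf (mesh M) z) c < x c ∧
        x c < cellCorner (mesh M) (cellOf (mesh M) z) c + mesh M := by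
    refine eventually_all.2 fun c => ?_
    have hc : Continuous fun x : EuclideanSpace ℝ (Fin n) => x c := by fun_prop
    exact (hc.continuousAt.eventually_const_lt ((hmem c).1.lt_of_ne (hz c _).symm)).and
      (hc.continuousAt.eventually_lt_const (hmem c).2)
  filter_upwards [hev] with x hx
  exact (mem_cell (mesh_pos M)).1 fun c => ⟨(hx c).1.le, (hx c).2⟩

/-- Off the hyperplanes that bound a cube, sufficiently small dyadic cells are contained in it or
disjoint from it. -/
lemma eventually_cubeInd_eq (a : EuclideanSpace ℝ (Fin n)) (l : ℝ) {z : EuclideanSpace ℝ (Fin n)}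
    (h1 : ∀ c, z c ≠ a c) (h2 : ∀ c, z c ≠ a c + l) :
    ∀ᶠ M in atTop, ∀ x, cellOf (mesh M) x = cellOf (mesh M) z →
      cubeInd 𝕜 a l x = cubeInd 𝕜 a l z := by
  have hsmall : ∀ r : ℝ, 0 < r → ∀ᶠ M in atTop, mesh M < r := fun r hr =>
    tendsto_mesh.eventually_lt_const hr
  have hev : ∀ᶠ M in atTop, ∀ c, mesh M < |z c - a c| ∧ mesh M < |z c - (a c + l)| :=
    eventually_all.2 fun c => (hsmall _ (abs_pos.2 (sub_ne_zero.2 (h1 c)))).and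
      (hsmall _ (abs_pos.2 (sub_ne_zero.2 (h2 c))))
  filter_upwards [hev] with M hM x hx
  have hmem : x ∈ cube a l ↔ z ∈ cube a l := by
    refine forall_congr' fun c => ?_
    have hx' := (mem_cell (mesh_pos M)).2 hx c
    have hz' := (mem_cell (mesh_pos M)).2 (rfl : cellOf (mesh M) z = _) c
    obtain ⟨h3, h4⟩ := hM c
    rcases abs_cases (z c - a c) with ⟨h5, _⟩ | ⟨h5, _⟩ <;>
    rcases abs_cases (z c - (a c + l)) with ⟨h6, _⟩ | ⟨h6, _⟩ <;> rw [h5] at h3 <;> rw [h6] at h4 <;>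
    constructor <;> rintro ⟨h7, h8⟩ <;> constructor <;> linarith
  by_cases hz : z ∈ cube a l
  · simp [cubeInd, hz, hmem.2 hz]
  · simp [cubeInd, hz, mt hmem.1 hz]

/-- Almost every point is an interior point of a dyadic cell on which the indicator of a given cube
is constant. -/
lemma ae_exists_cubeInd_eq (a : EuclideanSpace ℝ (Fin n)) (l : ℝ) :
    ∀ᵐ z, ∃ M, (∀ᶠ x in 𝓝 z, cellOf (mesh M) x = cellOf (mesh M) z) ∧
      ∀ x, cellOf (mesh M) x = cellOf (mesh M) z → cubeInd 𝕜 a l x = cubeInd 𝕜 a l z := by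
  filter_upwards [ae_apply_ne fun c => a c, ae_apply_ne fun c => a c + l,
    ae_eventually_cellOf_eq] with z h1 h2 h3
  obtain ⟨M, hM⟩ := (eventually_cubeInd_eq (𝕜 := 𝕜) a l h1 h2).exists
  exact ⟨M, h3 M, hM⟩

lemma ae_continuousAt_cubeInd (a : EuclideanSpace ℝ (Fin n)) (l : ℝ) :
    ∀ᵐ z, ContinuousAt (cubeInd 𝕜 a l) z := by
  filter_upwards [ae_exists_cubeInd_eq (𝕜 := 𝕜) a l] with z ⟨M, h1, h2⟩
  exact (continuousAt_const (y := cubeInd 𝕜 a l z)).congr (h1.mono fun x hx => (h2 x hx).symm)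

lemma cubeInd_eq_zero (a : EuclideanSpace ℝ (Fin n)) (l : ℝ) (x : EuclideanSpace ℝ (Fin n))
    (c : Fin n) (hx : ‖a‖ + |l| < |x c|) : cubeInd 𝕜 a l x = 0 := by
  refine Set.indicator_of_notMem (fun h => ?_) _
  have h1 := abs_le.1 (PiLp.norm_apply_le a c)
  have h2 := h c
  have h3 := le_abs_self l
  have h4 := abs_nonneg l
  rcases abs_cases (x c) with ⟨h5, _⟩ | ⟨h5, _⟩ <;> linarith

lemma norm_cubeInd_le (a : EuclideanSpace ℝ (Fin n)) (l : ℝ) (x : EuclideanSpace ℝ (Fin n)) :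
    ‖cubeInd 𝕜 a l x‖ ≤ 1 := by
  by_cases h : x ∈ cube a l <;> simp [cubeInd, h]

variable (𝕜) in
/-- The union of the dyadic cells of level `N` whose lower corner belongs to a given cube, as a step
function. -/
def cubeSample (a : EuclideanSpace ℝ (Fin n)) (l : ℝ) (N : ℕ) : stepFun n 𝕜 :=
  ∑ j ∈ (finite_support_corner (cubeInd_eq_zero (𝕜 := 𝕜) a l) (mesh_pos N)).toFinset,
    cellStep 𝕜 (mesh_pos N) j

lemma cubeSample_apply (a : EuclideanSpace ℝ (Fin n)) (l : ℝ) (N : ℕ)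
    (x : EuclideanSpace ℝ (Fin n)) :
    (cubeSample 𝕜 a l N : EuclideanSpace ℝ (Fin n) → 𝕜) x = cubeInd 𝕜 a l (corner N x) := by
  refine (sum_cellStep_apply (mesh_pos N) _ x).trans ?_
  simp only [Set.Finite.mem_toFinset, Function.mem_support]
  by_cases h : corner N x ∈ cube a l
  · have h' : cubeInd 𝕜 a l (corner N x) = 1 := by simp [cubeInd, h]
    rw [h', if_pos]
    exact h'.trans_ne one_ne_zero
  · have h' : cubeInd 𝕜 a l (corner N x) = 0 := by simp [cubeInd, h]
    rw [h', if_neg]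
    exact not_not.2 h'

/-- Almost everywhere, the images of the dyadic approximations of a cube converge to the image of
the cube: near almost every point `z`, the approximations agree with the cube, and so the
difference is given by the kernel, off `z`. -/
lemma IsSingularIntegral.ae_tendsto_cubeSample (hT : IsSingularIntegral K T) (hα : 0 < α)
    (hK : IsStandardKernel α CK K) (a : EuclideanSpace ℝ (Fin n)) {l : ℝ} (hl : 0 < l) :
    ∀ᵐ z, Tendsto (fun N => T (cubeSample 𝕜 a l N) z) atTop (𝓝 (T (cubeStep 𝕜 a hl) z)) := by
  -- `b ∈ {0, 1}` is the value of the indicator on the dyadic cell with index `j` and level `M`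
  have hrepr : ∀ f : stepFun n 𝕜, ∀ᵐ z, ∀ (b M : ℕ) (j : Cell n),
      z ∉ tsupport (f - (b : 𝕜) • cellStep 𝕜 (mesh_pos M) j : EuclideanSpace ℝ (Fin n) → 𝕜) →
      T f z = (b : 𝕜) * T (cellStep 𝕜 (mesh_pos M) j) z
        + ∫ y, K z y * (f - (b : 𝕜) • cellStep 𝕜 (mesh_pos M) j :
          EuclideanSpace ℝ (Fin n) → 𝕜) y := by
    intro f
    refine ae_all_iff.2 fun b => ae_all_iff.2 fun M => ae_all_iff.2 fun j => ?_
    have h1 := hT.repr (f - (b : 𝕜) • cellStep 𝕜 (mesh_pos M) j)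
    rw [map_sub, map_smul] at h1
    filter_upwards [h1, AEEqFun.coeFn_sub (T f) ((b : 𝕜) • T (cellStep 𝕜 (mesh_pos M) j)),
      AEEqFun.coeFn_smul (b : 𝕜) (T (cellStep 𝕜 (mesh_pos M) j))] with z h1 h2 h3 hz
    have h4 := h1 hz
    rw [h2, Pi.sub_apply, h3, Pi.smul_apply, smul_eq_mul, sub_eq_iff_eq_add'] at h4
    exact h4
  have hcorner : ∀ᵐ y, Tendsto (fun N => cubeInd 𝕜 a l (corner N y)) atTop
      (𝓝 (cubeInd 𝕜 a l y)) := by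
    filter_upwards [ae_continuousAt_cubeInd (𝕜 := 𝕜) a l] with y hy
    exact hy.tendsto.comp (tendsto_corner y)
  filter_upwards [ae_all_iff.2 fun N => hrepr (cubeSample 𝕜 a l N), hrepr (cubeStep 𝕜 a hl),
    ae_exists_cubeInd_eq (𝕜 := 𝕜) a l] with z hz1 hz2 hz
  obtain ⟨M, hM1, hM2⟩ := hz
  obtain ⟨b, hb, hb1⟩ : ∃ b : ℕ, cubeInd 𝕜 a l z = b ∧ b ≤ 1 := by
    by_cases h : z ∈ cube a l
    · exact ⟨1, by simp [cubeInd, h], le_rfl⟩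
    · exact ⟨0, by simp [cubeInd, h], zero_le_one⟩
  set j := cellOf (mesh M) z with hj
  set P := cellStep 𝕜 (mesh_pos M) j with hP
  have hzero : ∀ y, cellOf (mesh M) y = j → cubeInd 𝕜 a l y
      - ((b : 𝕜) • P : EuclideanSpace ℝ (Fin n) → 𝕜) y = 0 := by
    intro y hy
    rw [Pi.smul_apply, cellStep_apply, if_pos hy, hM2 y hy, hb, smul_eq_mul, mul_one, sub_self]
  have hcell : ∀ {N}, M ≤ N → ∀ y, cellOf (mesh M) y = j →
      cubeInd 𝕜 a l (corner N y) - ((b : 𝕜) • P : EuclideanSpace ℝ (Fin n) → 𝕜) y = 0 := by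
    intro N hN y hy
    rw [← hzero y hy, hM2 y hy, hM2 _ ((cellOf_corner hN y).trans hy)]
  obtain ⟨r, hr, hball⟩ := Metric.eventually_nhds_iff_ball.1 hM1
  -- the kernel, truncated near `z`
  set k : EuclideanSpace ℝ (Fin n) → 𝕜 := (Metric.ball z r)ᶜ.indicator (K z) with hk
  have hne : ∀ y ∈ (Metric.ball z r)ᶜ, r ≤ ‖z - y‖ ∧ z ≠ y := by
    intro y hy
    rw [Set.mem_compl_iff, Metric.mem_ball, not_lt, dist_comm, dist_eq_norm] at hy
    refine ⟨hy, fun h => ?_⟩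
    rw [h, sub_self, norm_zero] at hy
    linarith
  have hkm : AEStronglyMeasurable k volume :=
    (aestronglyMeasurable_indicator_iff Metric.isOpen_ball.measurableSet.compl).2
      (ContinuousOn.aestronglyMeasurable (fun y hy =>
        (hK.continuousAt_right hα (hne y hy).2).continuousWithinAt)
        Metric.isOpen_ball.measurableSet.compl)
  have hkb : ∀ y, ‖k y‖ ≤ CK / r ^ n := by
    intro y
    by_cases hy : y ∈ (Metric.ball z r)ᶜ
    · rw [hk, Set.indicator_of_mem hy]
      refine (hK.size z y (hne y hy).2).trans ?_
      have := (hne y hy).1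
      gcongr
    · rw [hk, Set.indicator_of_notMem hy, norm_zero]
      positivity
  have hrep : ∀ (f : stepFun n 𝕜) (g : EuclideanSpace ℝ (Fin n) → 𝕜),
      (∀ y, (f : EuclideanSpace ℝ (Fin n) → 𝕜) y = g y) →
      (∀ y, cellOf (mesh M) y = j → g y - ((b : 𝕜) • P : EuclideanSpace ℝ (Fin n) → 𝕜) y = 0) →
      (z ∉ tsupport (f - (b : 𝕜) • P : EuclideanSpace ℝ (Fin n) → 𝕜) →
      T f z = (b : 𝕜) * T P z
        + ∫ y, K z y * (f - (b : 𝕜) • P : EuclideanSpace ℝ (Fin n) → 𝕜) y) →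
      T f z = (b : 𝕜) * T P z
        + ∫ y, k y * (g y - ((b : 𝕜) • P : EuclideanSpace ℝ (Fin n) → 𝕜) y) := by
    intro f g hfg hg h
    rw [h]
    · congr 1
      refine integral_congr_ae (Eventually.of_forall fun y => ?_)
      beta_reduce
      rw [Pi.sub_apply, hfg]
      by_cases hy : y ∈ (Metric.ball z r)ᶜ
      · rw [hk, Set.indicator_of_mem hy]
      · rw [hg y (hball y (not_not.1 hy)), mul_zero, mul_zero]
    · rw [notMem_tsupport_iff_eventuallyEq]
      filter_upwards [Metric.ball_mem_nhds z hr] with y hy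
      rw [Pi.sub_apply, hfg, hg y (hball y hy)]
      rfl
  rw [hrep _ _ (fun y => rfl) hzero (hz2 b M j)]
  have hlim : Tendsto (fun N => ∫ y, k y * (cubeInd 𝕜 a l (corner N y)
      - ((b : 𝕜) • P : EuclideanSpace ℝ (Fin n) → 𝕜) y)) atTop
      (𝓝 (∫ y, k y * (cubeInd 𝕜 a l y - ((b : 𝕜) • P : EuclideanSpace ℝ (Fin n) → 𝕜) y))) := by
    have hPm : AEStronglyMeasurable ((b : 𝕜) • P : EuclideanSpace ℝ (Fin n) → 𝕜) volume :=
      (stepFun_memLp P 1).aestronglyMeasurable.const_smul _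
    set R := ‖a‖ + |l| with hR
    set S := cube (WithLp.toLp 2 fun _ : Fin n => -(R + 2)) (2 * (R + 2)) ∪ cell (mesh M) j with hS
    refine tendsto_integral_of_dominated_convergence (S.indicator fun _ => CK / r ^ n * (1 + 1))
      (fun N => hkm.mul ((measurable_comp_corner N _).aestronglyMeasurable.sub hPm)) ?_
      (fun N => Eventually.of_forall fun y => ?_) ?_
    · refine (integrable_indicator_iff ((measurableSet_cube _ _).union (measurableSet_cell _))).2 ?_
      refine integrableOn_const ?_
      exact ((measure_union_le _ _).trans_lt (ENNReal.add_lt_top.2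
        ⟨volume_cube_lt_top _ _, volume_cube_lt_top _ _⟩)).ne
    · by_cases hy : y ∈ S
      · rw [Set.indicator_of_mem hy, norm_mul]
        have h1 : ‖((b : 𝕜) • P : EuclideanSpace ℝ (Fin n) → 𝕜) y‖ ≤ 1 := by
          rw [Pi.smul_apply, cellStep_apply, smul_eq_mul]
          interval_cases b <;> split_ifs <;> simp
        gcongr
        · exact hkb y
        · exact (norm_sub_le _ _).trans (add_le_add (norm_cubeInd_le _ _ _) h1)
      · have h1 : cellOf (mesh M) y ≠ j := fun h => hy (Or.inr ((mem_cell (mesh_pos M)).2 h))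
        have h2 := comp_corner_eq_zero (cubeInd_eq_zero (𝕜 := 𝕜) a l) N fun h => hy (Or.inl h)
        rw [Set.indicator_of_notMem hy, h2.1, Pi.smul_apply, cellStep_apply, if_neg h1]
        simp
    · filter_upwards [hcorner] with y hy
      exact (hy.sub_const _).const_mul _
  refine (hlim.const_add _).congr' ?_
  filter_upwards [eventually_ge_atTop M] with N hN
  exact (hrep _ _ (cubeSample_apply a l N) (hcell hN) (hz1 N b M j)).symm

variable {X : Type*} [NormedAddCommGroup X] [NormedSpace 𝕜 X] {p : ℝ≥0∞} [Fact (1 ≤ p)]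

/-- A bounded operator that agrees with `T` on dyadic cells agrees with `T` on all step
functions. -/
lemma IsSingularIntegral.mem_agreeStep (hT : IsSingularIntegral K T) (hα : 0 < α)
    (hK : IsStandardKernel α CK K) (hp' : p ≠ ∞)
    {U : Lp X p (volume : Measure (EuclideanSpace ℝ (Fin n))) →L[𝕜]
      Lp X p (volume : Measure (EuclideanSpace ℝ (Fin n)))}
    (hU : ∀ N j, cellStep 𝕜 (mesh_pos N) j ∈ agreeStep T U) (f : stepFun n 𝕜) :
    f ∈ agreeStep T U := by
  have hp : p ≠ 0 := (zero_lt_one.trans_le (Fact.out : 1 ≤ p)).ne'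
  have hcube : ∀ (a : EuclideanSpace ℝ (Fin n)) (l : ℝ) (hl : 0 < l),
      cubeStep 𝕜 a hl ∈ agreeStep T U := by
    intro a l hl x
    have hlim : Tendsto (fun N => stepTensor p (cubeSample 𝕜 a l N) x) atTop
        (𝓝 (stepTensor p (cubeStep 𝕜 a hl) x)) := by
      rw [Lp.tendsto_Lp_iff_tendsto_eLpNorm']
      have h1 := tendsto_eLpNorm_comp_corner_sub hp hp'
        (F := fun y => cubeInd 𝕜 a l y • x) (M := ‖x‖) (R := ‖a‖ + |l|)
        (stepFun_smul_memLp (cubeStep 𝕜 a hl) x p).aestronglyMeasurable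
        (fun y => by
          rw [norm_smul]
          exact mul_le_of_le_one_left (norm_nonneg _) (norm_cubeInd_le a l y))
        (fun y c hy => by rw [cubeInd_eq_zero a l y c hy, zero_smul])
        ((ae_continuousAt_cubeInd (𝕜 := 𝕜) a l).mono fun y hy => hy.smul continuousAt_const)
      refine h1.congr fun N => eLpNorm_congr_ae ?_
      filter_upwards [coeFn_stepTensor (p := p) (cubeSample 𝕜 a l N) x,
        coeFn_stepTensor (p := p) (cubeStep 𝕜 a hl) x] with y h2 h3
      rw [Pi.sub_apply, h2, h3, cubeSample_apply]
      rfl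
    have hUlim := (U.continuous.tendsto _).comp hlim
    -- along a subsequence, convergence in `L^p` implies convergence almost everywhere
    obtain ⟨N, hmono, hN⟩ := (tendstoInMeasure_of_tendsto_Lp hUlim).exists_seq_tendsto_ae
    have hmem : ∀ N, cubeSample 𝕜 a l N ∈ agreeStep T U := fun N => by
      unfold cubeSample
      exact Submodule.sum_mem _ fun j _ => hU N j
    have hmem' : ∀ᵐ z, ∀ N, U (stepTensor p (cubeSample 𝕜 a l N) x) z
        = T (cubeSample 𝕜 a l N) z • x :=
      ae_all_iff.2 fun N => mem_agreeStep_iff.1 (hmem N) x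
    filter_upwards [hN, hT.ae_tendsto_cubeSample hα hK a hl,
      ae_all_iff.2 fun N => hmem N x] with z h1 h2 h3
    refine tendsto_nhds_unique h1 (((h2.comp hmono.tendsto_atTop).smul_const x).congr fun i => ?_)
    exact (h3 (N i)).symm
  have hle : stepFun n 𝕜 ≤ (agreeStep T U).map (stepFun n 𝕜).subtype := by
    refine Submodule.span_le.2 ?_
    rintro _ ⟨a, l, hl, rfl⟩
    exact ⟨cubeStep 𝕜 a hl, hcube a l hl, rfl⟩
  obtain ⟨g, hg, hgf⟩ := hle f.2
  rwa [← Subtype.ext hgf]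

end DyadicApproximation

end

theorem theorem1p1 (n : ℕ) (hn : 0 < n) (α : ℝ) (hα : 0 < α) (cK cW : ℝ) :
    ∃ C : ℝ≥0,
      ∀ (𝕜 : Type*) [RCLike 𝕜]
        (X : Type*) [NormedAddCommGroup X] [NormedSpace ℝ X] [NormedSpace 𝕜 X]
        [IsScalarTower ℝ 𝕜 X] [CompleteSpace X] (_ : IsUMD X)
        (p : ℝ≥0∞) [Fact (1 ≤ p)] (_ : 1 < p) (_ : p < ∞)
        (K : EuclideanSpace ℝ (Fin n) → EuclideanSpace ℝ (Fin n) → 𝕜)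
        (T : stepFun n 𝕜 →ₗ[𝕜] (EuclideanSpace ℝ (Fin n) →ₘ[volume] 𝕜)),
        IsStandardKernel α cK K → IsSingularIntegral K T → WeakBoundedness cW T →
        VanishesOnOne T → AdjointVanishesOnOne T →
        ∃ U : Lp X p (volume : Measure (EuclideanSpace ℝ (Fin n))) →L[𝕜]
            Lp X p (volume : Measure (EuclideanSpace ℝ (Fin n))),
          (∀ (f : stepFun n 𝕜) (x : X),
            (U (stepTensor p f x) : EuclideanSpace ℝ (Fin n) → X) =ᵐ[volume]
              fun t => T f t • x) ∧
          ‖U‖ₑ ≤ C * umdConst (volume : Measure (EuclideanSpace ℝ (Fin n))) p X ^ 2 := by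
  have : NeZero n := ⟨hn.ne'⟩
  obtain ⟨C', hC'⟩ := exists_isCellCZ_czMatrix.{_} (n := n)
  have hfin := tsum_czWeight_lt_top (n := n) hα
    (czConst n α (cW.toNNReal + (n + 1) * (cK.toNNReal * C')) cK.toNNReal)
  refine ⟨ENNReal.toNNReal (∑' m : Cell n, 2 ^ n * (96 * (n * (ancestorLevel m + 2) + 1 : ℕ)) *
    (czWeight α (czConst n α (cW.toNNReal + (n + 1) * (cK.toNNReal * C')) cK.toNNReal) m : ℝ≥0∞)),
    ?_⟩
  intro 𝕜 _ X _ _ _ _ _ hX p _ hp hp' K T hK hT hW hV hV'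
  -- `cK` and `cW` may be replaced by their positive parts
  have hK' := hK.toNNReal
  have hW' : WeakBoundedness (cW.toNNReal : ℝ) T := fun a l hl =>
    (hW a l hl).trans (mul_le_mul_of_nonneg_right (Real.le_coe_toNNReal cW) measureReal_nonneg)
  have ha := fun δ hδ => (hC' 𝕜 α _ _ K T hα hK' hT hW' hV hV' δ hδ).isDyadicCZ hα
  have hβ := hX.umdConst_lt_top hp hp' (volume : Measure (EuclideanSpace ℝ (Fin n)))
  obtain ⟨U, hU, hnorm⟩ := exists_extension (T := T) hp'.ne
    (ENNReal.mul_ne_top hfin.ne (ENNReal.pow_ne_top hβ.ne))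
    fun δ hδ h => hT.eLpNorm_stepImage_le hp.le hp'.ne (hX.isDiscreteUMDBound hp hp') ha hδ h
  refine ⟨U, hT.mem_agreeStep hα hK' hp'.ne hU, hnorm.trans_eq ?_⟩
  rw [ENNReal.coe_toNNReal hfin.ne]
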